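/- Let $n\ge 2$ and let $M$ be a smooth manifold of dimension $2n$ with an almost para-quaternionic structure $\mathcal Q\subset \mathrm{End}(TM)$, i.e. a rank $3$ subbundle locally spanned by smooth $I,J,K$ with $I^2=J^2=\mathrm{id}$ and $K=IJ=-JI$. Let $\mathcal Z^0=\{A\in\mathcal Q: A\circ A=0,\ A\neq 0\}$ be its $0$-twistor space. The equivalent almost Grassmannian structure is the $GL(2,\mathbb R)\otimes GL(n,\mathbb R)$-structure $\mathcal G_0\to M$ whose points over $x$ are the linear isomorphisms $u:\mathbb R^{2*}\otimes\mathbb R^n=\mathrm{Hom}(\mathbb R^2,\mathbb R^n)\to T_xM$ that carry the endomorphisms $X\mapsto X\circ a$ with $\mathrm{tr}\,a=0$ onto $\mathcal Q_x$; the pair $(A,B)$ acts on the right by $(u\cdot(A,B))(X)=u(BXA^{-1})$. Its correspondence space is $\mathcal CM=\mathcal G_0/Q_0$, where $Q_0$ is the subgroup of those $(A,B)$ for which $A$ stabilizes the line $\langle e_1\rangle\subset\mathbb R^2$. (a) With its quotient manifold structure, $\mathcal CM$ is a smooth manifold of dimension $2n+1$, the projection $\mathcal CM\to M$ is a surjective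 submersion, and its vertical subbundle $D\subset T(\mathcal CM)$ is a line bundle. (b) There is a bijection $\Phi:\mathcal Z^0\to D\setminus\{\text{zero section}\}$ over $M$ which is smooth with smooth inverse (as a map between subsets of the manifolds $\mathrm{End}(TM)$ and $T(\mathcal CM)$) and canonical in the following sense: if $u\in\mathcal G_0$ lies over $x$ and $A\in\mathcal Z^0_x$ is given by $A(u(X))=u(X\circ j^0)$ with $j^0=\begin{pmatrix}0&1\\0&0\end{pmatrix}$, then $$\Phi(A)=\frac{d}{dt}\Big|_{t=0}\Big[u\cdot\Big(\begin{pmatrix}1&0\\t&1\end{pmatrix},\mathrm{id}\Big)\Big]\in D_{[u]} .$$ For $c\ne 0$ the vectors $\Phi(cA)$ and $\Phi(A)$ have the same base point in $\mathcal CM$, and $\Phi(cA)=c^{-1}\Phi(A)$. (c) The projectivization $\mathcal P\mathcal Z^0=\mathcal Z^0/\mathbb R^\times$ has a quotient manifold structure, and sending the line of $A$ to the base point of $\Phi(A)$ defines a diffeomorphism $\mathcal P\mathcal Z^0\to\mathcal CM$ over $M$. (d) If $(\mathcal G\to M,\omega)$ is any normal parabolic geometry of type $PGL(2+n,\mathbb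 R)/P$ that induces this almost Grassmannian structure, where $P$ is the stabilizer of $\langle e_1,e_2\rangle$ and $Q\subset P$ the stabilizer of the flag $\langle e_1\rangle\subset\langle e_1,e_2\rangle$ in $\mathbb R^{2+n}$, then the orbit space $\mathcal G/Q$ has a quotient manifold structure, and the map that sends a point of $\mathcal G$ to the frame of $M$ determined by $\omega$ induces a diffeomorphism $\mathcal G/Q\to\mathcal CM$. (e) If $E$ and $F$ are smooth vector bundles of ranks $2$ and $n$ over $M$ and $\psi:E^*\otimes F\to TM$ is an isomorphism of smooth vector bundles under which $\mathcal Q$ consists of the endomorphisms $X\mapsto X\circ a$ with $a\in\mathrm{End}(E)$ trace-free, then $\mathcal PE$ has a quotient manifold structure, and there is a diffeomorphism $\mathcal PE\to\mathcal CM$ such that the line of $e(e_1)$ goes to $[u]$ whenever $u(X)=\psi(f\circ X\circ e^{-1})$ is a frame given by isomorphisms $e:\mathbb R^2\to E_x$ and $f:\mathbb R^n\to F_x$. -/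

import Mathlib

open scoped Manifold ContDiff Topology
open Bundle

noncomputable section

namespace ParaQuat

/-! ### Smooth maps out of subsets, and quotient manifolds -/

section Smooth

variable {X Y : Type*} [TopologicalSpace X] [TopologicalSpace Y]
  {EX HX EY HY : Type*}
  [NormedAddCommGroup EX] [NormedSpace ℝ EX] [TopologicalSpace HX]
  [NormedAddCommGroup EY] [NormedSpace ℝ EY] [TopologicalSpace HY]
  (I : ModelWithCorners ℝ EX HX) (J : ModelWithCorners ℝ EY HY)
  [ChartedSpace HX X] [ChartedSpace HY Y]

/-- Let `i : T → X` realise `T` as a subset of the manifold `X` (usually `i` is the coercion of a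
subtype, or the identity). A map `f : T → Y` into a manifold is smooth if it extends, locally
around each point of `T`, to a smooth map on an open subset of `X`. This is the standard notion
of a smooth map on an arbitrary subset of a manifold; on an embedded submanifold it is the
smoothness for the submanifold structure. -/
def SmoothAlong {T : Type*} (i : T → X) (f : T → Y) : Prop :=
  ∀ t : T, ∃ U : Set X, IsOpen U ∧ i t ∈ U ∧ ∃ F : X → Y,
    ContMDiffOn I J ∞ F U ∧ ∀ t' : T, i t' ∈ U → F (i t') = f t'

/-- The manifold structure on the quotient `Quot r` of the subset `T` of `X` is the quotient
manifold structure: the projection is smooth and it has a smooth local section through every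
point of `T` (it is a surjective submersion). There is at most one such structure. -/
def IsSmoothQuotient {T : Type*} [TopologicalSpace T] (i : T → X) (r : T → T → Prop)
    [ChartedSpace HY (Quot r)] : Prop :=
  SmoothAlong I J i (Quot.mk r) ∧
  ∀ t : T, ∃ W : Set (Quot r), IsOpen W ∧ Quot.mk r t ∈ W ∧ ∃ σ : Quot r → T,
    ContMDiffOn J I ∞ (fun b => i (σ b)) W ∧ σ (Quot.mk r t) = t ∧
    ∀ b ∈ W, Quot.mk r (σ b) = b

end Smooth

/-! ### Linear algebra of `ℝ^{2*} ⊗ ℝ^n` -/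

/-- `ℝ^{2*} ⊗ ℝ^n`, the space of linear maps `ℝ² → ℝⁿ`. -/
abbrev Std (n : ℕ) : Type := (Fin 2 → ℝ) →L[ℝ] (Fin n → ℝ)

/-- The first vector of the standard basis of `ℝ²`. -/
def e₁ : Fin 2 → ℝ := ![1, 0]

/-- The nilpotent endomorphism of `ℝ²` with matrix `(0 1; 0 0)`. -/
def j₀ : (Fin 2 → ℝ) →L[ℝ] (Fin 2 → ℝ) :=
  LinearMap.toContinuousLinearMap (Matrix.toLin' !![0, 1; 0, 0])

/-- The one-parameter group `(1 0; t 1)` of automorphisms of `ℝ²`. -/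
def shear (t : ℝ) : (Fin 2 → ℝ) ≃L[ℝ] (Fin 2 → ℝ) :=
  LinearEquiv.toContinuousLinearEquiv
    { toFun := fun v => ![v 0, v 1 + t * v 0]
      invFun := fun v => ![v 0, v 1 - t * v 0]
      map_add' := fun v w => by
        ext i; fin_cases i <;> simp; ring
      map_smul' := fun c v => by
        ext i; fin_cases i <;> simp; ring
      left_inv := fun v => by
        ext i; fin_cases i <;> simp
      right_inv := fun v => by
        ext i; fin_cases i <;> simp }

/-- Trace of an endomorphism of `ℝ²`. -/
def tr₂ (a : (Fin 2 → ℝ) →L[ℝ] (Fin 2 → ℝ)) : ℝ := LinearMap.trace ℝ _ a.toLinearMap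

lemma tr₂_conj (A : (Fin 2 → ℝ) ≃L[ℝ] (Fin 2 → ℝ)) (a : (Fin 2 → ℝ) →L[ℝ] (Fin 2 → ℝ)) :
    tr₂ (A.toContinuousLinearMap ∘L a ∘L A.symm.toContinuousLinearMap) = tr₂ a :=
  LinearMap.trace_conj' a.toLinearMap A.toLinearEquiv

/-! ### Almost para-quaternionic structures and their twistor spaces -/

section Manifold

variable {n : ℕ} {M : Type*} [TopologicalSpace M]
  [ChartedSpace (EuclideanSpace ℝ (Fin (2 * n))) M] [IsManifold (𝓡 (2 * n)) ∞ M]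

variable (n M) in
/-- The vector bundle `End(TM)` over a manifold of dimension `2n`. -/
abbrev EndT : Type _ :=
  TotalSpace (EuclideanSpace ℝ (Fin (2 * n)) →L[ℝ] EuclideanSpace ℝ (Fin (2 * n)))
    (fun x : M => TangentSpace (𝓡 (2 * n)) x →L[ℝ] TangentSpace (𝓡 (2 * n)) x)

/-- The model with corners of the manifold `End(TM)`. -/
abbrev modelEnd (n : ℕ) :=
  (𝓡 (2 * n)).prod
    𝓘(ℝ, EuclideanSpace ℝ (Fin (2 * n)) →L[ℝ] EuclideanSpace ℝ (Fin (2 * n)))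

/-- A fibrewise endomorphism field of `TM` that is smooth on `U`. -/
def SmoothEndOn (U : Set M)
    (A : ∀ x : M, TangentSpace (𝓡 (2 * n)) x →L[ℝ] TangentSpace (𝓡 (2 * n)) x) : Prop :=
  ContMDiffOn (𝓡 (2 * n)) (modelEnd n) ∞ (fun x => (⟨x, A x⟩ : EndT n M)) U

variable (n M) in
/-- An almost para-quaternionic structure on `M`: a subbundle of `End(TM)`, locally spanned by
smooth `I, J, K` with `I² = J² = id` and `K = IJ = -JI`. (For `n ≥ 1` the relations make `I, J, K`
linearly independent, so that the rank is 3.) -/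
structure AlmostParaQuaternionic where
  fiber : ∀ x : M, Submodule ℝ (TangentSpace (𝓡 (2 * n)) x →L[ℝ] TangentSpace (𝓡 (2 * n)) x)
  locally_spanned : ∀ x₀ : M, ∃ U : Set M, IsOpen U ∧ x₀ ∈ U ∧
    ∃ I J K : ∀ x : M, TangentSpace (𝓡 (2 * n)) x →L[ℝ] TangentSpace (𝓡 (2 * n)) x,
      SmoothEndOn U I ∧ SmoothEndOn U J ∧ SmoothEndOn U K ∧
      ∀ x ∈ U, I x ∘L I x = ContinuousLinearMap.id ℝ _ ∧
        J x ∘L J x = ContinuousLinearMap.id ℝ _ ∧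
        K x = I x ∘L J x ∧ K x = -(J x ∘L I x) ∧
        fiber x = Submodule.span ℝ {I x, J x, K x}

/-- The `s`-twistor space `{A ∈ 𝒬 : A ∘ A = s • id}`. -/
def twistorSpace (𝒬 : AlmostParaQuaternionic n M) (s : ℝ) : Set (EndT n M) :=
  {A | A.2 ∈ 𝒬.fiber A.1 ∧ A.2 ∘L A.2 = s • ContinuousLinearMap.id ℝ _}

/-- The bundle of light-like vectors: the `0`-twistor space without zero endomorphisms, i.e. the
bundle of almost tangent structures `im A = ker A` contained in `𝒬`. -/
def zeroTwistor (𝒬 : AlmostParaQuaternionic n M) : Set (EndT n M) :=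
  {A | A ∈ twistorSpace 𝒬 0 ∧ A.2 ≠ 0}

/-- Two elements of the `0`-twistor space span the same line. -/
def sameLine (𝒬 : AlmostParaQuaternionic n M) (A B : zeroTwistor 𝒬) : Prop :=
  ∃ c : ℝ, c ≠ 0 ∧ B.1 = ⟨A.1.1, c • A.1.2⟩

/-- The projectivization of the `0`-twistor space. -/
abbrev ProjZeroTwistor (𝒬 : AlmostParaQuaternionic n M) : Type _ := Quot (sameLine 𝒬)

/-- The projection of `ProjZeroTwistor 𝒬` to `M`. -/
def ProjZeroTwistor.proj (𝒬 : AlmostParaQuaternionic n M) : ProjZeroTwistor 𝒬 → M :=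
  Quot.lift (fun A => A.1.1) (by rintro A B ⟨c, -, h⟩; simp [h])

/-! ### The equivalent almost Grassmannian structure and its correspondence space -/

variable (n M) in
/-- The vector bundle of linear maps `ℝ^{2*} ⊗ ℝ^n → T_x M`, which contains the frame bundle
of `M`. -/
abbrev FrameT : Type _ :=
  TotalSpace (Std n →L[ℝ] EuclideanSpace ℝ (Fin (2 * n)))
    (fun x : M => Trivial M (Std n) x →L[ℝ] TangentSpace (𝓡 (2 * n)) x)

/-- The model with corners of the manifold `FrameT n M`. -/
abbrev modelFrame (n : ℕ) :=
  (𝓡 (2 * n)).prod 𝓘(ℝ, Std n →L[ℝ] EuclideanSpace ℝ (Fin (2 * n)))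

/-- The right action of `(A, B) ∈ GL(2) × GL(n)` on frames,
`(u · (A, B)) X = u (B ∘ X ∘ A⁻¹)`. -/
def moveFrame (u : FrameT n M) (A : (Fin 2 → ℝ) ≃L[ℝ] (Fin 2 → ℝ))
    (B : (Fin n → ℝ) ≃L[ℝ] (Fin n → ℝ)) : FrameT n M :=
  ⟨u.1, ContinuousLinearMap.comp (M₁ := Std n) u.2
    ((ContinuousLinearEquiv.arrowCongr A B : Std n ≃L[ℝ] Std n) : Std n →L[ℝ] Std n)⟩

/-- The frames adapted to `𝒬`: the linear isomorphisms `u : ℝ^{2*} ⊗ ℝ^n → T_x M` that take the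
standard para-quaternionic structure `{X ↦ X ∘ a : tr a = 0}` to `𝒬_x`. They form the
`GL(2) ⊗ GL(n)`-structure that is the almost Grassmannian structure equivalent to `𝒬`. -/
def adaptedFrames (𝒬 : AlmostParaQuaternionic n M) : Set (FrameT n M) :=
  {u | Function.Bijective (fun X : Std n => u.2 X) ∧
    ∀ A : TangentSpace (𝓡 (2 * n)) u.1 →L[ℝ] TangentSpace (𝓡 (2 * n)) u.1,
      A ∈ 𝒬.fiber u.1 ↔ ∃ a : (Fin 2 → ℝ) →L[ℝ] (Fin 2 → ℝ), tr₂ a = 0 ∧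
        ∀ X : Std n, A (u.2 X) = u.2 (X ∘L a : Std n)}

lemma moveFrame_mem (𝒬 : AlmostParaQuaternionic n M) {u : FrameT n M} (hu : u ∈ adaptedFrames 𝒬)
    (A : (Fin 2 → ℝ) ≃L[ℝ] (Fin 2 → ℝ)) (B : (Fin n → ℝ) ≃L[ℝ] (Fin n → ℝ)) :
    moveFrame u A B ∈ adaptedFrames 𝒬 := by
  have key : ∀ X : Std n, (moveFrame u A B).2 X =
      u.2 (B.toContinuousLinearMap ∘L X ∘L A.symm.toContinuousLinearMap : Std n) := fun X => rfl
  refine ⟨?_, fun C => ?_⟩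
  · exact hu.1.comp (ContinuousLinearEquiv.arrowCongr A B : Std n ≃L[ℝ] Std n).bijective
  · refine (hu.2 C).trans ⟨?_, ?_⟩
    · rintro ⟨a, ha, h⟩
      refine ⟨A.symm.toContinuousLinearMap ∘L a ∘L A.toContinuousLinearMap, ?_, fun X => ?_⟩
      · rw [← ha]; exact tr₂_conj A.symm a
      · refine (h _).trans (congrArg (fun Y : Std n => u.2 Y) ?_)
        ext v i; simp
    · rintro ⟨a, ha, h⟩
      refine ⟨A.toContinuousLinearMap ∘L a ∘L A.symm.toContinuousLinearMap, ?_, fun X => ?_⟩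
      · rw [← ha]; exact tr₂_conj A a
      · have h1 := h (B.symm.toContinuousLinearMap ∘L X ∘L A.toContinuousLinearMap)
        have e : X = (B.toContinuousLinearMap ∘L
            (B.symm.toContinuousLinearMap ∘L X ∘L A.toContinuousLinearMap) ∘L
            A.symm.toContinuousLinearMap : Std n) := by ext v i; simp
        have e2 : (B.toContinuousLinearMap ∘L
            ((B.symm.toContinuousLinearMap ∘L X ∘L A.toContinuousLinearMap) ∘L a) ∘L
            A.symm.toContinuousLinearMap : Std n) =
            (X ∘L A.toContinuousLinearMap ∘L a ∘L A.symm.toContinuousLinearMap : Std n) := by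
          ext v i; simp
        exact (congrArg (fun Y : Std n => C (u.2 Y)) e).trans
          (h1.trans (congrArg (fun Y : Std n => u.2 Y) e2))

/-- Two adapted frames are related by an element `(A, B)` of the subgroup of `GL(2) × GL(n)` that
is given by `A` stabilizing the line `⟨e₁⟩`. -/
def sameFlag (𝒬 : AlmostParaQuaternionic n M) (u v : adaptedFrames 𝒬) : Prop :=
  ∃ (A : (Fin 2 → ℝ) ≃L[ℝ] (Fin 2 → ℝ)) (B : (Fin n → ℝ) ≃L[ℝ] (Fin n → ℝ)),
    (∃ c : ℝ, A e₁ = c • e₁) ∧ v.1 = moveFrame u.1 A B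

/-- The correspondence space `𝒞M = 𝒢₀ / Q₀` of the almost Grassmannian structure. -/
abbrev CorrSpace (𝒬 : AlmostParaQuaternionic n M) : Type _ := Quot (sameFlag 𝒬)

/-- The projection `𝒞M → M`. -/
def CorrSpace.proj (𝒬 : AlmostParaQuaternionic n M) : CorrSpace 𝒬 → M :=
  Quot.lift (fun u => u.1.1) (by rintro u v ⟨A, B, -, h⟩; simp [h, moveFrame])

/-- The model with corners of manifolds of dimension `2n + 1`. -/
abbrev modelC (n : ℕ) := 𝓘(ℝ, EuclideanSpace ℝ (Fin (2 * n)) × ℝ)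

/-- The vertical subbundle `D ⊂ T(𝒞M)` of the projection `𝒞M → M`. -/
def verticalBundle (𝒬 : AlmostParaQuaternionic n M)
    [ChartedSpace (EuclideanSpace ℝ (Fin (2 * n)) × ℝ) (CorrSpace 𝒬)] :
    Set (TangentBundle (modelC n) (CorrSpace 𝒬)) :=
  {v | mfderiv (modelC n) (𝓡 (2 * n)) (CorrSpace.proj 𝒬) v.1 v.2 = 0}

/-- The vertical subbundle without its zero section. -/
def verticalNonzero (𝒬 : AlmostParaQuaternionic n M)
    [ChartedSpace (EuclideanSpace ℝ (Fin (2 * n)) × ℝ) (CorrSpace 𝒬)] :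
    Set (TangentBundle (modelC n) (CorrSpace 𝒬)) :=
  {v | v ∈ verticalBundle 𝒬 ∧ v.2 ≠ 0}

/-- The curve `t ↦ [u · (1 0; t 1)]` in the fibre of `𝒞M → M` through `[u]`. -/
def flagCurve (𝒬 : AlmostParaQuaternionic n M) (u : adaptedFrames 𝒬) (t : ℝ) : CorrSpace 𝒬 :=
  Quot.mk _ ⟨moveFrame u.1 (shear t) (ContinuousLinearEquiv.refl ℝ _), moveFrame_mem 𝒬 u.2 _ _⟩

/-- The velocity at `t = 0` of `flagCurve 𝒬 u`. -/
def flagVelocity (𝒬 : AlmostParaQuaternionic n M)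
    [ChartedSpace (EuclideanSpace ℝ (Fin (2 * n)) × ℝ) (CorrSpace 𝒬)] (u : adaptedFrames 𝒬) :
    TangentBundle (modelC n) (CorrSpace 𝒬) :=
  ⟨flagCurve 𝒬 u 0, mfderiv 𝓘(ℝ, ℝ) (modelC n) (flagCurve 𝒬 u) 0 (1 : ℝ)⟩

end Manifold

/-! ### Parabolic geometries of type `PGL(2+n) / P` -/

section Parabolic

/-- Square matrices with blocks of sizes `2` and `n`. -/
abbrev Mat (n : ℕ) : Type := Matrix (Fin 2 ⊕ Fin n) (Fin 2 ⊕ Fin n) ℝ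

/-- The Lie algebra `𝔤 = 𝔰𝔩(2+n, ℝ)`. -/
abbrev slAlg (n : ℕ) := LieAlgebra.SpecialLinear.sl (Fin 2 ⊕ Fin n) ℝ

/-- Vanishing of the lower left block. -/
def BlockUpper {n : ℕ} (p : Mat n) : Prop := ∀ a b, p (Sum.inr a) (Sum.inl b) = 0

/-- The invertible matrices that represent elements of `P ⊂ PGL(2+n, ℝ)`, the stabilizer of
`⟨e₁, e₂⟩`. -/
def MemP {n : ℕ} (p : Mat n) : Prop := p.det ≠ 0 ∧ BlockUpper p

/-- The invertible matrices that represent elements of `Q ⊂ PGL(2+n, ℝ)`, the stabilizer of the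
flag `⟨e₁⟩ ⊂ ⟨e₁, e₂⟩`. -/
def MemQ {n : ℕ} (p : Mat n) : Prop := MemP p ∧ p (Sum.inl 1) (Sum.inl 0) = 0

/-- The basis element of `𝔤₋₁` with entry `1` at position `(a, b)` of the lower left block. -/
def negElem {n : ℕ} (a : Fin n) (b : Fin 2) : slAlg n :=
  LieAlgebra.SpecialLinear.single (R := ℝ) (Sum.inr a) (Sum.inl b) (by simp) 1

/-- The basis element of `𝔤₁` with entry `1` at position `(b, a)` of the upper right block; with
respect to the trace form these are dual to the basis `negElem` of `𝔤₋₁ ≅ 𝔤/𝔭`. -/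
def posElem {n : ℕ} (a : Fin n) (b : Fin 2) : slAlg n :=
  LieAlgebra.SpecialLinear.single (R := ℝ) (Sum.inl b) (Sum.inr a) (by simp) 1

/-- The inclusion of `𝔤₋₁ ≅ ℝ^{2*} ⊗ ℝ^n` in `𝔤` as the lower left block. -/
def negIncl (n : ℕ) : Std n →ₗ[ℝ] slAlg n :=
  ∑ a : Fin n, ∑ b : Fin 2,
    ((LinearMap.proj a ∘ₗ LinearMap.applyₗ (Pi.single b (1 : ℝ)) ∘ₗ
        (ContinuousLinearMap.coeLM ℝ : Std n →ₗ[ℝ] _)) : Std n →ₗ[ℝ] ℝ).smulRight (negElem a b)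

variable (n : ℕ) (M : Type*) [TopologicalSpace M]
  [ChartedSpace (EuclideanSpace ℝ (Fin (2 * n))) M] [IsManifold (𝓡 (2 * n)) ∞ M]
  (𝒢 : Type*) [TopologicalSpace 𝒢]
  [ChartedSpace (EuclideanSpace ℝ (Fin (n ^ 2 + 4 * n + 3))) 𝒢]
  [IsManifold (𝓡 (n ^ 2 + 4 * n + 3)) ∞ 𝒢]

/-- A Cartan geometry `(𝒢 → M, conn)` of type `G/P` with `G = PGL(2+n, ℝ)`.
An element of `P` is represented by a block triangular invertible matrix `p`, unique up to
scalar multiples; the values of `act` on other matrices are irrelevant. -/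
structure CartanGeometry where
  /-- the bundle projection -/
  proj : 𝒢 → M
  /-- the principal right action of `P` -/
  act : 𝒢 → Mat n → 𝒢
  act_one : ∀ u, act u 1 = u
  act_mul : ∀ u p q, MemP p → MemP q → act u (p * q) = act (act u p) q
  /-- scalar matrices, and only they, have fixed points -/
  act_eq_self_iff : ∀ u p, MemP p → (act u p = u ↔ ∃ c : ℝ, p = c • (1 : Mat n))
  /-- the fibres are the orbits -/
  proj_eq_iff : ∀ u v, proj u = proj v ↔ ∃ p, MemP p ∧ v = act u p
  smooth_proj : ContMDiff (𝓡 (n ^ 2 + 4 * n + 3)) (𝓡 (2 * n)) ∞ proj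
  local_section : ∀ x₀ : M, ∃ U : Set M, IsOpen U ∧ x₀ ∈ U ∧ ∃ σ : M → 𝒢,
    ContMDiffOn (𝓡 (2 * n)) (𝓡 (n ^ 2 + 4 * n + 3)) ∞ σ U ∧ ∀ x ∈ U, proj (σ x) = x
  smooth_act : SmoothAlong
    ((𝓡 (n ^ 2 + 4 * n + 3)).prod 𝓘(ℝ, Fin 2 ⊕ Fin n → Fin 2 ⊕ Fin n → ℝ))
    (𝓡 (n ^ 2 + 4 * n + 3))
    (fun w : {w : 𝒢 × (Fin 2 ⊕ Fin n → Fin 2 ⊕ Fin n → ℝ) // MemP (Matrix.of w.2)} => w.1)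
    (fun w => act w.1.1 (Matrix.of w.1.2))
  /-- the Cartan connection -/
  conn : ∀ u : 𝒢, TangentSpace (𝓡 (n ^ 2 + 4 * n + 3)) u ≃ₗ[ℝ] slAlg n
  smooth_conn : ∀ i j, ContMDiff (𝓡 (n ^ 2 + 4 * n + 3)).tangent 𝓘(ℝ, ℝ) ∞
    (fun v : TangentBundle (𝓡 (n ^ 2 + 4 * n + 3)) 𝒢 => (conn v.1 v.2 : Mat n) i j)
  equivariant : ∀ p, MemP p → ∀ u ξ,
    (conn (act u p) (mfderiv (𝓡 (n ^ 2 + 4 * n + 3)) (𝓡 (n ^ 2 + 4 * n + 3))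
      (fun v => act v p) u ξ) : Mat n) = p⁻¹ * (conn u ξ : Mat n) * p
  /-- `conn` reproduces the generators of the fundamental vector fields -/
  reproduces : ∀ X : slAlg n, BlockUpper (X : Mat n) → ∀ u,
    conn _ (mfderiv 𝓘(ℝ, ℝ) (𝓡 (n ^ 2 + 4 * n + 3))
      (fun t : ℝ => act u (NormedSpace.exp (t • (X : Mat n)))) 0 (1 : ℝ)) = X

variable {n M 𝒢}

/-- The curvature function `κ(X, Y) = [X, Y] - conn [conn⁻¹ X, conn⁻¹ Y]` of a Cartan connection. -/
def CartanGeometry.curvature (Γ : CartanGeometry n M 𝒢) (u : 𝒢) (X Y : slAlg n) : slAlg n :=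
  ⁅X, Y⁆ - Γ.conn u (VectorField.mlieBracket (𝓡 (n ^ 2 + 4 * n + 3))
    (fun v => (Γ.conn v).symm X) (fun v => (Γ.conn v).symm Y) u)

/-- Normality `∂*κ = 0` of a Cartan geometry. -/
def CartanGeometry.IsNormal (Γ : CartanGeometry n M 𝒢) : Prop :=
  ∀ (u : 𝒢) (X : slAlg n),
    ∑ a : Fin n, ∑ b : Fin 2, ⁅posElem a b, Γ.curvature u X (negElem a b)⁆ = 0

/-- The frame `ℝ^{2*} ⊗ ℝ^n ≅ 𝔤₋₁ ≅ 𝔤/𝔭 ≅ T_x M` that the Cartan connection assigns to a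
point `u` of `𝒢` over `x`. -/
def CartanGeometry.frame (Γ : CartanGeometry n M 𝒢) (u : 𝒢) : FrameT n M :=
  ⟨Γ.proj u,
    (mfderiv (𝓡 (n ^ 2 + 4 * n + 3)) (𝓡 (2 * n)) Γ.proj u) ∘L
      (LinearMap.toContinuousLinearMap
        ((Γ.conn u).symm.toLinearMap ∘ₗ negIncl n) :
          Std n →L[ℝ] TangentSpace (𝓡 (n ^ 2 + 4 * n + 3)) u)⟩

/-- The Cartan geometry induces the almost Grassmannian structure equivalent to `𝒬`. -/
def CartanGeometry.Induces (Γ : CartanGeometry n M 𝒢) (𝒬 : AlmostParaQuaternionic n M) : Prop :=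
  ∀ u : 𝒢, Γ.frame u ∈ adaptedFrames 𝒬

/-- Two points lie in the same `Q`-orbit; the quotient is the correspondence space `𝒢/Q`. -/
def CartanGeometry.sameOrbit (Γ : CartanGeometry n M 𝒢) (u v : 𝒢) : Prop :=
  ∃ p, MemQ p ∧ v = Γ.act u p

end Parabolic

/-! ### Global auxiliary bundles -/

section Auxiliary

variable {n : ℕ} {M : Type*} [TopologicalSpace M]
  [ChartedSpace (EuclideanSpace ℝ (Fin (2 * n))) M] [IsManifold (𝓡 (2 * n)) ∞ M]
  (E F : M → Type*)
  [TopologicalSpace (TotalSpace (Fin 2 → ℝ) E)] [∀ x, AddCommGroup (E x)] [∀ x, Module ℝ (E x)]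
  [∀ x, TopologicalSpace (E x)] [∀ x, IsTopologicalAddGroup (E x)]
  [∀ x, ContinuousSMul ℝ (E x)]
  [FiberBundle (Fin 2 → ℝ) E] [VectorBundle ℝ (Fin 2 → ℝ) E]
  [TopologicalSpace (TotalSpace (Fin n → ℝ) F)] [∀ x, AddCommGroup (F x)] [∀ x, Module ℝ (F x)]
  [∀ x, TopologicalSpace (F x)] [∀ x, IsTopologicalAddGroup (F x)]
  [∀ x, ContinuousSMul ℝ (F x)]
  [FiberBundle (Fin n → ℝ) F] [VectorBundle ℝ (Fin n → ℝ) F]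

variable {E F} in
/-- The fibrewise isomorphism `ψ : E* ⊗ F = Hom(E, F) → TM` is smooth, i.e. an isomorphism of
smooth vector bundles. -/
def SmoothIso (ψ : ∀ x, (E x →L[ℝ] F x) ≃ₗ[ℝ] TangentSpace (𝓡 (2 * n)) x) : Prop :=
  ContMDiff ((𝓡 (2 * n)).prod 𝓘(ℝ, Std n)) (𝓡 (2 * n)).tangent ∞
    (fun w : TotalSpace (Std n) (fun x => E x →L[ℝ] F x) =>
      (⟨w.1, ψ w.1 w.2⟩ : TangentBundle (𝓡 (2 * n)) M))

variable {E F} in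
/-- `E* ⊗ F ≅ TM` is an almost Grassmannian structure equivalent to `𝒬`: the elements of `𝒬`
are given by the trace-free endomorphisms of `E`. -/
def EquivalentTo (ψ : ∀ x, (E x →L[ℝ] F x) ≃ₗ[ℝ] TangentSpace (𝓡 (2 * n)) x)
    (𝒬 : AlmostParaQuaternionic n M) : Prop :=
  ∀ (x : M) (A : TangentSpace (𝓡 (2 * n)) x →L[ℝ] TangentSpace (𝓡 (2 * n)) x),
    A ∈ 𝒬.fiber x ↔ ∃ a : E x →L[ℝ] E x, LinearMap.trace ℝ _ a.toLinearMap = 0 ∧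
      ∀ X : E x →L[ℝ] F x, A (ψ x X) = ψ x (X ∘L a)

/-- The complement of the zero section in `E`. -/
abbrev NonzeroVec : Type _ := {v : TotalSpace (Fin 2 → ℝ) E // v.2 ≠ 0}

/-- Two non-zero vectors span the same line. -/
def sameLineE (v w : NonzeroVec E) : Prop :=
  ∃ c : ℝ, c ≠ 0 ∧ w.1 = ⟨v.1.1, c • v.1.2⟩

/-- The projectivization `P E`. -/
abbrev ProjBundle : Type _ := Quot (sameLineE E)

end Auxiliary

end ParaQuat

end

open ParaQuat

open scoped Manifold ContDiff Topology
open Bundle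

noncomputable section

namespace ParaQuat

/-! ### Smooth maps out of quotients -/

section Quotients

variable {X Y Z : Type*} [TopologicalSpace X] [TopologicalSpace Y] [TopologicalSpace Z]
  {EX HX EY HY EZ HZ : Type*}
  [NormedAddCommGroup EX] [NormedSpace ℝ EX] [TopologicalSpace HX]
  [NormedAddCommGroup EY] [NormedSpace ℝ EY] [TopologicalSpace HY]
  [NormedAddCommGroup EZ] [NormedSpace ℝ EZ] [TopologicalSpace HZ]
  {I : ModelWithCorners ℝ EX HX} {J : ModelWithCorners ℝ EY HY} {K : ModelWithCorners ℝ EZ HZ}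
  [ChartedSpace HX X] [ChartedSpace HY Y] [ChartedSpace HZ Z]

/-! An adapted frame `u` carries `j₀` to a nilpotent `conjR u j₀` in the `0`-twistor space. Two
adapted frames at one point differ by some `(A, B)` in `GL(2) × GL(n)`: the transition map
normalizes right multiplication by 2×2 matrices, so it induces an automorphism of the matrix
algebra, and this is inner (`exists_eq_arrowCongr`). The change of frame replaces `j₀` by `A j₀
A⁻¹`, whose image and kernel are the line of `A e₁`. Hence the class of a frame modulo `Q₀` is the
line of its nilpotent (`sameFlag_iff`), and every non-zero nilpotent in `𝒬` comes from a frame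
(`exists_frame_of_zeroTwistor`).

Through every adapted frame there is a smooth local one, `s` (`exists_localFrame`). Relative to `s`,
a nilpotent whose upper right entry `z` is non-zero has the matrix `z (-t 1; -t² t)`; here `z` is
its scale and `t` the slope of its line. The point of `M` and the slope are coordinates on the
correspondence space, with the frames `s_x · (1 0; t 1)` as slices (`exists_corrSpace_manifold`).

The canonical map rests on one computation, `flagVelocity_eq`. Let `w` and `z` be the columns of `A`
and `d` its determinant. The frame `s_x · (A, B)` has scale `w₀² / d`, and its flag curve has slope
`(w₁ + τ z₁) / (w₀ + τ z₀)`, with derivative `d / w₀²` at `τ = 0`. The velocity is therefore the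
reciprocal of the scale, times the coordinate vector of the slope. It depends on the nilpotent
alone, is homogeneous of degree `-1`, and in coordinates the map is `(x, z, t) ↦ (x, t, z⁻¹)`, a
smooth bijection with smooth inverse.

The three diffeomorphisms with `𝒞M` are instances of `exists_quotient_diffeo`: a smooth surjection
with smooth local sections through every point identifies the quotient by its fibres with its
target. For `𝒵⁰` the surjection is the base point of the velocity. For `𝒢` it is the class of
`Γ.frame u`, where `p ∈ P` acts on frames through its diagonal blocks (`frame_act`), so that the
fibres are the `Q`-orbits. For `E` it is the class of any frame built from an isomorphism `e` with
`e e₁ = v`; only the line of `v` matters (`mk_bundleLin_eq_iff`). -/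

lemma SmoothAlong.contMDiffAt_comp {T : Type*} {i : T → X} {f : T → Y}
    (hf : SmoothAlong I J i f) {τ : Z → T} {p : Z}
    (hτ : ContMDiffAt K I ∞ (fun q => i (τ q)) p) :
    ContMDiffAt K J ∞ (fun q => f (τ q)) p := by
  obtain ⟨U, hU, hpU, F, hF, hFf⟩ := hf (τ p)
  have h1 : ContMDiffAt K J ∞ (fun q => F (i (τ q))) p :=
    ContMDiffAt.comp (f := fun q => i (τ q)) p (hF.contMDiffAt (hU.mem_nhds hpU)) hτ
  refine h1.congr_of_eventuallyEq ?_
  filter_upwards [hτ.continuousAt.preimage_mem_nhds (hU.mem_nhds hpU)] with q hq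
  exact (hFf (τ q) hq).symm

lemma SmoothAlong.continuous {T : Type*} [TopologicalSpace T] {i : T → X} (hi : Continuous i)
    {f : T → Y} (hf : SmoothAlong I J i f) : Continuous f := by
  rw [continuous_iff_continuousAt]
  intro t
  obtain ⟨U, hU, htU, F, hF, hFf⟩ := hf t
  have h1 : ContinuousAt (fun t' => F (i t')) t :=
    ContinuousAt.comp (hF.continuousOn.continuousAt (hU.mem_nhds htU)) hi.continuousAt
  refine h1.congr ?_
  filter_upwards [(hU.preimage hi).mem_nhds htU] with t' ht'
  exact hFf t' ht'

/-- Near the class of `t`, `f` is the composite of `F` with a smooth local section through `t`. The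
agreement of `F` with `f` is needed only at points in the image of `i`. -/
lemma IsSmoothQuotient.contMDiffAt {T : Type*} [TopologicalSpace T] {i : T → X}
    {r : T → T → Prop} [ChartedSpace HY (Quot r)] (hq : IsSmoothQuotient I J i r)
    {f : Quot r → Z} {F : X → Z} {t : T} (hF : ContMDiffAt I K ∞ F (i t))
    (h : ∀ᶠ p in 𝓝 (i t), ∀ t', i t' = p → F p = f (Quot.mk r t')) :
    ContMDiffAt J K ∞ f (Quot.mk r t) := by
  obtain ⟨W, hW, htW, σ, hσ, hσt, hσW⟩ := hq.2 t
  have h0 : ContMDiffAt J I ∞ (fun b => i (σ b)) (Quot.mk r t) := hσ.contMDiffAt (hW.mem_nhds htW)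
  have h1 : ContMDiffAt J K ∞ (fun b => F (i (σ b))) (Quot.mk r t) :=
    ContMDiffAt.comp (f := fun b => i (σ b)) _ (by rw [hσt]; exact hF) h0
  refine h1.congr_of_eventuallyEq ?_
  have h2 := h0.continuousAt.eventually
    (p := fun p => ∀ t', i t' = p → F p = f (Quot.mk r t')) (by simpa only [hσt] using h)
  filter_upwards [h2, hW.mem_nhds htW] with b hb hbW
  rw [hb (σ b) rfl, hσW b hbW]

lemma IsSmoothQuotient.contMDiffAt_mk_comp {T : Type*} [TopologicalSpace T] {i : T → X}
    {r : T → T → Prop} [ChartedSpace HY (Quot r)] (hq : IsSmoothQuotient I J i r)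
    {τ : Z → T} {p : Z} (hτ : ContMDiffAt K I ∞ (fun q => i (τ q)) p) :
    ContMDiffAt K J ∞ (fun q => Quot.mk r (τ q)) p :=
  hq.1.contMDiffAt_comp hτ

/-- A manifold structure on `Quot r` from slices `σ : E → T` and invariant functions `c : T → E`. -/
theorem exists_quotient_manifold {T E : Type*} [TopologicalSpace T]
    [NormedAddCommGroup E] [NormedSpace ℝ E] {i : T → X} (hi : Topology.IsInducing i)
    (r : T → T → Prop)
    (h : ∀ t₀ : T, ∃ (D : Set T) (c : T → E) (V : Set E) (σ : E → T),
      IsOpen D ∧ IsOpen V ∧ t₀ ∈ D ∧ σ (c t₀) = t₀ ∧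
      (∀ t t', r t t' → (t ∈ D ↔ t' ∈ D)) ∧ (∀ t t', r t t' → t ∈ D → c t = c t') ∧
      (∀ t ∈ D, c t ∈ V ∧ Quot.mk r (σ (c t)) = Quot.mk r t) ∧
      (∀ y ∈ V, σ y ∈ D ∧ c (σ y) = y) ∧
      (∀ t ∈ D, ∃ U : Set X, IsOpen U ∧ i t ∈ U ∧ ∃ C : X → E, ContMDiffOn I 𝓘(ℝ, E) ∞ C U ∧
        ∀ t', i t' ∈ U → t' ∈ D ∧ C (i t') = c t') ∧
      ContMDiffOn 𝓘(ℝ, E) I ∞ (fun y => i (σ y)) V) :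
    ∃ (_ : ChartedSpace E (Quot r)) (_ : IsManifold 𝓘(ℝ, E) ∞ (Quot r)),
      IsSmoothQuotient I 𝓘(ℝ, E) i r := by
  choose D c V σ hD hV htD hσt hrD hrc hcV hσV hC hσ using h
  have hccont : ∀ t₀, ContinuousOn (c t₀) (D t₀) := fun t₀ t ht => by
    obtain ⟨U, hU, htU, C, hCs, hCc⟩ := hC t₀ t ht
    have h1 : ContinuousAt (fun t' => C (i t')) t :=
      ContinuousAt.comp (hCs.continuousOn.continuousAt (hU.mem_nhds htU)) hi.continuous.continuousAt
    refine (h1.congr ?_).continuousWithinAt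
    filter_upwards [(hU.preimage hi.continuous).mem_nhds htU] with t' ht'
    exact (hCc t' ht').2
  have hσcont : ∀ t₀, ContinuousOn (σ t₀) (V t₀) := fun t₀ =>
    hi.continuousOn_iff.2 (hσ t₀).continuousOn
  -- The set `D t₀` is saturated, so membership descends to the quotient; the descended set is open
  -- because its preimage is `D t₀`.
  let S : T → Set (Quot r) := fun t₀ =>
    {q | Quot.lift (fun t => t ∈ D t₀) (fun t t' htt => propext (hrD t₀ t t' htt)) q}
  have hS : ∀ t₀ t, Quot.mk r t ∈ S t₀ ↔ t ∈ D t₀ := fun t₀ t => Iff.rfl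
  have hSo : ∀ t₀, IsOpen (S t₀) := fun t₀ => isOpen_coinduced.2 (hD t₀)
  classical
  -- The value `0` outside `D t₀` is a filler that makes the function total.
  let cc : T → Quot r → E := fun t₀ => Quot.lift (fun t => if t ∈ D t₀ then c t₀ t else 0)
    (fun t t' htt => by
      by_cases ht : t ∈ D t₀
      · simp only [ht, (hrD t₀ t t' htt).1 ht, if_true]; exact hrc t₀ t t' htt ht
      · have ht' : t' ∉ D t₀ := fun h => ht ((hrD t₀ t t' htt).2 h)
        simp only [ht, ht', if_false])
  have hcc : ∀ t₀ t, t ∈ D t₀ → cc t₀ (Quot.mk r t) = c t₀ t := fun t₀ t ht => if_pos ht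
  let φ : T → OpenPartialHomeomorph (Quot r) E := fun t₀ =>
    { toFun := cc t₀
      invFun := fun y => Quot.mk r (σ t₀ y)
      source := S t₀
      target := V t₀
      map_source' := by
        rintro ⟨t⟩ ht
        rw [hcc t₀ t ht]; exact (hcV t₀ t ht).1
      map_target' := fun y hy => (hσV t₀ y hy).1
      left_inv' := by
        rintro ⟨t⟩ ht
        rw [hcc t₀ t ht]; exact (hcV t₀ t ht).2
      right_inv' := fun y hy => by
        rw [hcc t₀ _ (hσV t₀ y hy).1, (hσV t₀ y hy).2]
      open_source := hSo t₀
      open_target := hV t₀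
      continuousOn_toFun := by
        rw [continuousOn_open_iff (hSo t₀)]
        intro O hO
        refine isOpen_coinduced.2 ?_
        have := (hccont t₀).isOpen_inter_preimage (hD t₀) hO
        convert this using 1
        ext t
        constructor
        · rintro ⟨h1, h2⟩
          exact ⟨h1, by change c t₀ t ∈ O; rw [← hcc t₀ t h1]; exact h2⟩
        · rintro ⟨h1, h2⟩
          exact ⟨h1, by change cc t₀ (Quot.mk r t) ∈ O; rw [hcc t₀ t h1]; exact h2⟩
      continuousOn_invFun := continuous_quot_mk.comp_continuousOn (hσcont t₀) }
  let cs : ChartedSpace E (Quot r) :=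
    { atlas := Set.range φ
      chartAt := fun q => φ q.out
      mem_chart_source := fun q => by
        have : q = Quot.mk r q.out := q.out_eq.symm
        have h1 : Quot.mk r q.out ∈ S q.out := htD _
        rwa [← this] at h1
      chart_mem_atlas := fun q => ⟨_, rfl⟩ }
  -- A transition map is the invariant function of one chart along the slice of another. It is
  -- smooth because invariant functions extend locally to smooth functions on `X`.
  have key : ∀ t₀ t₁ y, y ∈ V t₀ → σ t₀ y ∈ D t₁ →
      ContMDiffAt 𝓘(ℝ, E) 𝓘(ℝ, E) ∞ (fun y => cc t₁ (Quot.mk r (σ t₀ y))) y := by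
    intro t₀ t₁ y hy hy1
    obtain ⟨U, hU, htU, C, hCs, hCc⟩ := hC t₁ _ hy1
    have h0 : ContMDiffAt 𝓘(ℝ, E) I ∞ (fun y => i (σ t₀ y)) y :=
      (hσ t₀).contMDiffAt ((hV t₀).mem_nhds hy)
    have h1 : ContMDiffAt 𝓘(ℝ, E) 𝓘(ℝ, E) ∞ (fun y => C (i (σ t₀ y))) y :=
      ContMDiffAt.comp (f := fun y => i (σ t₀ y)) y (hCs.contMDiffAt (hU.mem_nhds htU)) h0
    refine h1.congr_of_eventuallyEq ?_
    filter_upwards [h0.continuousAt.preimage_mem_nhds (hU.mem_nhds htU)] with y' hy'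
    rw [hcc t₁ _ (hCc _ hy').1, (hCc _ hy').2]
  have hm : IsManifold 𝓘(ℝ, E) ∞ (Quot r) := by
    refine isManifold_of_contDiffOn _ _ _ ?_
    rintro _ _ ⟨t₀, rfl⟩ ⟨t₁, rfl⟩
    simp only [modelWithCornersSelf_coe, modelWithCornersSelf_coe_symm, Set.range_id,
      Set.inter_univ, Set.preimage_id_eq, Function.id_comp, Function.comp_id, id_eq]
    intro y hy
    rw [OpenPartialHomeomorph.trans_source] at hy
    exact (key t₀ t₁ y hy.1 hy.2).contDiffAt.contDiffWithinAt
  refine ⟨cs, hm, ?_, ?_⟩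
  · intro t
    obtain ⟨U, hU, htU, C, hCs, hCc⟩ := hC t t (htD t)
    have hφ : φ t ∈ IsManifold.maximalAtlas 𝓘(ℝ, E) ∞ (Quot r) :=
      IsManifold.subset_maximalAtlas ⟨t, rfl⟩
    have hopen : IsOpen (U ∩ C ⁻¹' (V t)) := hCs.continuousOn.isOpen_inter_preimage hU (hV t)
    refine ⟨U ∩ C ⁻¹' (V t), hopen, ⟨htU, ?_⟩, fun x => (φ t).symm (C x), ?_, ?_⟩
    · change C (i t) ∈ V t
      rw [(hCc t htU).2]; exact (hcV t t (htD t)).1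
    · exact (contMDiffOn_symm_of_mem_maximalAtlas hφ).comp (hCs.mono Set.inter_subset_left)
        (fun x hx => hx.2)
    · rintro t' ⟨h1, h2⟩
      change Quot.mk r (σ t (C (i t'))) = Quot.mk r t'
      rw [(hCc t' h1).2]; exact (hcV t t' (hCc t' h1).1).2
  · intro t
    have hφ : φ t ∈ IsManifold.maximalAtlas 𝓘(ℝ, E) ∞ (Quot r) :=
      IsManifold.subset_maximalAtlas ⟨t, rfl⟩
    refine ⟨S t, hSo t, htD t, fun b => σ t (cc t b), ?_, ?_, ?_⟩
    · exact (hσ t).comp (contMDiffOn_of_mem_maximalAtlas hφ) (fun b hb => (φ t).map_source hb)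
    · change σ t (cc t (Quot.mk r t)) = t
      rw [hcc t t (htD t)]; exact hσt t
    · intro b hb
      exact (φ t).left_inv hb

/-- The quotient of `T` by the fibres of a submersion onto a manifold `C` is diffeomorphic
to `C`. -/
theorem exists_quotient_diffeo {T C E : Type*} [TopologicalSpace T] [TopologicalSpace C]
    [NormedAddCommGroup E] [NormedSpace ℝ E] [ChartedSpace E C] [IsManifold 𝓘(ℝ, E) ∞ C]
    {i : T → X} (hi : Topology.IsInducing i) (r : T → T → Prop) (ρ : T → C)
    (hρ : SmoothAlong I 𝓘(ℝ, E) i ρ) (hsurj : Function.Surjective ρ)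
    (hr : ∀ t t', r t t' → ρ t = ρ t') (hinj : ∀ t t', ρ t = ρ t' → r t t')
    (hsec : ∀ t, ∃ W : Set C, IsOpen W ∧ ρ t ∈ W ∧ ∃ σ : C → T,
      ContMDiffOn 𝓘(ℝ, E) I ∞ (fun b => i (σ b)) W ∧ σ (ρ t) = t ∧ ∀ b ∈ W, ρ (σ b) = b) :
    ∃ (_ : ChartedSpace E (Quot r)) (_ : IsManifold 𝓘(ℝ, E) ∞ (Quot r)),
      IsSmoothQuotient I 𝓘(ℝ, E) i r ∧
      ∃ χ : Diffeomorph 𝓘(ℝ, E) 𝓘(ℝ, E) (Quot r) C ∞, ∀ t, χ (Quot.mk r t) = ρ t := by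
  obtain ⟨cs, hm, hq⟩ := exists_quotient_manifold (E := E) (I := I) hi r (by
    intro t₀
    obtain ⟨W, hW, htW, σ, hσ, hσt, hσW⟩ := hsec t₀
    let e := chartAt E (ρ t₀)
    have hρc := hρ.continuous hi.continuous
    have hO : IsOpen (W ∩ e.source) := hW.inter e.open_source
    -- A chart of `C` composed with `ρ` is the invariant function, and the local section of `ρ` read
    -- in that chart is the slice.
    refine ⟨ρ ⁻¹' (W ∩ e.source), fun t => e (ρ t), e.target ∩ e.symm ⁻¹' W,
      fun y => σ (e.symm y), hO.preimage hρc, e.symm.isOpen_inter_preimage hW,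
      ⟨htW, mem_chart_source E _⟩, ?_, ?_, ?_, ?_, ?_, ?_, ?_⟩
    · change σ (e.symm (e (ρ t₀))) = t₀
      rw [e.left_inv (mem_chart_source E _), hσt]
    · intro t t' h
      simp only [Set.mem_preimage, hr t t' h]
    · intro t t' h _
      simp only [hr t t' h]
    · rintro t ⟨h1, h2⟩
      refine ⟨⟨e.map_source h2, ?_⟩, ?_⟩
      · change e.symm (e (ρ t)) ∈ W
        rwa [e.left_inv h2]
      · refine Quot.sound (hinj _ _ ?_)
        change ρ (σ (e.symm (e (ρ t)))) = ρ t
        rw [e.left_inv h2, hσW _ h1]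
    · rintro y ⟨h1, h2⟩
      have h3 : ρ (σ (e.symm y)) = e.symm y := hσW _ h2
      refine ⟨⟨?_, ?_⟩, ?_⟩
      · change ρ (σ (e.symm y)) ∈ W
        rw [h3]; exact h2
      · rw [h3]; exact e.map_target h1
      · change e (ρ (σ (e.symm y))) = y
        rw [h3, e.right_inv h1]
    · intro t ht
      obtain ⟨U, hU, htU, F, hF, hFf⟩ := hρ t
      refine ⟨U ∩ F ⁻¹' (W ∩ e.source), hF.continuousOn.isOpen_inter_preimage hU hO, ⟨htU, ?_⟩,
        fun x => e (F x), ?_, ?_⟩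
      · change F (i t) ∈ W ∩ e.source
        rw [hFf t htU]; exact ht
      · exact (contMDiffOn_chart (I := 𝓘(ℝ, E))).comp (hF.mono Set.inter_subset_left)
          (fun x hx => hx.2.2)
      · rintro t' ⟨h1, h2⟩
        have h3 := hFf t' h1
        refine ⟨?_, congrArg e h3⟩
        change ρ t' ∈ W ∩ e.source
        rw [← h3]; exact h2
    · exact hσ.comp ((contMDiffOn_chart_symm (I := 𝓘(ℝ, E))).mono Set.inter_subset_left)
        (fun y hy => hy.2))
  refine ⟨cs, hm, hq, ?_⟩
  let f : Quot r → C := Quot.lift ρ hr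
  have hbij : Function.Bijective f := by
    constructor
    · rintro ⟨t⟩ ⟨t'⟩ h
      exact Quot.sound (hinj t t' h)
    · intro c
      obtain ⟨t, rfl⟩ := hsurj c
      exact ⟨Quot.mk r t, rfl⟩
  refine ⟨⟨Equiv.ofBijective f hbij, ?_, ?_⟩, fun t => rfl⟩
  · rintro ⟨t⟩
    obtain ⟨U, hU, htU, F, hF, hFf⟩ := hρ t
    refine hq.contMDiffAt (F := F) (hF.contMDiffAt (hU.mem_nhds htU)) ?_
    filter_upwards [hU.mem_nhds htU] with p hp t' ht'
    subst ht'
    exact hFf t' hp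
  · intro c
    obtain ⟨t, rfl⟩ := hsurj c
    obtain ⟨W, hW, htW, σ, hσ, hσt, hσW⟩ := hsec t
    have h1 : ContMDiffAt 𝓘(ℝ, E) 𝓘(ℝ, E) ∞ (fun b => Quot.mk r (σ b)) (ρ t) :=
      hq.contMDiffAt_mk_comp (hσ.contMDiffAt (hW.mem_nhds htW))
    refine h1.congr_of_eventuallyEq ?_
    filter_upwards [hW.mem_nhds htW] with b hb
    refine (Equiv.symm_apply_eq _).2 ?_
    exact (hσW b hb).symm

end Quotients

/-! ### Endomorphisms of the plane -/

section Plane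

lemma tr₂_eq (a : (Fin 2 → ℝ) →L[ℝ] (Fin 2 → ℝ)) :
    tr₂ a = a (Pi.single 0 1) 0 + a (Pi.single 1 1) 1 := by
  rw [tr₂, LinearMap.trace_eq_matrix_trace ℝ (Pi.basisFun ℝ (Fin 2)), Matrix.trace_fin_two]
  simp

lemma plane_apply (a : (Fin 2 → ℝ) →L[ℝ] (Fin 2 → ℝ)) (v : Fin 2 → ℝ) (b : Fin 2) :
    a v b = v 0 * a (Pi.single 0 1) b + v 1 * a (Pi.single 1 1) b := by
  have h : v = v 0 • (Pi.single 0 1 : Fin 2 → ℝ) + v 1 • (Pi.single 1 1 : Fin 2 → ℝ) := by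
    ext i; fin_cases i <;> simp
  conv_lhs => rw [h]
  simp only [map_add, map_smul, Pi.add_apply, Pi.smul_apply, smul_eq_mul]

lemma plane_ext {a a' : (Fin 2 → ℝ) →L[ℝ] (Fin 2 → ℝ)}
    (h : ∀ b k : Fin 2, a (Pi.single k 1) b = a' (Pi.single k 1) b) : a = a' := by
  ext v b
  rw [plane_apply a, plane_apply a', h, h]

lemma e₁_eq : e₁ = Pi.single 0 1 := by
  ext i; fin_cases i <;> simp [e₁]

lemma j₀_apply (v : Fin 2 → ℝ) : j₀ v = ![v 1, 0] := by
  ext i; fin_cases i <;> simp [j₀, Matrix.mulVec, dotProduct]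

lemma j₀_comp_j₀ : j₀ ∘L j₀ = 0 := by
  ext v i; fin_cases i <;> simp [j₀_apply]

lemma tr₂_j₀ : tr₂ j₀ = 0 := by
  simp [tr₂_eq, j₀_apply]

lemma j₀_ne_zero : j₀ ≠ 0 := by
  intro h
  have := congrArg (fun a : (Fin 2 → ℝ) →L[ℝ] (Fin 2 → ℝ) => a (Pi.single 1 1) 0) h
  simp [j₀_apply] at this

/-- The endomorphism with matrix `(1 0; 0 -1)`. -/
def h₀ : (Fin 2 → ℝ) →L[ℝ] (Fin 2 → ℝ) :=
  LinearMap.toContinuousLinearMap (Matrix.toLin' !![1, 0; 0, -1])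

/-- The endomorphism with matrix `(0 0; 1 0)`. -/
def f₀ : (Fin 2 → ℝ) →L[ℝ] (Fin 2 → ℝ) :=
  LinearMap.toContinuousLinearMap (Matrix.toLin' !![0, 0; 1, 0])

lemma h₀_apply (v : Fin 2 → ℝ) : h₀ v = ![v 0, -v 1] := by
  ext i; fin_cases i <;> simp [h₀, Matrix.mulVec, dotProduct]

lemma f₀_apply (v : Fin 2 → ℝ) : f₀ v = ![0, v 0] := by
  ext i; fin_cases i <;> simp [f₀, Matrix.mulVec, dotProduct]

/-- The nilpotent endomorphism with matrix `z (-t 1; -t² t)`. -/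
def nilMat (z t : ℝ) : (Fin 2 → ℝ) →L[ℝ] (Fin 2 → ℝ) :=
  z • (j₀ - t • h₀ - t ^ 2 • f₀)

lemma nilMat_entries (z t : ℝ) :
    nilMat z t (Pi.single 0 1) 0 = -(z * t) ∧ nilMat z t (Pi.single 1 1) 0 = z ∧
    nilMat z t (Pi.single 0 1) 1 = -(z * t ^ 2) ∧ nilMat z t (Pi.single 1 1) 1 = z * t := by
  simp [nilMat, j₀_apply, h₀_apply, f₀_apply]

lemma nilMat_one_zero : nilMat 1 0 = j₀ := by simp [nilMat]

/-- A nilpotent endomorphism is determined by its last column if that does not vanish in the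
first place. -/
lemma eq_nilMat {a : (Fin 2 → ℝ) →L[ℝ] (Fin 2 → ℝ)} (htr : tr₂ a = 0) (hsq : a ∘L a = 0)
    (hz : a (Pi.single 1 1) 0 ≠ 0) :
    a = nilMat (a (Pi.single 1 1) 0) (a (Pi.single 1 1) 1 / a (Pi.single 1 1) 0) := by
  rw [tr₂_eq] at htr
  -- The lower right entry of `a² = 0` reads `a₁₀ a₀₁ + a₁₁² = 0`. With trace zero it fixes the
  -- first column, as `a₀₁ ≠ 0`.
  have h1 := congrArg (fun a : (Fin 2 → ℝ) →L[ℝ] (Fin 2 → ℝ) => a (Pi.single 1 1) 1) hsq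
  simp only [ContinuousLinearMap.comp_apply, zero_apply, Pi.zero_apply] at h1
  rw [plane_apply a (a (Pi.single 1 1))] at h1
  obtain ⟨n1, n2, n3, n4⟩ := nilMat_entries (a (Pi.single 1 1) 0)
    (a (Pi.single 1 1) 1 / a (Pi.single 1 1) 0)
  refine plane_ext fun b k => ?_
  fin_cases b <;> fin_cases k <;> simp only [Fin.zero_eta, Fin.mk_one, Fin.isValue, n1, n2, n3, n4]
  · field_simp; linarith
  · field_simp; linarith
  · field_simp

lemma shear_apply (t : ℝ) (v : Fin 2 → ℝ) : shear t v = ![v 0, v 1 + t * v 0] := rfl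

lemma shear_symm_apply (t : ℝ) (v : Fin 2 → ℝ) : (shear t).symm v = ![v 0, v 1 - t * v 0] := rfl

lemma shear_zero : shear 0 = ContinuousLinearEquiv.refl ℝ _ := by
  ext v i; fin_cases i <;> simp [shear_apply]

/-- `shear t` moves `e₁` to `(1, t)`, which spans the image and the kernel of the conjugate. As `t`
varies, every line of the plane occurs except that of `(0, 1)`. -/
lemma shear_conj (t : ℝ) :
    (shear t).toContinuousLinearMap ∘L j₀ ∘L (shear t).symm.toContinuousLinearMap =
      nilMat 1 t := by
  obtain ⟨n1, n2, n3, n4⟩ := nilMat_entries 1 t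
  refine plane_ext fun b k => ?_
  fin_cases b <;> fin_cases k <;>
    simp only [Fin.zero_eta, Fin.mk_one, Fin.isValue, n1, n2, n3, n4] <;>
    simp [shear_apply, shear_symm_apply, j₀_apply]
  ring

/-- The automorphism of the plane with columns `w` and `z`. -/
def ofColumns (w z : Fin 2 → ℝ) (h : w 0 * z 1 - w 1 * z 0 ≠ 0) :
    (Fin 2 → ℝ) ≃L[ℝ] (Fin 2 → ℝ) :=
  LinearEquiv.toContinuousLinearEquiv
    { toFun := fun v => v 0 • w + v 1 • z
      invFun := fun v => ![(v 0 * z 1 - v 1 * z 0) / (w 0 * z 1 - w 1 * z 0),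
        (w 0 * v 1 - w 1 * v 0) / (w 0 * z 1 - w 1 * z 0)]
      map_add' := fun v w => by simp only [Pi.add_apply]; module
      map_smul' := fun c v => by
        simp only [Pi.smul_apply, smul_eq_mul, RingHom.id_apply]; module
      left_inv := fun v => by
        ext i; fin_cases i <;> simp <;> rw [div_eq_iff h] <;> ring
      right_inv := fun v => by
        ext i; fin_cases i <;> simp <;>
          rw [div_mul_eq_mul_div, div_mul_eq_mul_div, ← add_div, div_eq_iff h] <;> ring }

lemma ofColumns_apply (w z : Fin 2 → ℝ) (h : w 0 * z 1 - w 1 * z 0 ≠ 0) (v : Fin 2 → ℝ) :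
    ofColumns w z h v = v 0 • w + v 1 • z := rfl

lemma ofColumns_e₁ (w z : Fin 2 → ℝ) (h : w 0 * z 1 - w 1 * z 0 ≠ 0) :
    ofColumns w z h e₁ = w := by
  simp [ofColumns_apply, e₁]

lemma exists_equiv_apply_e₁ {w : Fin 2 → ℝ} (hw : w ≠ 0) :
    ∃ A : (Fin 2 → ℝ) ≃L[ℝ] (Fin 2 → ℝ), A e₁ = w := by
  -- The second column is `w` turned by a right angle, so the determinant is the sum of the squares
  -- of the entries of `w`.
  refine ⟨ofColumns w ![-w 1, w 0] ?_, ofColumns_e₁ _ _ _⟩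
  intro h
  apply hw
  simp at h
  have h0 : w 0 = 0 := by nlinarith [mul_self_nonneg (w 0), mul_self_nonneg (w 1)]
  have h1 : w 1 = 0 := by nlinarith [mul_self_nonneg (w 0), mul_self_nonneg (w 1)]
  ext i; fin_cases i <;> simp [h0, h1]

/-- A non-zero square-zero endomorphism of the plane is conjugate to `j₀`. -/
lemma exists_conj_j₀ {a : (Fin 2 → ℝ) →L[ℝ] (Fin 2 → ℝ)} (hsq : a ∘L a = 0) (ha : a ≠ 0) :
    ∃ A : (Fin 2 → ℝ) ≃L[ℝ] (Fin 2 → ℝ),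
      A.toContinuousLinearMap ∘L j₀ ∘L A.symm.toContinuousLinearMap = a := by
  obtain ⟨z, hz⟩ : ∃ z, a z ≠ 0 := by
    by_contra! h
    exact ha (ContinuousLinearMap.ext h)
  have hw : a (a z) = 0 := DFunLike.congr_fun hsq z
  -- If `z` and `a z` were dependent, each coordinate of `a z` times `z` would be a multiple of `a
  -- z`. Applying `a`, which kills `a z` but not `z`, makes both coordinates vanish.
  have hdet : (a z) 0 * z 1 - (a z) 1 * z 0 ≠ 0 := by
    intro h
    have h0 : (a z 0) • z - (z 0) • a z = 0 := by
      ext i; fin_cases i <;> simp <;> linarith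
    have h1 : (a z 1) • z - (z 1) • a z = 0 := by
      ext i; fin_cases i <;> simp <;> linarith
    have h0' := congrArg a h0
    have h1' := congrArg a h1
    simp only [map_sub, map_smul, hw, smul_zero, sub_zero, map_zero, smul_eq_zero, hz,
      or_false] at h0' h1'
    exact hz (by ext i; fin_cases i <;> simp [h0', h1'])
  -- In the basis `(a z, z)` the matrix of `a` is that of `j₀`.
  refine ⟨ofColumns (a z) z hdet, ?_⟩
  ext v : 1
  obtain ⟨v, rfl⟩ := (ofColumns (a z) z hdet).surjective v
  simp only [ContinuousLinearMap.comp_apply, ContinuousLinearEquiv.coe_coe,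
    ContinuousLinearEquiv.symm_apply_apply]
  simp [ofColumns_apply, j₀_apply, hw]

/-- If `A` stabilizes `⟨e₁⟩`, then it rescales `j₀`. -/
lemma conj_j₀_of_flag {A : (Fin 2 → ℝ) ≃L[ℝ] (Fin 2 → ℝ)} {c : ℝ} (h : A e₁ = c • e₁) :
    ∃ k : ℝ, k ≠ 0 ∧
      A.toContinuousLinearMap ∘L j₀ ∘L A.symm.toContinuousLinearMap = k • j₀ := by
  have hc : c ≠ 0 := by
    rintro rfl
    rw [zero_smul, map_eq_zero_iff _ A.injective] at h
    simpa [e₁] using congrFun h 0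
  have hA1 : A (Pi.single 1 1) 1 ≠ 0 := by
    intro h1
    have h2 : A (c • Pi.single 1 1 - (A (Pi.single 1 1) 0) • e₁) = 0 := by
      rw [map_sub, map_smul, map_smul, h]
      ext i; fin_cases i <;> simp [e₁, h1]; ring
    rw [map_eq_zero_iff _ A.injective] at h2
    simpa [e₁, hc] using congrFun h2 1
  -- `A` is upper triangular, and conjugation scales `j₀` by the ratio of its diagonal entries.
  refine ⟨c / A (Pi.single 1 1) 1, div_ne_zero hc hA1, ?_⟩
  ext v : 1
  obtain ⟨v, rfl⟩ := A.surjective v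
  have h3 : j₀ v = v 1 • e₁ := by ext i; fin_cases i <;> simp [j₀_apply, e₁]
  have h4 := plane_apply A.toContinuousLinearMap v 1
  simp only [ContinuousLinearEquiv.coe_coe] at h4
  have h5 : A (Pi.single 0 1) = c • e₁ := by rw [← e₁_eq, h]
  simp only [ContinuousLinearMap.comp_apply, ContinuousLinearEquiv.coe_coe,
    ContinuousLinearEquiv.symm_apply_apply, smul_apply, h3, map_smul, h]
  ext i; fin_cases i
  · simp [j₀_apply, h4, h5, e₁]
    field_simp
  · simp [j₀_apply, e₁]

/-- The conjugate of `j₀` kills `A e₁`, so `k • j₀` does; the kernel of `j₀` is the line of `e₁`. -/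
lemma flag_of_conj_j₀ {A : (Fin 2 → ℝ) ≃L[ℝ] (Fin 2 → ℝ)} {k : ℝ} (hk : k ≠ 0)
    (h : A.toContinuousLinearMap ∘L j₀ ∘L A.symm.toContinuousLinearMap = k • j₀) :
    ∃ c : ℝ, A e₁ = c • e₁ := by
  have h1 := DFunLike.congr_fun h (A e₁)
  have h2 : j₀ e₁ = 0 := by ext i; fin_cases i <;> simp [j₀_apply, e₁]
  simp only [ContinuousLinearMap.comp_apply, ContinuousLinearEquiv.coe_coe,
    ContinuousLinearEquiv.symm_apply_apply, h2, map_zero, smul_apply,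
    j₀_apply] at h1
  have h3 := congrFun h1 0
  simp [hk] at h3
  refine ⟨A e₁ 0, ?_⟩
  ext i; fin_cases i
  · simp [e₁]
  · simpa [e₁] using h3

/-- The last column of `A j₀ A⁻¹` is `w₀ w / det A` with `w = A e₁`. -/
lemma conj_j₀_entries (A : (Fin 2 → ℝ) ≃L[ℝ] (Fin 2 → ℝ)) :
    ∃ d : ℝ, d ≠ 0 ∧
      d = A e₁ 0 * A (Pi.single 1 1) 1 - A e₁ 1 * A (Pi.single 1 1) 0 ∧
      ∀ b, (A.toContinuousLinearMap ∘L j₀ ∘L A.symm.toContinuousLinearMap) (Pi.single 1 1) b * d =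
        A e₁ 0 * A e₁ b := by
  set a := A.toContinuousLinearMap ∘L j₀ ∘L A.symm.toContinuousLinearMap with ha
  have h0 : a (A e₁) = 0 := by
    simp only [ha, ContinuousLinearMap.comp_apply, ContinuousLinearEquiv.coe_coe,
      ContinuousLinearEquiv.symm_apply_apply]
    rw [show j₀ e₁ = 0 by ext i; fin_cases i <;> simp [j₀_apply, e₁], map_zero]
  have h1 : a (A (Pi.single 1 1)) = A e₁ := by
    simp only [ha, ContinuousLinearMap.comp_apply, ContinuousLinearEquiv.coe_coe,
      ContinuousLinearEquiv.symm_apply_apply]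
    congr 1
    ext i; fin_cases i <;> simp [j₀_apply, e₁]
  refine ⟨_, ?_, rfl, fun b => ?_⟩
  · intro hd
    have hw : A e₁ ≠ 0 := by
      rw [Ne, map_eq_zero_iff _ A.injective]
      intro h; simpa [e₁] using congrFun h 0
    have h2 : A ((A e₁ 0) • Pi.single 1 1 - (A (Pi.single 1 1) 0) • e₁) = 0 := by
      rw [map_sub, map_smul, map_smul]
      ext i; fin_cases i <;> simp <;> linarith
    have h3 : A ((A e₁ 1) • Pi.single 1 1 - (A (Pi.single 1 1) 1) • e₁) = 0 := by
      rw [map_sub, map_smul, map_smul]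
      ext i; fin_cases i <;> simp <;> linarith
    rw [map_eq_zero_iff _ A.injective] at h2 h3
    have h2' := congrFun h2 1
    have h3' := congrFun h3 1
    simp [e₁] at h2' h3'
    apply hw
    ext i; fin_cases i
    · simpa [e₁] using h2'
    · simpa [e₁] using h3'
  -- Row `b` of the conjugate solves two linear equations, given by its values on the two columns of
  -- `A`. Eliminating the first entry is Cramer's rule.
  · have k0 := congrFun h0 b
    have k1 := congrFun h1 b
    rw [plane_apply] at k0 k1
    simp only [Pi.zero_apply] at k0
    linear_combination (A e₁ 0) * k1 - (A (Pi.single 1 1) 0) * k0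

end Plane

/-! ### Endomorphisms of `ℝ^{2*} ⊗ ℝ^n` -/

section Std

variable {n : ℕ}

local instance : NormedAddCommGroup (Std n) := ContinuousLinearMap.toNormedAddCommGroup

local instance : NormedSpace ℝ (Std n) := ContinuousLinearMap.toNormedSpace

local instance : NormedAddCommGroup (Std n →L[ℝ] Std n) := ContinuousLinearMap.toNormedAddCommGroup

local instance : NormedSpace ℝ (Std n →L[ℝ] Std n) := ContinuousLinearMap.toNormedSpace

/-- Composition from the right, as a linear map. -/
def rmulL (n : ℕ) : ((Fin 2 → ℝ) →L[ℝ] (Fin 2 → ℝ)) →L[ℝ] (Std n →L[ℝ] Std n) :=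
  (ContinuousLinearMap.compL ℝ (Fin 2 → ℝ) (Fin 2 → ℝ) (Fin n → ℝ)).flip

/-- The endomorphism `X ↦ X ∘ a` of `ℝ^{2*} ⊗ ℝ^n`. -/
def rmul (n : ℕ) (a : (Fin 2 → ℝ) →L[ℝ] (Fin 2 → ℝ)) : Std n →L[ℝ] Std n := rmulL n a

@[simp] lemma rmul_apply (a : (Fin 2 → ℝ) →L[ℝ] (Fin 2 → ℝ)) (X : Std n) :
    rmul n a X = X ∘L a := rfl

lemma contDiff_rmul : ContDiff ℝ ∞ (rmul n) := (rmulL n).contDiff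

lemma rmul_smul (c : ℝ) (a : (Fin 2 → ℝ) →L[ℝ] (Fin 2 → ℝ)) : rmul n (c • a) = c • rmul n a :=
  (rmulL n).map_smul c a

lemma rmul_zero : rmul n 0 = 0 := (rmulL n).map_zero

variable [NeZero n]

/-- A basis element of `ℝ^{2*} ⊗ ℝ^n`. -/
def stdElem (n : ℕ) [NeZero n] (b : Fin 2) : Std n :=
  (ContinuousLinearMap.proj b : (Fin 2 → ℝ) →L[ℝ] ℝ).smulRight (Pi.single (0 : Fin n) (1 : ℝ))

/-- The functional on endomorphisms of `ℝ^{2*} ⊗ ℝ^n` that recovers the entry at `(b, 1)` of `a`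
from `X ↦ X ∘ a`. -/
def lastCol (b : Fin 2) (C : Std n →L[ℝ] Std n) : ℝ := C (stdElem n b) (Pi.single 1 1) 0

lemma lastCol_rmul (b : Fin 2) (a : (Fin 2 → ℝ) →L[ℝ] (Fin 2 → ℝ)) :
    lastCol b (rmul n a) = a (Pi.single 1 1) b := by
  simp [lastCol, stdElem]

lemma lastCol_smul (b : Fin 2) (c : ℝ) (C : Std n →L[ℝ] Std n) :
    lastCol b (c • C) = c * lastCol b C := by
  simp [lastCol]

lemma contDiff_lastCol (b : Fin 2) : ContDiff ℝ ∞ (lastCol (n := n) b) := by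
  have h : lastCol (n := n) b = fun C => ((ContinuousLinearMap.proj (R := ℝ)
      (φ := fun _ : Fin n => ℝ) 0) ∘L
      (ContinuousLinearMap.apply ℝ (Fin n → ℝ) (Pi.single 1 1 : Fin 2 → ℝ)) ∘L
      (ContinuousLinearMap.apply ℝ (Std n) (stdElem n b))) C := rfl
  rw [h]
  exact ContinuousLinearMap.contDiff _

lemma rmul_injective : Function.Injective (rmul n) := by
  intro a a' h
  ext v b
  have := congrArg (fun C : Std n →L[ℝ] Std n => C (stdElem n b) v 0) h
  simpa [stdElem] using this

/-- A linear automorphism of `ℝ^{2*} ⊗ ℝ^n` that normalizes the para-quaternionic structure comes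
from `GL(2) × GL(n)`. -/
theorem exists_eq_arrowCongr (g : Std n ≃L[ℝ] Std n)
    (h : ∀ a : (Fin 2 → ℝ) →L[ℝ] (Fin 2 → ℝ), tr₂ a = 0 →
      ∃ a' : (Fin 2 → ℝ) →L[ℝ] (Fin 2 → ℝ), ∀ X : Std n, g (X ∘L a) = g X ∘L a') :
    ∃ (A : (Fin 2 → ℝ) ≃L[ℝ] (Fin 2 → ℝ)) (B : (Fin n → ℝ) ≃L[ℝ] (Fin n → ℝ)),
      ∀ X, g X = ContinuousLinearEquiv.arrowCongr A B X := by
  -- Every matrix is trace-free up to a multiple of the identity, and multiples of the identity pass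
  -- through `g`.
  have h' : ∀ a : (Fin 2 → ℝ) →L[ℝ] (Fin 2 → ℝ),
      ∃ a' : (Fin 2 → ℝ) →L[ℝ] (Fin 2 → ℝ), ∀ X : Std n, g (X ∘L a) = g X ∘L a' := by
    intro a
    let m := tr₂ a / 2
    obtain ⟨a', ha'⟩ := h (a - m • ContinuousLinearMap.id ℝ _) (by
      simp [tr₂_eq, m]; ring)
    refine ⟨a' + m • ContinuousLinearMap.id ℝ _, fun X => ?_⟩
    have h1 : X ∘L a = X ∘L (a - m • ContinuousLinearMap.id ℝ _) + m • X := by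
      ext v; simp
    rw [h1, map_add, ha', map_smul, ContinuousLinearMap.comp_add]
    congr 1
    ext v; simp
  choose f hf using h'
  -- Right multiplication is faithful and `g` is onto, so the matrix assigned to `a` is unique.
  -- Uniqueness makes `f` linear and multiplicative.
  have huniq : ∀ a a', (∀ X : Std n, g (X ∘L a) = g X ∘L a') → f a = a' := by
    intro a a' haa
    refine rmul_injective (n := n) (ContinuousLinearMap.ext fun Y => ?_)
    obtain ⟨X, rfl⟩ := g.surjective Y
    rw [rmul_apply, rmul_apply, ← hf, haa]
  let F : ((Fin 2 → ℝ) →L[ℝ] (Fin 2 → ℝ)) →ₐ[ℝ] ((Fin 2 → ℝ) →L[ℝ] (Fin 2 → ℝ)) :=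
    AlgHom.ofLinearMap
      { toFun := f
        map_add' := fun a b => huniq _ _ fun X => by
          rw [ContinuousLinearMap.comp_add, map_add, hf, hf, ContinuousLinearMap.comp_add]
        map_smul' := fun c a => huniq _ _ fun X => by
          rw [ContinuousLinearMap.comp_smul, map_smul, hf, RingHom.id_apply,
            ContinuousLinearMap.comp_smul] }
      (huniq _ _ fun X => rfl)
      (fun a b => huniq _ _ fun X => by
        change g ((X ∘L a) ∘L b) = (g X ∘L f a) ∘L f b
        rw [hf, hf])
  have hinj : Function.Injective F := by
    rw [injective_iff_map_eq_zero]
    intro a ha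
    refine rmul_injective (n := n) (ContinuousLinearMap.ext fun X => g.injective ?_)
    rw [rmul_apply, rmul_apply, hf, show f a = 0 from ha]
    simp
  have hbij : Function.Bijective F :=
    ⟨hinj, LinearMap.surjective_of_injective (f := F.toLinearMap) hinj⟩
  let Fe := AlgEquiv.ofBijective F hbij
  let Fc : ((Fin 2 → ℝ) →L[ℝ] (Fin 2 → ℝ)) ≃A[ℝ] ((Fin 2 → ℝ) →L[ℝ] (Fin 2 → ℝ)) :=
    { Fe with
      continuous_toFun := LinearMap.continuous_of_finiteDimensional Fe.toLinearMap
      continuous_invFun := LinearMap.continuous_of_finiteDimensional Fe.symm.toLinearMap }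
  -- Skolem–Noether: automorphisms of the endomorphism algebra are inner.
  obtain ⟨A, hA⟩ := Fc.eq_continuousLinearEquivConjContinuousAlgEquiv
  have hfA : ∀ a, f a = A.toContinuousLinearMap ∘L a ∘L A.symm.toContinuousLinearMap :=
    fun a => DFunLike.congr_fun hA a
  -- `B` is read off from the rank-one maps `ε ⊗ w`. The identity `X ∘ (ε ⊗ v) = ε ⊗ X v` propagates
  -- the formula to every `X`.
  let ε : (Fin 2 → ℝ) →L[ℝ] ℝ := ContinuousLinearMap.proj 0
  let B : (Fin n → ℝ) →ₗ[ℝ] (Fin n → ℝ) :=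
    { toFun := fun w => g (ε.smulRight w) (A (Pi.single 0 1))
      map_add' := fun w w' => by
        rw [show ε.smulRight (w + w') = ε.smulRight w + ε.smulRight w' by ext; simp [mul_add],
          map_add]; rfl
      map_smul' := fun c w => by
        rw [show ε.smulRight (c • w) = c • ε.smulRight w by ext; simp; ring, map_smul]; rfl }
  have hB : ∀ (X : Std n) v, g X (A v) = B (X v) := by
    intro X v
    have h1 := hf (ε.smulRight v) X
    have h2 : (X ∘L ε.smulRight v : Std n) = ε.smulRight (X v) := by ext; simp
    rw [h2, hfA] at h1
    change _ = g (ε.smulRight (X v)) (A (Pi.single 0 1))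
    rw [h1]
    simp [ε]
  have hBinj : Function.Injective B := by
    rw [injective_iff_map_eq_zero]
    intro w hw
    have h1 : g (ε.smulRight w) = 0 := by
      ext v : 1
      obtain ⟨v, rfl⟩ := A.surjective v
      rw [hB]
      simp [hw]
    rw [map_eq_zero_iff _ g.injective] at h1
    simpa [ε] using DFunLike.congr_fun h1 (Pi.single 0 1)
  let Be := (LinearEquiv.ofInjectiveEndo B hBinj).toContinuousLinearEquiv
  refine ⟨A, Be, fun X => ?_⟩
  ext v : 1
  obtain ⟨v, rfl⟩ := A.surjective v
  rw [hB]
  simp [Be]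

end Std

/-! ### Adapted frames -/

section Frames

set_option linter.unusedSectionVars false

variable {n : ℕ}

/-- The endomorphism `u X ↦ u (X ∘ a)`. -/
def conjR {V : Type*} [AddCommGroup V] [Module ℝ V] [TopologicalSpace V]
    (u : Std n ≃L[ℝ] V) (a : (Fin 2 → ℝ) →L[ℝ] (Fin 2 → ℝ)) : V →L[ℝ] V :=
  u.toContinuousLinearMap ∘L rmul n a ∘L u.symm.toContinuousLinearMap

section conjR

variable {V : Type*} [AddCommGroup V] [Module ℝ V] [TopologicalSpace V] (u : Std n ≃L[ℝ] V)

lemma conjR_apply (a : (Fin 2 → ℝ) →L[ℝ] (Fin 2 → ℝ)) (X : Std n) :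
    conjR u a (u X) = u (X ∘L a) := by
  simp [conjR]

lemma eq_conjR_iff (a : (Fin 2 → ℝ) →L[ℝ] (Fin 2 → ℝ)) (C : V →L[ℝ] V) :
    C = conjR u a ↔ ∀ X : Std n, C (u X) = u (X ∘L a) := by
  constructor
  · rintro rfl X; exact conjR_apply u a X
  · intro h
    ext v
    obtain ⟨X, rfl⟩ := u.surjective v
    rw [h, conjR_apply]

/-- The order is reversed because matrices act from the right. -/
lemma conjR_comp (a b : (Fin 2 → ℝ) →L[ℝ] (Fin 2 → ℝ)) :
    conjR u a ∘L conjR u b = conjR u (b ∘L a) := by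
  rw [eq_conjR_iff]
  intro X
  simp [conjR_apply, ContinuousLinearMap.comp_assoc]

lemma conjR_zero : conjR u (0 : (Fin 2 → ℝ) →L[ℝ] (Fin 2 → ℝ)) = 0 := by
  simp [conjR, rmul_zero]

lemma conjR_smul [ContinuousConstSMul ℝ V] (c : ℝ) (a : (Fin 2 → ℝ) →L[ℝ] (Fin 2 → ℝ)) :
    conjR u (c • a) = c • conjR u a := by
  ext v
  simp [conjR, rmul_smul]

lemma conjR_injective [NeZero n] : Function.Injective (conjR u) := by
  intro a b h
  refine rmul_injective (n := n) (ContinuousLinearMap.ext fun X => u.injective ?_)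
  rw [rmul_apply, rmul_apply, ← conjR_apply, ← conjR_apply, h]

/-- `B` acts on the other side from `a` and cancels, so only `A` affects the nilpotent of a frame.
-/
lemma conjR_arrowCongr (A : (Fin 2 → ℝ) ≃L[ℝ] (Fin 2 → ℝ)) (B : (Fin n → ℝ) ≃L[ℝ] (Fin n → ℝ))
    (a : (Fin 2 → ℝ) →L[ℝ] (Fin 2 → ℝ)) :
    conjR ((ContinuousLinearEquiv.arrowCongr A B : Std n ≃L[ℝ] Std n).trans u) a =
      conjR u (A.toContinuousLinearMap ∘L a ∘L A.symm.toContinuousLinearMap) := by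
  symm
  rw [eq_conjR_iff]
  intro X
  change conjR u _ (u (ContinuousLinearEquiv.arrowCongr A B X)) =
    u (ContinuousLinearEquiv.arrowCongr A B (X ∘L a))
  rw [conjR_apply]
  congr 1
  ext v : 1
  simp

end conjR

variable {M : Type*} [TopologicalSpace M]
  [ChartedSpace (EuclideanSpace ℝ (Fin (2 * n))) M] [IsManifold (𝓡 (2 * n)) ∞ M]
  (𝒬 : AlmostParaQuaternionic n M)

local instance (x : M) : T2Space (TangentSpace (𝓡 (2 * n)) x) :=
  inferInstanceAs (T2Space (EuclideanSpace ℝ (Fin (2 * n))))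

/-- A linear frame of a tangent space, as an element of the manifold of frames. -/
def mkFrame (x : M) (u : Std n ≃L[ℝ] TangentSpace (𝓡 (2 * n)) x) : FrameT n M :=
  ⟨x, (u : Std n →L[ℝ] TangentSpace (𝓡 (2 * n)) x)⟩

lemma moveFrame_mkFrame (x : M) (u : Std n ≃L[ℝ] TangentSpace (𝓡 (2 * n)) x)
    (A : (Fin 2 → ℝ) ≃L[ℝ] (Fin 2 → ℝ)) (B : (Fin n → ℝ) ≃L[ℝ] (Fin n → ℝ)) :
    moveFrame (mkFrame x u) A B =
      mkFrame x ((ContinuousLinearEquiv.arrowCongr A B : Std n ≃L[ℝ] Std n).trans u) := rfl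

lemma mkFrame_mem_iff (x : M) (u : Std n ≃L[ℝ] TangentSpace (𝓡 (2 * n)) x) :
    mkFrame x u ∈ adaptedFrames 𝒬 ↔
      ∀ A : TangentSpace (𝓡 (2 * n)) x →L[ℝ] TangentSpace (𝓡 (2 * n)) x,
        A ∈ 𝒬.fiber x ↔ ∃ a, tr₂ a = 0 ∧ A = conjR u a := by
  have h1 : ∀ (A : TangentSpace (𝓡 (2 * n)) x →L[ℝ] TangentSpace (𝓡 (2 * n)) x)
      (a : (Fin 2 → ℝ) →L[ℝ] (Fin 2 → ℝ)),
      (∀ X : Std n, A ((mkFrame x u).2 X) = (mkFrame x u).2 (X ∘L a : Std n)) ↔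
        A = conjR u a := fun A a => (eq_conjR_iff u a A).symm
  have h2 : mkFrame x u ∈ adaptedFrames 𝒬 ↔
      Function.Bijective (fun X : Std n => (mkFrame x u).2 X) ∧
      ∀ A : TangentSpace (𝓡 (2 * n)) x →L[ℝ] TangentSpace (𝓡 (2 * n)) x,
        A ∈ 𝒬.fiber x ↔ ∃ a : (Fin 2 → ℝ) →L[ℝ] (Fin 2 → ℝ), tr₂ a = 0 ∧
        ∀ X : Std n, A ((mkFrame x u).2 X) = (mkFrame x u).2 (X ∘L a : Std n) := Iff.rfl
  rw [h2]
  simp only [h1]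
  exact and_iff_right u.bijective

lemma exists_eq_mkFrame {u : FrameT n M} (hu : u ∈ adaptedFrames 𝒬) :
    ∃ v : Std n ≃L[ℝ] TangentSpace (𝓡 (2 * n)) u.1, u = mkFrame u.1 v := by
  let f : Std n →L[ℝ] TangentSpace (𝓡 (2 * n)) u.1 := u.2
  refine ⟨(LinearEquiv.ofBijective f.toLinearMap hu.1).toContinuousLinearEquiv, ?_⟩
  obtain ⟨x, u⟩ := u
  rfl

variable {𝒬} in
/-- Induction principle: an adapted frame is a linear isomorphism. -/
lemma adaptedFrames_rec {p : adaptedFrames 𝒬 → Prop}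
    (h : ∀ x (u : Std n ≃L[ℝ] TangentSpace (𝓡 (2 * n)) x) (hu : mkFrame x u ∈ adaptedFrames 𝒬),
      p ⟨mkFrame x u, hu⟩) (u : adaptedFrames 𝒬) : p u := by
  obtain ⟨v, hv⟩ := exists_eq_mkFrame 𝒬 u.2
  have : u = ⟨mkFrame u.1.1 v, hv ▸ u.2⟩ := Subtype.ext hv
  rw [this]
  exact h _ _ _

variable [NeZero n]

/-- Two adapted frames at the same point differ by an element of `GL(2) × GL(n)`. -/
lemma exists_moveFrame {x : M} {u v : Std n ≃L[ℝ] TangentSpace (𝓡 (2 * n)) x}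
    (hu : mkFrame x u ∈ adaptedFrames 𝒬) (hv : mkFrame x v ∈ adaptedFrames 𝒬) :
    ∃ (A : (Fin 2 → ℝ) ≃L[ℝ] (Fin 2 → ℝ)) (B : (Fin n → ℝ) ≃L[ℝ] (Fin n → ℝ)),
      v = (ContinuousLinearEquiv.arrowCongr A B : Std n ≃L[ℝ] Std n).trans u := by
  rw [mkFrame_mem_iff] at hu hv
  obtain ⟨A, B, h⟩ := exists_eq_arrowCongr (v.trans u.symm) (by
    intro a ha
    -- An element of `𝒬_x` has a matrix in each of the two frames, so the transition map normalizes
    -- the trace-free right multiplications.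
    obtain ⟨a', ha', h⟩ := (hu (conjR v a)).1 ((hv _).2 ⟨a, ha, rfl⟩)
    refine ⟨a', fun X => u.injective ?_⟩
    change u (u.symm (v (X ∘L a))) = u (u.symm (v X) ∘L a')
    rw [u.apply_symm_apply, ← conjR_apply, ← conjR_apply, u.apply_symm_apply, h])
  refine ⟨A, B, ?_⟩
  refine ContinuousLinearEquiv.ext (funext fun X => ?_)
  change v X = u (ContinuousLinearEquiv.arrowCongr A B X)
  rw [← h X]
  simp

omit [NeZero n] in
lemma mkFrame_injective {x : M} {u v : Std n ≃L[ℝ] TangentSpace (𝓡 (2 * n)) x}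
    (h : mkFrame x u = mkFrame x v) : u = v := by
  have h1 : (u : Std n →L[ℝ] TangentSpace (𝓡 (2 * n)) x) = v := by
    have := (TotalSpace.mk.injEq _ _ _ _).mp h
    exact eq_of_heq this.2
  exact ContinuousLinearEquiv.ext (funext fun X => DFunLike.congr_fun h1 X)

/-- Two adapted frames determine the same flag if and only if their nilpotents span the same
line. -/
lemma sameFlag_iff {x : M} {u v : Std n ≃L[ℝ] TangentSpace (𝓡 (2 * n)) x}
    (hu : mkFrame x u ∈ adaptedFrames 𝒬) (hv : mkFrame x v ∈ adaptedFrames 𝒬) :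
    sameFlag 𝒬 ⟨mkFrame x u, hu⟩ ⟨mkFrame x v, hv⟩ ↔
      ∃ k : ℝ, k ≠ 0 ∧ conjR v j₀ = k • conjR u j₀ := by
  constructor
  · rintro ⟨A, B, ⟨c, hc⟩, h⟩
    obtain ⟨k, hk, h1⟩ := conj_j₀_of_flag hc
    refine ⟨k, hk, ?_⟩
    rw [mkFrame_injective (h.trans (moveFrame_mkFrame x u A B)), conjR_arrowCongr, h1, conjR_smul]
  · rintro ⟨k, hk, h⟩
    obtain ⟨A, B, rfl⟩ := exists_moveFrame 𝒬 hu hv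
    rw [conjR_arrowCongr, ← conjR_smul] at h
    exact ⟨A, B, flag_of_conj_j₀ hk (conjR_injective u h), rfl⟩

lemma exists_eq_conjR {x : M} {u : Std n ≃L[ℝ] TangentSpace (𝓡 (2 * n)) x}
    (hu : mkFrame x u ∈ adaptedFrames 𝒬)
    {C : TangentSpace (𝓡 (2 * n)) x →L[ℝ] TangentSpace (𝓡 (2 * n)) x}
    (hC : (⟨x, C⟩ : EndT n M) ∈ zeroTwistor 𝒬) :
    ∃ a, tr₂ a = 0 ∧ a ∘L a = 0 ∧ a ≠ 0 ∧ C = conjR u a := by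
  obtain ⟨⟨h1, h2⟩, h3⟩ := hC
  obtain ⟨a, ha, rfl⟩ := ((mkFrame_mem_iff 𝒬 x u).1 hu C).1 h1
  refine ⟨a, ha, ?_, ?_, rfl⟩
  · refine conjR_injective u ?_
    rw [← conjR_comp, conjR_zero]
    simpa using h2
  · rintro rfl
    exact h3 (conjR_zero u)

lemma conjR_mem_zeroTwistor {x : M} {u : Std n ≃L[ℝ] TangentSpace (𝓡 (2 * n)) x}
    (hu : mkFrame x u ∈ adaptedFrames 𝒬) {a : (Fin 2 → ℝ) →L[ℝ] (Fin 2 → ℝ)} (htr : tr₂ a = 0)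
    (hsq : a ∘L a = 0) (ha : a ≠ 0) :
    (⟨x, conjR u a⟩ : EndT n M) ∈ zeroTwistor 𝒬 := by
  refine ⟨⟨((mkFrame_mem_iff 𝒬 x u).1 hu _).2 ⟨a, htr, rfl⟩, ?_⟩, ?_⟩
  · change conjR u a ∘L conjR u a = _
    rw [conjR_comp, hsq, conjR_zero, zero_smul]
  · intro h
    exact ha (conjR_injective u (h.trans (conjR_zero u).symm))

/-- Every element of the `0`-twistor space is the nilpotent of an adapted frame. -/
lemma exists_frame_of_zeroTwistor {x : M} {u : Std n ≃L[ℝ] TangentSpace (𝓡 (2 * n)) x}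
    (hu : mkFrame x u ∈ adaptedFrames 𝒬)
    {C : TangentSpace (𝓡 (2 * n)) x →L[ℝ] TangentSpace (𝓡 (2 * n)) x}
    (hC : (⟨x, C⟩ : EndT n M) ∈ zeroTwistor 𝒬) :
    ∃ v : Std n ≃L[ℝ] TangentSpace (𝓡 (2 * n)) x, mkFrame x v ∈ adaptedFrames 𝒬 ∧
      conjR v j₀ = C := by
  obtain ⟨a, -, h2, h3, rfl⟩ := exists_eq_conjR 𝒬 hu hC
  obtain ⟨A, hA⟩ := exists_conj_j₀ h2 h3
  refine ⟨(ContinuousLinearEquiv.arrowCongr A (ContinuousLinearEquiv.refl ℝ (Fin n → ℝ)) :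
    Std n ≃L[ℝ] Std n).trans u, moveFrame_mem 𝒬 hu A (ContinuousLinearEquiv.refl ℝ _), ?_⟩
  rw [conjR_arrowCongr, hA]

end Frames

/-! ### Local adapted frames and the coordinates they define -/

local instance (n m : ℕ) : NormedAddCommGroup (Std n →L[ℝ] EuclideanSpace ℝ (Fin m)) :=
  ContinuousLinearMap.toNormedAddCommGroup

local instance (n m : ℕ) : NormedSpace ℝ (Std n →L[ℝ] EuclideanSpace ℝ (Fin m)) :=
  ContinuousLinearMap.toNormedSpace

local instance (n : ℕ) : NormedAddCommGroup (Std n →L[ℝ] Std n) :=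
  ContinuousLinearMap.toNormedAddCommGroup

local instance (n : ℕ) : NormedSpace ℝ (Std n →L[ℝ] Std n) := ContinuousLinearMap.toNormedSpace

/-- `V` is finite-dimensional: `L q` is a sum of rank-one maps whose vectors are the values of `L q`
on a basis. -/
lemma contMDiffAt_clm_of_apply {N EN HN V W : Type*} [NormedAddCommGroup EN] [NormedSpace ℝ EN]
    [TopologicalSpace HN] {K : ModelWithCorners ℝ EN HN} [TopologicalSpace N] [ChartedSpace HN N]
    [NormedAddCommGroup V] [NormedSpace ℝ V] [FiniteDimensional ℝ V]
    [NormedAddCommGroup W] [NormedSpace ℝ W] {L : N → V →L[ℝ] W} {p : N}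
    (h : ∀ v, ContMDiffAt K 𝓘(ℝ, W) ∞ (fun q => L q v) p) :
    ContMDiffAt K 𝓘(ℝ, V →L[ℝ] W) ∞ L p := by
  let b := Module.finBasis ℝ V
  let c : ∀ i, V →L[ℝ] ℝ := fun i => LinearMap.toContinuousLinearMap (b.coord i)
  have h1 : L = fun q => ∑ i, ContinuousLinearMap.smulRightL ℝ V W (c i) (L q (b i)) := by
    ext q v
    rw [sum_apply]
    conv_lhs => rw [← b.sum_repr v, map_sum]
    simp [c]
  rw [h1]
  refine contMDiffAt_finsetSum fun i _ => ?_
  exact ContMDiffAt.comp (f := fun q => L q (b i)) p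
    (ContinuousLinearMap.smulRightL ℝ V W (c i)).contMDiff.contMDiffAt (h (b i))

section Frames

set_option linter.unusedSectionVars false

variable {n : ℕ} {M : Type*} [TopologicalSpace M]
  [ChartedSpace (EuclideanSpace ℝ (Fin (2 * n))) M] [IsManifold (𝓡 (2 * n)) ∞ M]

/-- The trivialization of the tangent bundle at `x₀`, as a linear map on the fibre at `x`. -/
def tanTriv (x₀ x : M) : TangentSpace (𝓡 (2 * n)) x →L[ℝ] EuclideanSpace ℝ (Fin (2 * n)) :=
  (trivializationAt (EuclideanSpace ℝ (Fin (2 * n)))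
    (TangentSpace (𝓡 (2 * n)) : M → Type _) x₀).continuousLinearMapAt ℝ x

/-- The inverse of `tanTriv`. -/
def tanSymm (x₀ x : M) : EuclideanSpace ℝ (Fin (2 * n)) →L[ℝ] TangentSpace (𝓡 (2 * n)) x :=
  (trivializationAt (EuclideanSpace ℝ (Fin (2 * n)))
    (TangentSpace (𝓡 (2 * n)) : M → Type _) x₀).symmL ℝ x

/-- The domain of the trivialization of the tangent bundle at `x₀`. -/
def tanBase (x₀ : M) : Set M :=
  (trivializationAt (EuclideanSpace ℝ (Fin (2 * n)))
    (TangentSpace (𝓡 (2 * n)) : M → Type _) x₀).baseSet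

lemma isOpen_tanBase (x₀ : M) : IsOpen (tanBase (n := n) x₀) :=
  (trivializationAt (EuclideanSpace ℝ (Fin (2 * n)))
    (TangentSpace (𝓡 (2 * n)) : M → Type _) x₀).open_baseSet

lemma mem_tanBase (x₀ : M) : x₀ ∈ tanBase (n := n) x₀ :=
  FiberBundle.mem_baseSet_trivializationAt' x₀

lemma tanSymm_tanTriv {x₀ x : M} (h : x ∈ tanBase (n := n) x₀) (v : TangentSpace (𝓡 (2 * n)) x) :
    tanSymm x₀ x (tanTriv x₀ x v) = v :=
  (trivializationAt (EuclideanSpace ℝ (Fin (2 * n)))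
    (TangentSpace (𝓡 (2 * n)) : M → Type _) x₀).symmL_continuousLinearMapAt h v

lemma tanTriv_tanSymm {x₀ x : M} (h : x ∈ tanBase (n := n) x₀)
    (v : EuclideanSpace ℝ (Fin (2 * n))) :
    tanTriv x₀ x (tanSymm x₀ x v) = v :=
  (trivializationAt (EuclideanSpace ℝ (Fin (2 * n)))
    (TangentSpace (𝓡 (2 * n)) : M → Type _) x₀).continuousLinearMapAt_symmL h v

lemma tanTriv_apply {x₀ x : M} (h : x ∈ tanBase (n := n) x₀) (v : TangentSpace (𝓡 (2 * n)) x) :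
    (trivializationAt (EuclideanSpace ℝ (Fin (2 * n)))
      (TangentSpace (𝓡 (2 * n)) : M → Type _) x₀ ⟨x, v⟩).2 = tanTriv x₀ x v := by
  rw [tanTriv, Trivialization.continuousLinearMapAt_apply, Trivialization.coe_linearMapAt_of_mem _ h]

/-- The fibre `Std n` is trivialized as a bundle of homomorphisms between two trivial bundles, each
trivialized by the identity. -/
lemma trivial_symmL (x₀ x : M) (X : Std n) :
    (trivializationAt (Std n) (Trivial M (Std n)) x₀).symmL ℝ x X = X := by
  have hb : x ∈ (trivializationAt (Std n) (Trivial M (Std n)) x₀).baseSet := by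
    rw [hom_trivializationAt_baseSet]
    exact ⟨Set.mem_univ _, Set.mem_univ _⟩
  have h1 : (trivializationAt (Std n) (Trivial M (Std n)) x₀ ⟨x, X⟩).2 = X := by
    refine (congrArg Prod.snd (hom_trivializationAt_apply (RingHom.id ℝ) x₀ _)).trans ?_
    change (Trivial.trivialization M (Fin n → ℝ)).continuousLinearMapAt ℝ x ∘L X ∘L
      (Trivial.trivialization M (Fin 2 → ℝ)).symmL ℝ x = X
    rw [Trivial.symmL_trivialization, Trivial.continuousLinearMapAt_trivialization]
    rfl
  have h2 := (trivializationAt (Std n) (Trivial M (Std n)) x₀).symmL_continuousLinearMapAt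
    (R := ℝ) hb X
  rw [Trivialization.continuousLinearMapAt_apply, Trivialization.coe_linearMapAt_of_mem _ hb] at h2
  beta_reduce at h2
  rwa [h1] at h2

/-- The linear map underlying a point of `FrameT n M`. -/
def linOf (u : FrameT n M) : Std n →L[ℝ] TangentSpace (𝓡 (2 * n)) u.1 := u.2

section Smooth

variable {N EN HN : Type*} [NormedAddCommGroup EN] [NormedSpace ℝ EN]
    [TopologicalSpace HN] {K : ModelWithCorners ℝ EN HN} [TopologicalSpace N] [ChartedSpace HN N]

/-- This and the next two criteria reduce smoothness of a bundle-valued map to smoothness of its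
base point and of its expression in one trivialization of `TM`. -/
lemma contMDiffAt_tangent_iff {f : N → TangentBundle (𝓡 (2 * n)) M} {p : N} {x₀ : M}
    (hx : (f p).1 ∈ tanBase (n := n) x₀) :
    ContMDiffAt K (𝓡 (2 * n)).tangent ∞ f p ↔
      ContMDiffAt K (𝓡 (2 * n)) ∞ (fun q => (f q).1) p ∧
      ContMDiffAt K 𝓘(ℝ, EuclideanSpace ℝ (Fin (2 * n))) ∞
        (fun q => tanTriv x₀ (f q).1 (f q).2) p := by
  refine Iff.trans (Trivialization.contMDiffAt_iff (e := trivializationAt (EuclideanSpace ℝ (Fin (2 * n)))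
    (TangentSpace (𝓡 (2 * n)) : M → Type _) x₀) ((Trivialization.mem_source _).2 hx)) ?_
  refine and_congr_right fun h => ?_
  refine Filter.EventuallyEq.contMDiffAt_iff ?_
  filter_upwards [h.continuousAt.preimage_mem_nhds ((isOpen_tanBase x₀).mem_nhds hx)] with q hq
  exact tanTriv_apply hq (f q).2

lemma contMDiffAt_frameT_iff {f : N → FrameT n M} {p : N} {x₀ : M}
    (hx : (f p).1 ∈ tanBase (n := n) x₀) :
    ContMDiffAt K (modelFrame n) ∞ f p ↔
      ContMDiffAt K (𝓡 (2 * n)) ∞ (fun q => (f q).1) p ∧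
      ContMDiffAt K 𝓘(ℝ, Std n →L[ℝ] EuclideanSpace ℝ (Fin (2 * n))) ∞
        (fun q => tanTriv x₀ (f q).1 ∘L linOf (f q)) p := by
  refine Iff.trans (Trivialization.contMDiffAt_iff (e := trivializationAt
    (Std n →L[ℝ] EuclideanSpace ℝ (Fin (2 * n)))
    (fun x : M => Trivial M (Std n) x →L[ℝ] TangentSpace (𝓡 (2 * n)) x) x₀)
    ((Trivialization.mem_source _).2 (by
      rw [hom_trivializationAt_baseSet, hom_trivializationAt_baseSet]
      exact ⟨⟨Set.mem_univ _, Set.mem_univ _⟩, hx⟩))) ?_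
  refine and_congr_right fun h => ?_
  refine Filter.EventuallyEq.contMDiffAt_iff (Filter.Eventually.of_forall fun q => ?_)
  refine (congrArg Prod.snd (hom_trivializationAt_apply (RingHom.id ℝ) x₀ (f q))).trans ?_
  ext X : 1
  exact congrArg (fun Y => tanTriv x₀ (f q).1 (linOf (f q) Y)) (trivial_symmL x₀ (f q).1 X)

lemma contMDiffAt_endT_iff {f : N → EndT n M} {p : N} {x₀ : M}
    (hx : (f p).1 ∈ tanBase (n := n) x₀) :
    ContMDiffAt K (modelEnd n) ∞ f p ↔
      ContMDiffAt K (𝓡 (2 * n)) ∞ (fun q => (f q).1) p ∧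
      ContMDiffAt K 𝓘(ℝ, EuclideanSpace ℝ (Fin (2 * n)) →L[ℝ] EuclideanSpace ℝ (Fin (2 * n))) ∞
        (fun q => tanTriv x₀ (f q).1 ∘L (f q).2 ∘L tanSymm x₀ (f q).1) p := by
  refine Iff.trans (Trivialization.contMDiffAt_iff (e := trivializationAt
    (EuclideanSpace ℝ (Fin (2 * n)) →L[ℝ] EuclideanSpace ℝ (Fin (2 * n)))
    (fun x : M => TangentSpace (𝓡 (2 * n)) x →L[ℝ] TangentSpace (𝓡 (2 * n)) x) x₀)
    ((Trivialization.mem_source _).2 (by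
      rw [hom_trivializationAt_baseSet]; exact ⟨hx, hx⟩))) ?_
  refine and_congr_right fun h => ?_
  refine Filter.EventuallyEq.contMDiffAt_iff (Filter.Eventually.of_forall fun q => ?_)
  refine (congrArg Prod.snd (hom_trivializationAt_apply (RingHom.id ℝ) x₀ (f q))).trans ?_
  rfl

/-- A family of frames is smooth if its values on fixed vectors are. -/
lemma contMDiffAt_frameT_of_apply {f : N → FrameT n M} {p : N}
    (hb : ContMDiffAt K (𝓡 (2 * n)) ∞ (fun q => (f q).1) p)
    (h : ∀ X : Std n, ContMDiffAt K (𝓡 (2 * n)).tangent ∞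
      (fun q => (⟨(f q).1, linOf (f q) X⟩ : TangentBundle (𝓡 (2 * n)) M)) p) :
    ContMDiffAt K (modelFrame n) ∞ f p := by
  rw [contMDiffAt_frameT_iff (mem_tanBase (f p).1)]
  refine ⟨hb, contMDiffAt_clm_of_apply fun X => ?_⟩
  exact ((contMDiffAt_tangent_iff (mem_tanBase (f p).1)).1 (h X)).2

end Smooth

/-- A field of adapted frames on `M` that is smooth on the open set `dom`. -/
structure LocalFrame (𝒬 : AlmostParaQuaternionic n M) where
  /-- the domain -/
  dom : Set M
  isOpen_dom : IsOpen dom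
  /-- the frames -/
  lin : ∀ x : M, Std n ≃L[ℝ] TangentSpace (𝓡 (2 * n)) x
  adapted : ∀ x, mkFrame x (lin x) ∈ adaptedFrames 𝒬
  smooth : ContMDiffOn (𝓡 (2 * n)) (modelFrame n) ∞ (fun x => mkFrame x (lin x)) dom

namespace LocalFrame

variable {𝒬 : AlmostParaQuaternionic n M} (s : LocalFrame 𝒬)

/-- The frame in trivialized form. -/
def triv (x₀ x : M) : Std n →L[ℝ] EuclideanSpace ℝ (Fin (2 * n)) :=
  tanTriv x₀ x ∘L (s.lin x).toContinuousLinearMap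

/-- The frame in trivialized form as an isomorphism. -/
def trivEquiv {x₀ x : M} (h : x ∈ tanBase (n := n) x₀) :
    Std n ≃L[ℝ] EuclideanSpace ℝ (Fin (2 * n)) :=
  (s.lin x).trans (ContinuousLinearEquiv.equivOfInverse (tanTriv x₀ x) (tanSymm x₀ x)
    (tanSymm_tanTriv h) (tanTriv_tanSymm h))

lemma trivEquiv_coe {x₀ x : M} (h : x ∈ tanBase (n := n) x₀) :
    (s.trivEquiv h).toContinuousLinearMap = s.triv x₀ x := rfl

/-- Writing the inverse frame with `ContinuousLinearMap.inverse` makes the smoothness of inversion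
available. The formula needs `x` in the trivialization domain. -/
lemma inverse_triv {x₀ x : M} (h : x ∈ tanBase (n := n) x₀) :
    (s.triv x₀ x).inverse = (s.lin x).symm.toContinuousLinearMap ∘L tanSymm x₀ x := by
  rw [← s.trivEquiv_coe h, ContinuousLinearMap.inverse_equiv]
  rfl

lemma contMDiffAt_triv {x₀ : M} (h : x₀ ∈ s.dom) :
    ContMDiffAt (𝓡 (2 * n)) 𝓘(ℝ, Std n →L[ℝ] EuclideanSpace ℝ (Fin (2 * n))) ∞
      (s.triv x₀) x₀ :=
  ((contMDiffAt_frameT_iff (f := fun x => mkFrame x (s.lin x)) (mem_tanBase x₀)).1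
    (s.smooth.contMDiffAt (s.isOpen_dom.mem_nhds h))).2

lemma contMDiffAt_inverse_triv {x₀ : M} (h : x₀ ∈ s.dom) :
    ContMDiffAt (𝓡 (2 * n)) 𝓘(ℝ, EuclideanSpace ℝ (Fin (2 * n)) →L[ℝ] Std n) ∞
      (fun x => (s.triv x₀ x).inverse) x₀ :=
  ContMDiffAt.comp (f := s.triv x₀) x₀
    (contDiffAt_map_inverse (s.trivEquiv (mem_tanBase x₀))).contMDiffAt (s.contMDiffAt_triv h)

/-- The matrix of a frame with respect to the local frame. -/
def coordFrame (u : FrameT n M) : Std n →L[ℝ] Std n :=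
  (s.lin u.1).symm.toContinuousLinearMap ∘L linOf u

/-- The matrix of an endomorphism with respect to the local frame. -/
def coordEnd (C : EndT n M) : Std n →L[ℝ] Std n :=
  (s.lin C.1).symm.toContinuousLinearMap ∘L C.2 ∘L (s.lin C.1).toContinuousLinearMap

lemma contMDiffOn_coordFrame :
    ContMDiffOn (modelFrame n) 𝓘(ℝ, Std n →L[ℝ] Std n) ∞ s.coordFrame
      (TotalSpace.proj ⁻¹' s.dom) := by
  intro u hu
  refine ContMDiffAt.contMDiffWithinAt ?_
  obtain ⟨h1, h2⟩ := (contMDiffAt_frameT_iff (f := fun q : FrameT n M => q)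
    (mem_tanBase u.1)).1 contMDiffAt_id
  have h3 : ContMDiffAt (modelFrame n) 𝓘(ℝ, EuclideanSpace ℝ (Fin (2 * n)) →L[ℝ] Std n) ∞
      (fun q : FrameT n M => (s.triv u.1 q.1).inverse) u :=
    ContMDiffAt.comp (f := fun q : FrameT n M => q.1) u (s.contMDiffAt_inverse_triv hu) h1
  refine (h3.clm_comp h2).congr_of_eventuallyEq ?_
  filter_upwards [h1.continuousAt.preimage_mem_nhds
    ((isOpen_tanBase (n := n) u.1).mem_nhds (mem_tanBase u.1))] with q hq
  rw [s.inverse_triv hq]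
  ext1 X
  simp [coordFrame, tanSymm_tanTriv hq]

lemma contMDiffOn_coordEnd :
    ContMDiffOn (modelEnd n) 𝓘(ℝ, Std n →L[ℝ] Std n) ∞ s.coordEnd
      (TotalSpace.proj ⁻¹' s.dom) := by
  intro u hu
  refine ContMDiffAt.contMDiffWithinAt ?_
  obtain ⟨h1, h2⟩ := (contMDiffAt_endT_iff (f := fun q : EndT n M => q)
    (mem_tanBase u.1)).1 contMDiffAt_id
  have h3 : ContMDiffAt (modelEnd n) 𝓘(ℝ, EuclideanSpace ℝ (Fin (2 * n)) →L[ℝ] Std n) ∞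
      (fun q : EndT n M => (s.triv u.1 q.1).inverse) u :=
    ContMDiffAt.comp (f := fun q : EndT n M => q.1) u (s.contMDiffAt_inverse_triv hu) h1
  have h4 : ContMDiffAt (modelEnd n) 𝓘(ℝ, Std n →L[ℝ] EuclideanSpace ℝ (Fin (2 * n))) ∞
      (fun q : EndT n M => s.triv u.1 q.1) u :=
    ContMDiffAt.comp (f := fun q : EndT n M => q.1) u (s.contMDiffAt_triv hu) h1
  refine (h3.clm_comp (h2.clm_comp h4)).congr_of_eventuallyEq ?_
  filter_upwards [h1.continuousAt.preimage_mem_nhds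
    ((isOpen_tanBase (n := n) u.1).mem_nhds (mem_tanBase u.1))] with q hq
  rw [s.inverse_triv hq]
  ext1 X
  simp [coordEnd, tanSymm_tanTriv hq, triv]

variable {N EN HN : Type*} [NormedAddCommGroup EN] [NormedSpace ℝ EN]
    [TopologicalSpace HN] {K : ModelWithCorners ℝ EN HN} [TopologicalSpace N] [ChartedSpace HN N]

lemma contMDiffAt_frame_comp {x : N → M} {g : N → Std n ≃L[ℝ] Std n} {p : N}
    (hx : ContMDiffAt K (𝓡 (2 * n)) ∞ x p) (hp : x p ∈ s.dom)
    (hg : ContMDiffAt K 𝓘(ℝ, Std n →L[ℝ] Std n) ∞ (fun q => (g q).toContinuousLinearMap) p) :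
    ContMDiffAt K (modelFrame n) ∞ (fun q => mkFrame (x q) ((g q).trans (s.lin (x q)))) p := by
  rw [contMDiffAt_frameT_iff (mem_tanBase (x p))]
  refine ⟨hx, ?_⟩
  exact (ContMDiffAt.comp (f := x) p (s.contMDiffAt_triv hp) hx).clm_comp hg

lemma contMDiffAt_conjR {x : N → M} {a : N → (Fin 2 → ℝ) →L[ℝ] (Fin 2 → ℝ)} {p : N}
    (hx : ContMDiffAt K (𝓡 (2 * n)) ∞ x p) (hp : x p ∈ s.dom)
    (ha : ContMDiffAt K 𝓘(ℝ, (Fin 2 → ℝ) →L[ℝ] (Fin 2 → ℝ)) ∞ a p) :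
    ContMDiffAt K (modelEnd n) ∞
      (fun q => (⟨x q, conjR (s.lin (x q)) (a q)⟩ : EndT n M)) p := by
  rw [contMDiffAt_endT_iff (mem_tanBase (x p))]
  refine ⟨hx, ?_⟩
  have h1 := ContMDiffAt.comp (f := x) p (s.contMDiffAt_triv hp) hx
  have h2 := ContMDiffAt.comp (f := x) p (s.contMDiffAt_inverse_triv hp) hx
  have h3 : ContMDiffAt K 𝓘(ℝ, Std n →L[ℝ] Std n) ∞ (fun q => rmul n (a q)) p :=
    ContMDiffAt.comp (f := a) p contDiff_rmul.contMDiff.contMDiffAt ha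
  refine (h1.clm_comp (h3.clm_comp h2)).congr_of_eventuallyEq ?_
  filter_upwards [hx.continuousAt.preimage_mem_nhds
    ((isOpen_tanBase (n := n) (x p)).mem_nhds (mem_tanBase (x p)))] with q hq
  simp only [Function.comp_apply]
  rw [s.inverse_triv hq]
  rfl

end LocalFrame

end Frames

local instance {E H N : Type*} [NormedAddCommGroup E] [NormedSpace ℝ E] [TopologicalSpace H]
    {I : ModelWithCorners ℝ E H} [TopologicalSpace N] [ChartedSpace H N] [IsManifold I ∞ N] :
    IsManifold I 1 N := IsManifold.of_le (n := ∞) (by simp)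

local instance {n : ℕ} {M : Type*} [TopologicalSpace M]
    [ChartedSpace (EuclideanSpace ℝ (Fin (2 * n))) M] [IsManifold (𝓡 (2 * n)) ∞ M] :
    TopologicalSpace (FrameT n M) := inferInstance

local instance {n : ℕ} {M : Type*} [TopologicalSpace M]
    [ChartedSpace (EuclideanSpace ℝ (Fin (2 * n))) M] [IsManifold (𝓡 (2 * n)) ∞ M] :
    TopologicalSpace (EndT n M) := inferInstance

local instance {n : ℕ} {M : Type*} [TopologicalSpace M]
    [ChartedSpace (EuclideanSpace ℝ (Fin (2 * n))) M] [IsManifold (𝓡 (2 * n)) ∞ M]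
    (𝒬 : AlmostParaQuaternionic n M) : TopologicalSpace (CorrSpace 𝒬) := inferInstance

local instance {n : ℕ} {M : Type*} [TopologicalSpace M]
    [ChartedSpace (EuclideanSpace ℝ (Fin (2 * n))) M] [IsManifold (𝓡 (2 * n)) ∞ M]
    (𝒬 : AlmostParaQuaternionic n M)
    [ChartedSpace (EuclideanSpace ℝ (Fin (2 * n)) × ℝ) (CorrSpace 𝒬)]
    [IsManifold (modelC n) ∞ (CorrSpace 𝒬)] :
    TopologicalSpace (TangentBundle (modelC n) (CorrSpace 𝒬)) := inferInstance

set_option linter.unusedSectionVars false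

/-! ### Existence of local adapted frames -/

section Existence

/-- Adapted bases of a vector space with a para-quaternionic structure. -/
lemma exists_eigenframe {n : ℕ} {V : Type*} [NormedAddCommGroup V] [NormedSpace ℝ V]
    [FiniteDimensional ℝ V] (hV : Module.finrank ℝ V = 2 * n) (P J : V →L[ℝ] V)
    (hP : P ∘L P = ContinuousLinearMap.id ℝ V) (hJ : J ∘L J = ContinuousLinearMap.id ℝ V)
    (hPJ : P ∘L J = -(J ∘L P)) :
    ∃ F : (Fin n → ℝ) →L[ℝ] V, P ∘L F = F ∧
      Function.Bijective (fun X : Std n => F (X (Pi.single 0 1)) + J (F (X (Pi.single 1 1)))) := by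
  have hP' : ∀ v, P (P v) = v := fun v => DFunLike.congr_fun hP v
  have hJ' : ∀ v, J (J v) = v := fun v => DFunLike.congr_fun hJ v
  have hPJ' : ∀ v, P (J v) = -J (P v) := fun v => DFunLike.congr_fun hPJ v
  -- `T` is the `+1` eigenspace of `P`. Since `J` anticommutes with `P`, it interchanges the two
  -- eigenspaces, whence `V = T ⊕ J T` and `T` has dimension `n`.
  let T : Submodule ℝ V := LinearMap.ker (P.toLinearMap - LinearMap.id)
  have hT : ∀ v, v ∈ T ↔ P v = v := fun v => by
    simp [T, sub_eq_zero]
  let e : (T × T) ≃ₗ[ℝ] V :=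
    { toFun := fun w => w.1 + J w.2
      invFun := fun v => (⟨(1 / 2 : ℝ) • (v + P v), by rw [hT]; simp [hP', add_comm]⟩,
        ⟨(1 / 2 : ℝ) • (J v - J (P v)), by
          rw [hT]; simp only [map_smul, map_sub, hPJ', hP']; congr 1; abel⟩)
      map_add' := fun v w => by simp; abel
      map_smul' := fun c v => by simp
      left_inv := by
        rintro ⟨⟨v, hv⟩, ⟨w, hw⟩⟩
        rw [hT] at hv hw
        ext
        · simp only [map_add, hv, hPJ', hw]
          module
        · simp only [map_add, hv, hPJ', hw, map_neg, hJ']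
          module
      right_inv := fun v => by
        simp only [map_smul, map_sub, hJ']
        module }
  have hdim : Module.finrank ℝ T = n := by
    have := e.finrank_eq
    rw [Module.finrank_prod, hV] at this
    omega
  let b : (Fin n → ℝ) ≃ₗ[ℝ] T :=
    LinearEquiv.ofFinrankEq _ _ (by rw [hdim, Module.finrank_fin_fun])
  refine ⟨LinearMap.toContinuousLinearMap (T.subtype ∘ₗ b.toLinearMap), ?_, ?_⟩
  · ext1 v
    exact (hT _).1 (b v).2
  · constructor
    · intro X Y h
      have h1 : e (b (X (Pi.single 0 1)), b (X (Pi.single 1 1))) =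
          e (b (Y (Pi.single 0 1)), b (Y (Pi.single 1 1))) := h
      have h2 := e.injective h1
      simp only [Prod.mk.injEq, EmbeddingLike.apply_eq_iff_eq] at h2
      refine ContinuousLinearMap.coe_injective (LinearMap.pi_ext' fun k => ?_)
      fin_cases k
      · exact LinearMap.ext_ring h2.1
      · exact LinearMap.ext_ring h2.2
    · intro v
      obtain ⟨⟨p, q⟩, rfl⟩ := e.surjective v
      refine ⟨(ContinuousLinearMap.proj 0 : (Fin 2 → ℝ) →L[ℝ] ℝ).smulRight (b.symm p) +
        (ContinuousLinearMap.proj 1 : (Fin 2 → ℝ) →L[ℝ] ℝ).smulRight (b.symm q), ?_⟩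
      simp [e]

/-- A frame that intertwines `h₀` and the swap with `P` and `J` is adapted to their span. -/
lemma mem_span_iff {n : ℕ} {V : Type*} [AddCommGroup V] [Module ℝ V] [TopologicalSpace V]
    [IsTopologicalAddGroup V] [ContinuousConstSMul ℝ V]
    (u : Std n ≃L[ℝ] V) (P J Q : V →L[ℝ] V) (w : (Fin 2 → ℝ) →L[ℝ] (Fin 2 → ℝ))
    (hw : ∀ v, w v = ![v 1, v 0]) (hP : P = conjR u h₀) (hJ : J = conjR u w) (hQ : Q = P ∘L J)
    (A : V →L[ℝ] V) :
    A ∈ Submodule.span ℝ {P, J, Q} ↔ ∃ a, tr₂ a = 0 ∧ A = conjR u a := by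
  -- `Q = P ∘ J` corresponds to `w ∘ h₀`, since `conjR` reverses products; `h₀`, `w` and `w ∘ h₀`
  -- form a basis of the trace-free matrices.
  have key : ∀ α β γ : ℝ, α • P + β • J + γ • Q = conjR u (α • h₀ + β • w + γ • (w ∘L h₀)) := by
    intro α β γ
    rw [eq_conjR_iff]
    intro X
    rw [hQ, hP, hJ, conjR_comp]
    simp only [add_apply, smul_apply, conjR_apply, ← map_smul, ← map_add]
    congr 1
    ext v : 1
    simp
  rw [Submodule.mem_span_triple]
  constructor
  · rintro ⟨α, β, γ, rfl⟩
    refine ⟨_, ?_, key α β γ⟩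
    simp [tr₂_eq, h₀_apply, hw]
  · rintro ⟨a, ha, rfl⟩
    refine ⟨a (Pi.single 0 1) 0, (a (Pi.single 1 1) 0 + a (Pi.single 0 1) 1) / 2,
      (a (Pi.single 0 1) 1 - a (Pi.single 1 1) 0) / 2, ?_⟩
    rw [key]
    congr 1
    rw [tr₂_eq] at ha
    refine plane_ext fun b k => ?_
    fin_cases b <;> fin_cases k <;> simp [h₀_apply, hw] <;> linarith

variable {n : ℕ} {M : Type*} [TopologicalSpace M]
  [ChartedSpace (EuclideanSpace ℝ (Fin (2 * n))) M] [IsManifold (𝓡 (2 * n)) ∞ M]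
  (𝒬 : AlmostParaQuaternionic n M)

/-- Extension by zero of a linear map on the tangent space to trivialized form. -/
def trivEnd (x₀ x : M) (A : TangentSpace (𝓡 (2 * n)) x →L[ℝ] TangentSpace (𝓡 (2 * n)) x) :
    EuclideanSpace ℝ (Fin (2 * n)) →L[ℝ] EuclideanSpace ℝ (Fin (2 * n)) :=
  tanTriv x₀ x ∘L A ∘L tanSymm x₀ x

lemma trivEnd_comp {x₀ x : M} (h : x ∈ tanBase (n := n) x₀)
    (A B : TangentSpace (𝓡 (2 * n)) x →L[ℝ] TangentSpace (𝓡 (2 * n)) x) :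
    trivEnd x₀ x (A ∘L B) = trivEnd x₀ x A ∘L trivEnd x₀ x B := by
  ext1 v
  simp [trivEnd, tanSymm_tanTriv h]

lemma trivEnd_id {x₀ x : M} (h : x ∈ tanBase (n := n) x₀) :
    trivEnd x₀ x (ContinuousLinearMap.id ℝ (TangentSpace (𝓡 (2 * n)) x)) =
      ContinuousLinearMap.id ℝ _ := by
  ext1 v
  simp [trivEnd, tanTriv_tanSymm h]

lemma trivEnd_neg (x₀ x : M) (A : TangentSpace (𝓡 (2 * n)) x →L[ℝ] TangentSpace (𝓡 (2 * n)) x) :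
    trivEnd x₀ x (-A) = -trivEnd x₀ x A := by
  ext1 v
  simp [trivEnd]

lemma SmoothEndOn.contMDiffOn_trivEnd {U : Set M} (hU : IsOpen U)
    {A : ∀ x : M, TangentSpace (𝓡 (2 * n)) x →L[ℝ] TangentSpace (𝓡 (2 * n)) x}
    (hA : SmoothEndOn U A) (x₀ : M) :
    ContMDiffOn (𝓡 (2 * n))
      𝓘(ℝ, EuclideanSpace ℝ (Fin (2 * n)) →L[ℝ] EuclideanSpace ℝ (Fin (2 * n))) ∞
      (fun x => trivEnd x₀ x (A x)) (U ∩ tanBase (n := n) x₀) := fun _ hx =>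
  ((contMDiffAt_endT_iff (f := fun x => (⟨x, A x⟩ : EndT n M)) hx.2).1
    (hA.contMDiffAt (hU.mem_nhds hx.1))).2.contMDiffWithinAt

/-- The family of frames defined by the families `P`, `J` and the vectors `F`. -/
def eigenFrame {V : Type*} [NormedAddCommGroup V] [NormedSpace ℝ V]
    (P J : V →L[ℝ] V) (F : (Fin n → ℝ) →L[ℝ] V) : Std n →L[ℝ] V :=
  ((1 / 2 : ℝ) • (ContinuousLinearMap.id ℝ V + P)) ∘L F ∘L
      ContinuousLinearMap.apply ℝ (Fin n → ℝ) (Pi.single 0 1 : Fin 2 → ℝ) +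
    J ∘L ((1 / 2 : ℝ) • (ContinuousLinearMap.id ℝ V + P)) ∘L F ∘L
      ContinuousLinearMap.apply ℝ (Fin n → ℝ) (Pi.single 1 1 : Fin 2 → ℝ)

lemma eigenFrame_apply {V : Type*} [NormedAddCommGroup V] [NormedSpace ℝ V]
    (P J : V →L[ℝ] V) (F : (Fin n → ℝ) →L[ℝ] V) (X : Std n) :
    eigenFrame P J F X = (1 / 2 : ℝ) • (F (X (Pi.single 0 1)) + P (F (X (Pi.single 0 1)))) +
      J ((1 / 2 : ℝ) • (F (X (Pi.single 1 1)) + P (F (X (Pi.single 1 1))))) := by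
  simp [eigenFrame]

/-- Vectors `F` spanning the `+1` eigenspace of `P` at `x₀` are kept constant in a trivialization.
The projector `(1 + P) / 2` pushes them smoothly into the eigenspace at nearby points, and `J`
supplies the other eigenspace. Bijectivity is an open condition, and the frame is adapted because it
intertwines `h₀` with `P` and the swap of coordinates with `J`. -/
lemma exists_localFrame_aux (x₀ : M) : ∃ U : Set M, IsOpen U ∧ x₀ ∈ U ∧
    ∃ s : ∀ x : M, Std n →L[ℝ] TangentSpace (𝓡 (2 * n)) x,
      (∀ x ∈ U, ∃ u : Std n ≃L[ℝ] TangentSpace (𝓡 (2 * n)) x,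
        mkFrame x u ∈ adaptedFrames 𝒬 ∧ s x = u) ∧
      ContMDiffOn (𝓡 (2 * n)) (modelFrame n) ∞ (fun x => (⟨x, s x⟩ : FrameT n M)) U := by
  obtain ⟨U, hU, hx₀, P, J, Q, hP, hJ, -, hrel⟩ := 𝒬.locally_spanned x₀
  have hU' : IsOpen (U ∩ tanBase (n := n) x₀) := hU.inter (isOpen_tanBase x₀)
  have hP2 : ∀ x ∈ U ∩ tanBase (n := n) x₀,
      trivEnd x₀ x (P x) ∘L trivEnd x₀ x (P x) = ContinuousLinearMap.id ℝ _ := fun x hx => by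
    rw [← trivEnd_comp hx.2, (hrel x hx.1).1, trivEnd_id hx.2]
  have hJ2 : ∀ x ∈ U ∩ tanBase (n := n) x₀,
      trivEnd x₀ x (J x) ∘L trivEnd x₀ x (J x) = ContinuousLinearMap.id ℝ _ := fun x hx => by
    rw [← trivEnd_comp hx.2, (hrel x hx.1).2.1, trivEnd_id hx.2]
  have hPJ : ∀ x ∈ U ∩ tanBase (n := n) x₀, trivEnd x₀ x (P x) ∘L trivEnd x₀ x (J x) =
      -(trivEnd x₀ x (J x) ∘L trivEnd x₀ x (P x)) := fun x hx => by
    rw [← trivEnd_comp hx.2, ← trivEnd_comp hx.2, ← trivEnd_neg, ← (hrel x hx.1).2.2.1,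
      (hrel x hx.1).2.2.2.1]
  have hxU : x₀ ∈ U ∩ tanBase (n := n) x₀ := ⟨hx₀, mem_tanBase x₀⟩
  obtain ⟨F, hF, hbij⟩ := exists_eigenframe (n := n) finrank_euclideanSpace_fin _ _
    (hP2 x₀ hxU) (hJ2 x₀ hxU) (hPJ x₀ hxU)
  let w : M → Std n →L[ℝ] EuclideanSpace ℝ (Fin (2 * n)) := fun x =>
    eigenFrame (trivEnd x₀ x (P x)) (trivEnd x₀ x (J x)) F
  have hw : ContMDiffOn (𝓡 (2 * n)) 𝓘(ℝ, Std n →L[ℝ] EuclideanSpace ℝ (Fin (2 * n))) ∞ w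
      (U ∩ tanBase (n := n) x₀) := by
    have h1 := hP.contMDiffOn_trivEnd hU x₀
    have h2 := hJ.contMDiffOn_trivEnd hU x₀
    have h3 : ContMDiffOn (𝓡 (2 * n))
        𝓘(ℝ, EuclideanSpace ℝ (Fin (2 * n)) →L[ℝ] EuclideanSpace ℝ (Fin (2 * n))) ∞
        (fun x => (1 / 2 : ℝ) • (ContinuousLinearMap.id ℝ _ + trivEnd x₀ x (P x)))
        (U ∩ tanBase (n := n) x₀) := by
      have h4 : ContDiff ℝ ∞ (fun A : EuclideanSpace ℝ (Fin (2 * n)) →L[ℝ]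
          EuclideanSpace ℝ (Fin (2 * n)) => (1 / 2 : ℝ) • (ContinuousLinearMap.id ℝ _ + A)) := by
        fun_prop
      exact h4.contMDiff.comp_contMDiffOn h1
    exact (h3.clm_comp contMDiffOn_const).add (h2.clm_comp (h3.clm_comp contMDiffOn_const))
  have hwx₀ : w x₀ ∈ Set.range (ContinuousLinearEquiv.toContinuousLinearMap :
      (Std n ≃L[ℝ] EuclideanSpace ℝ (Fin (2 * n))) → _) := by
    have h1 : ∀ X : Std n, w x₀ X = F (X (Pi.single 0 1)) +
        trivEnd x₀ x₀ (J x₀) (F (X (Pi.single 1 1))) := by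
      intro X
      have hF' : ∀ v, trivEnd x₀ x₀ (P x₀) (F v) = F v := fun v => DFunLike.congr_fun hF v
      simp only [w, eigenFrame_apply, hF', ← two_smul ℝ (F _), smul_smul]
      norm_num
    refine ⟨(LinearEquiv.ofBijective (w x₀).toLinearMap ?_).toContinuousLinearEquiv, rfl⟩
    convert hbij using 1
    exact funext h1
  have hopen := hw.continuousOn.isOpen_inter_preimage hU'
    (ContinuousLinearEquiv.isOpen (𝕜 := ℝ) (E := Std n) (F := EuclideanSpace ℝ (Fin (2 * n))))
  refine ⟨_, hopen, ⟨hxU, hwx₀⟩, fun x => tanSymm x₀ x ∘L w x, ?_, ?_⟩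
  · rintro x ⟨hx, ⟨v, hv⟩⟩
    let τ := ContinuousLinearEquiv.equivOfInverse (tanTriv x₀ x) (tanSymm x₀ x)
      (tanSymm_tanTriv hx.2) (tanTriv_tanSymm hx.2)
    let u := v.trans τ.symm
    have hu : ∀ X, u X = tanSymm x₀ x (w x X) := fun X => by
      rw [← hv]; rfl
    have hPu : ∀ X, P x (u X) = tanSymm x₀ x (trivEnd x₀ x (P x) (w x X)) := fun X => by
      simp [hu, trivEnd, tanSymm_tanTriv hx.2]
    have hJu : ∀ X, J x (u X) = tanSymm x₀ x (trivEnd x₀ x (J x) (w x X)) := fun X => by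
      simp [hu, trivEnd, tanSymm_tanTriv hx.2]
    have hP2' : ∀ v, trivEnd x₀ x (P x) (trivEnd x₀ x (P x) v) = v :=
      fun v => DFunLike.congr_fun (hP2 x hx) v
    have hJ2' : ∀ v, trivEnd x₀ x (J x) (trivEnd x₀ x (J x) v) = v :=
      fun v => DFunLike.congr_fun (hJ2 x hx) v
    have hPJ' : ∀ v, trivEnd x₀ x (P x) (trivEnd x₀ x (J x) v) =
      -trivEnd x₀ x (J x) (trivEnd x₀ x (P x) v) := fun v => DFunLike.congr_fun (hPJ x hx) v
    let sw : (Fin 2 → ℝ) →L[ℝ] (Fin 2 → ℝ) := j₀ + f₀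
    have hsw : ∀ v, sw v = ![v 1, v 0] := fun v => by
      simp [sw, j₀_apply, f₀_apply]
    have hs0 : sw (Pi.single 0 1) = Pi.single 1 1 := by
      rw [hsw]; ext i; fin_cases i <;> simp
    have hs1 : sw (Pi.single 1 1) = Pi.single 0 1 := by
      rw [hsw]; ext i; fin_cases i <;> simp
    have hh0 : h₀ (Pi.single 0 1) = Pi.single 0 1 := by
      rw [h₀_apply]; ext i; fin_cases i <;> simp
    have hh1 : h₀ (Pi.single 1 1) = -Pi.single 1 1 := by
      rw [h₀_apply]; ext i; fin_cases i <;> simp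
    refine ⟨u, ?_, ?_⟩
    · rw [mkFrame_mem_iff]
      intro A
      rw [(hrel x hx.1).2.2.2.2]
      refine mem_span_iff u _ _ _ sw hsw ?_ ?_ (hrel x hx.1).2.2.1 A
      · rw [eq_conjR_iff]
        intro X
        rw [hPu, hu]
        congr 1
        simp only [w, eigenFrame_apply, ContinuousLinearMap.comp_apply, hh0, hh1, map_add, map_smul,
          map_neg, hP2', hPJ']
        module
      · rw [eq_conjR_iff]
        intro X
        rw [hJu, hu]
        congr 1
        simp only [w, eigenFrame_apply, ContinuousLinearMap.comp_apply, hs0, hs1, map_add, map_smul,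
          hJ2']
        module
    · ext1 X
      exact (hu X).symm
  · intro x hx
    refine ContMDiffAt.contMDiffWithinAt ?_
    rw [contMDiffAt_frameT_iff (x₀ := x₀) hx.1.2]
    refine ⟨contMDiffAt_id, ?_⟩
    refine (hw.contMDiffAt (hU'.mem_nhds hx.1)).congr_of_eventuallyEq ?_
    filter_upwards [(isOpen_tanBase (n := n) x₀).mem_nhds hx.1.2] with y hy
    ext1 X
    change tanTriv x₀ y (tanSymm x₀ y (w y X)) = w y X
    rw [tanTriv_tanSymm hy]

lemma exists_adapted (x : M) : ∃ u : Std n ≃L[ℝ] TangentSpace (𝓡 (2 * n)) x,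
    mkFrame x u ∈ adaptedFrames 𝒬 := by
  obtain ⟨U, -, hx, s, hs, -⟩ := exists_localFrame_aux 𝒬 x
  obtain ⟨u, hu, -⟩ := hs x hx
  exact ⟨u, hu⟩

/-- Constant change of a local frame. -/
def LocalFrame.move {𝒬 : AlmostParaQuaternionic n M} (s : LocalFrame 𝒬)
    (A : (Fin 2 → ℝ) ≃L[ℝ] (Fin 2 → ℝ)) (B : (Fin n → ℝ) ≃L[ℝ] (Fin n → ℝ)) : LocalFrame 𝒬 where
  dom := s.dom
  isOpen_dom := s.isOpen_dom
  lin x := (ContinuousLinearEquiv.arrowCongr A B : Std n ≃L[ℝ] Std n).trans (s.lin x)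
  adapted x := moveFrame_mem 𝒬 (s.adapted x) A B
  smooth _ hx := (s.contMDiffAt_frame_comp contMDiffAt_id hx contMDiffAt_const).contMDiffWithinAt

variable [NeZero n]

/-- Through every adapted frame there is a local adapted frame. -/
theorem exists_localFrame {x : M} {u : Std n ≃L[ℝ] TangentSpace (𝓡 (2 * n)) x}
    (hu : mkFrame x u ∈ adaptedFrames 𝒬) :
    ∃ s : LocalFrame 𝒬, x ∈ s.dom ∧ s.lin x = u := by
  obtain ⟨U, hU, hx, s, hs, hsm⟩ := exists_localFrame_aux 𝒬 x
  -- A `LocalFrame` has a value at every point; outside `U` an arbitrary adapted frame is taken.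
  have h1 : ∀ y, ∃ v : Std n ≃L[ℝ] TangentSpace (𝓡 (2 * n)) y,
      mkFrame y v ∈ adaptedFrames 𝒬 ∧ (y ∈ U → s y = v) := by
    intro y
    by_cases hy : y ∈ U
    · obtain ⟨v, hv, hv'⟩ := hs y hy
      exact ⟨v, hv, fun _ => hv'⟩
    · obtain ⟨v, hv⟩ := exists_adapted 𝒬 y
      exact ⟨v, hv, fun h => absurd h hy⟩
  choose v hv hv' using h1
  let s' : LocalFrame 𝒬 :=
    { dom := U
      isOpen_dom := hU
      lin := v
      adapted := hv
      smooth := hsm.congr fun y hy => by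
        change (⟨y, _⟩ : FrameT n M) = ⟨y, _⟩
        rw [hv' y hy] }
  -- A constant change of frame makes the field pass through `u`.
  obtain ⟨A, B, h⟩ := exists_moveFrame 𝒬 (hv x) hu
  exact ⟨s'.move A B, hx, h.symm⟩

end Existence

/-! ### The manifold structure of the correspondence space -/

section Hub

variable {n : ℕ} [NeZero n] {M : Type*} [TopologicalSpace M]
  [ChartedSpace (EuclideanSpace ℝ (Fin (2 * n))) M] [IsManifold (𝓡 (2 * n)) ∞ M]
  {𝒬 : AlmostParaQuaternionic n M}

namespace LocalFrame

variable (s : LocalFrame 𝒬)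

/-- The nilpotent endomorphism determined by a frame, in the coordinates of the local frame. -/
def nil (u : FrameT n M) : Std n →L[ℝ] Std n :=
  s.coordFrame u ∘L rmul n j₀ ∘L (s.coordFrame u).inverse

lemma coordFrame_mkFrame (x : M) (u : Std n ≃L[ℝ] TangentSpace (𝓡 (2 * n)) x) :
    s.coordFrame (mkFrame x u) = (u.trans (s.lin x).symm).toContinuousLinearMap := rfl

/-- `nil` is defined on all of `FrameT n M` by means of `inverse`, so that its smoothness can be
stated on an open set of the ambient manifold. On frames it is the matrix of the nilpotent `conjR u
j₀`. -/
lemma nil_mkFrame (x : M) (u : Std n ≃L[ℝ] TangentSpace (𝓡 (2 * n)) x) :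
    s.nil (mkFrame x u) = s.coordEnd (⟨x, conjR u j₀⟩ : EndT n M) := by
  rw [nil, coordFrame_mkFrame, ContinuousLinearMap.inverse_equiv]
  rfl

lemma coordEnd_conjR (x : M) (a : (Fin 2 → ℝ) →L[ℝ] (Fin 2 → ℝ)) :
    s.coordEnd (⟨x, conjR (s.lin x) a⟩ : EndT n M) = rmul n a := by
  ext1 X
  simp [coordEnd, conjR]

lemma coordEnd_smul (x : M) (k : ℝ)
    (C : TangentSpace (𝓡 (2 * n)) x →L[ℝ] TangentSpace (𝓡 (2 * n)) x) :
    s.coordEnd (⟨x, k • C⟩ : EndT n M) = k • s.coordEnd (⟨x, C⟩ : EndT n M) := by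
  ext1 X
  simp [coordEnd]

/-- The open set of frames with non-degenerate coordinate. -/
def frameDom : Set (FrameT n M) :=
  {u | (u.1 ∈ s.dom ∧ s.coordFrame u ∈ Set.range
    (ContinuousLinearEquiv.toContinuousLinearMap : (Std n ≃L[ℝ] Std n) → _)) ∧
    lastCol 0 (s.nil u) ≠ 0}

/-- The affine coordinate of the flag of a frame. -/
def slope (u : FrameT n M) : ℝ := lastCol 1 (s.nil u) / lastCol 0 (s.nil u)

lemma isOpen_coordFrame_range : IsOpen {u : FrameT n M | u.1 ∈ s.dom ∧ s.coordFrame u ∈ Set.range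
    (ContinuousLinearEquiv.toContinuousLinearMap : (Std n ≃L[ℝ] Std n) → _)} :=
  s.contMDiffOn_coordFrame.continuousOn.isOpen_inter_preimage
    (s.isOpen_dom.preimage (FiberBundle.continuous_proj _ _)) ContinuousLinearEquiv.isOpen

lemma contMDiffOn_nil : ContMDiffOn (modelFrame n) 𝓘(ℝ, Std n →L[ℝ] Std n) ∞ s.nil
    {u : FrameT n M | u.1 ∈ s.dom ∧ s.coordFrame u ∈ Set.range
      (ContinuousLinearEquiv.toContinuousLinearMap : (Std n ≃L[ℝ] Std n) → _)} := by
  intro u hu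
  refine ContMDiffAt.contMDiffWithinAt ?_
  have h1 : ContMDiffAt (modelFrame n) 𝓘(ℝ, Std n →L[ℝ] Std n) ∞ s.coordFrame u :=
    s.contMDiffOn_coordFrame.contMDiffAt
      ((s.isOpen_dom.preimage (FiberBundle.continuous_proj _ _)).mem_nhds hu.1)
  obtain ⟨g, hg⟩ := hu.2
  have h2 : ContMDiffAt (modelFrame n) 𝓘(ℝ, Std n →L[ℝ] Std n) ∞
      (fun u => (s.coordFrame u).inverse) u := by
    have h4 : ContDiffAt ℝ ∞ (ContinuousLinearMap.inverse : (Std n →L[ℝ] Std n) → _)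
        (s.coordFrame u) := by
      rw [← hg]
      exact contDiffAt_map_inverse g
    exact ContMDiffAt.comp (f := s.coordFrame) u h4.contMDiffAt h1
  have h3 : ContMDiffAt (modelFrame n) 𝓘(ℝ, Std n →L[ℝ] Std n) ∞
      (fun _ : FrameT n M => rmul n j₀) u := contMDiffAt_const
  exact h1.clm_comp (h3.clm_comp h2)

lemma contMDiffOn_lastCol_nil (b : Fin 2) :
    ContMDiffOn (modelFrame n) 𝓘(ℝ, ℝ) ∞ (fun u => lastCol b (s.nil u))
    {u : FrameT n M | u.1 ∈ s.dom ∧ s.coordFrame u ∈ Set.range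
      (ContinuousLinearEquiv.toContinuousLinearMap : (Std n ≃L[ℝ] Std n) → _)} :=
  (contDiff_lastCol b).contMDiff.comp_contMDiffOn s.contMDiffOn_nil

lemma isOpen_frameDom : IsOpen s.frameDom :=
  (s.contMDiffOn_lastCol_nil 0).continuousOn.isOpen_inter_preimage s.isOpen_coordFrame_range
    isOpen_ne

lemma contMDiffOn_slope : ContMDiffOn (modelFrame n) 𝓘(ℝ, ℝ) ∞ s.slope s.frameDom :=
  ((s.contMDiffOn_lastCol_nil 1).mono fun _ hu => hu.1).div₀
    ((s.contMDiffOn_lastCol_nil 0).mono fun _ hu => hu.1) fun _ hu => hu.2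

lemma mem_frameDom_iff (x : M) (u : Std n ≃L[ℝ] TangentSpace (𝓡 (2 * n)) x) :
    mkFrame x u ∈ s.frameDom ↔ x ∈ s.dom ∧ lastCol 0 (s.nil (mkFrame x u)) ≠ 0 :=
  ⟨fun h => ⟨h.1.1, h.2⟩, fun h => ⟨⟨h.1, ⟨u.trans (s.lin x).symm, rfl⟩⟩, h.2⟩⟩

/-- The frame `s_x · (1 0; t 1)`. -/
def slice (x : M) (t : ℝ) : adaptedFrames 𝒬 :=
  ⟨moveFrame (mkFrame x (s.lin x)) (shear t) (ContinuousLinearEquiv.refl ℝ _),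
    moveFrame_mem 𝒬 (s.adapted x) _ _⟩

/-- The linear isomorphism underlying `slice`. -/
def sliceLin (x : M) (t : ℝ) : Std n ≃L[ℝ] TangentSpace (𝓡 (2 * n)) x :=
  (ContinuousLinearEquiv.arrowCongr (shear t) (ContinuousLinearEquiv.refl ℝ _) :
    Std n ≃L[ℝ] Std n).trans (s.lin x)

lemma slice_val (x : M) (t : ℝ) : (s.slice x t).1 = mkFrame x (s.sliceLin x t) := rfl

lemma conjR_sliceLin (x : M) (t : ℝ) :
    conjR (s.sliceLin x t) j₀ = conjR (s.lin x) (nilMat 1 t) := by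
  rw [sliceLin, conjR_arrowCongr, shear_conj]

lemma nil_slice (x : M) (t : ℝ) : s.nil (s.slice x t).1 = rmul n (nilMat 1 t) := by
  rw [slice_val, nil_mkFrame, conjR_sliceLin, coordEnd_conjR]

lemma slice_mem_frameDom {x : M} (hx : x ∈ s.dom) (t : ℝ) : (s.slice x t).1 ∈ s.frameDom := by
  rw [slice_val, mem_frameDom_iff, ← slice_val, nil_slice, lastCol_rmul, (nilMat_entries 1 t).2.1]
  exact ⟨hx, one_ne_zero⟩

lemma slope_slice (x : M) (t : ℝ) : s.slope (s.slice x t).1 = t := by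
  rw [slope, nil_slice, lastCol_rmul, lastCol_rmul, (nilMat_entries 1 t).2.1,
    (nilMat_entries 1 t).2.2.2]
  simp

/-- In the coordinates of a local frame, an element of the `0`-twistor space is `nilMat`. -/
lemma eq_conjR_nilMat {x : M}
    {C : TangentSpace (𝓡 (2 * n)) x →L[ℝ] TangentSpace (𝓡 (2 * n)) x}
    (hC : (⟨x, C⟩ : EndT n M) ∈ zeroTwistor 𝒬)
    (h0 : lastCol 0 (s.coordEnd (⟨x, C⟩ : EndT n M)) ≠ 0) :
    C = conjR (s.lin x) (nilMat (lastCol 0 (s.coordEnd (⟨x, C⟩ : EndT n M)))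
      (lastCol 1 (s.coordEnd (⟨x, C⟩ : EndT n M)) /
        lastCol 0 (s.coordEnd (⟨x, C⟩ : EndT n M)))) := by
  obtain ⟨a, h1, h2, h3, rfl⟩ := exists_eq_conjR 𝒬 (s.adapted x) hC
  rw [coordEnd_conjR, lastCol_rmul] at h0
  rw [coordEnd_conjR, lastCol_rmul, lastCol_rmul, ← eq_nilMat h1 h2 h0]

lemma nilMat_eq_smul (z t : ℝ) : nilMat z t = z • nilMat 1 t := by
  simp [nilMat]

lemma conjR_j₀_mem {x : M} {u : Std n ≃L[ℝ] TangentSpace (𝓡 (2 * n)) x}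
    (hu : mkFrame x u ∈ adaptedFrames 𝒬) :
    (⟨x, conjR u j₀⟩ : EndT n M) ∈ zeroTwistor 𝒬 :=
  conjR_mem_zeroTwistor 𝒬 hu tr₂_j₀ j₀_comp_j₀ j₀_ne_zero

/-- The nilpotent of `u` is `nilMat z t`, which is `z` times the nilpotent `nilMat 1 t` of the slice
of the same slope; proportional nilpotents give the same flag. -/
lemma sameFlag_slice (u : adaptedFrames 𝒬) (h : u.1 ∈ s.frameDom) :
    sameFlag 𝒬 (s.slice u.1.1 (s.slope u.1)) u := by
  induction u using adaptedFrames_rec with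
  | h x u hu =>
  rw [mem_frameDom_iff, nil_mkFrame] at h
  have h1 := s.eq_conjR_nilMat (conjR_j₀_mem hu) h.2
  have hsl : mkFrame x (s.sliceLin x (s.slope (mkFrame x u))) ∈ adaptedFrames 𝒬 :=
    (s.slice x _).2
  refine (sameFlag_iff 𝒬 hsl hu).2 ⟨_, h.2, ?_⟩
  refine h1.trans ?_
  rw [nilMat_eq_smul, conjR_smul]
  refine congrArg _ (Eq.trans ?_ (s.conjR_sliceLin _ _).symm)
  rw [slope, nil_mkFrame]

lemma base_eq_of_sameFlag {u v : adaptedFrames 𝒬} (h : sameFlag 𝒬 u v) : v.1.1 = u.1.1 := by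
  obtain ⟨A, B, -, h⟩ := h
  rw [h]; rfl

/-- The nilpotent of a frame changes by a non-zero factor along a class, so the domain of the slope
and the slope, a ratio of entries, descend to the quotient. -/
lemma sameFlag_nil {u v : adaptedFrames 𝒬} (h : sameFlag 𝒬 u v) :
    ∃ k : ℝ, k ≠ 0 ∧ s.nil v.1 = k • s.nil u.1 := by
  induction u using adaptedFrames_rec with
  | h x u hu =>
  induction v using adaptedFrames_rec with
  | h y v hv =>
  obtain rfl : y = x := base_eq_of_sameFlag h
  obtain ⟨k, hk, h⟩ := (sameFlag_iff 𝒬 hu hv).1 h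
  refine ⟨k, hk, ?_⟩
  rw [nil_mkFrame, nil_mkFrame, h, coordEnd_smul]

lemma mem_frameDom_of_sameFlag {u v : adaptedFrames 𝒬} (h : sameFlag 𝒬 u v) :
    u.1 ∈ s.frameDom ↔ v.1 ∈ s.frameDom := by
  obtain ⟨k, hk, h1⟩ := s.sameFlag_nil h
  have h2 := base_eq_of_sameFlag h
  induction u using adaptedFrames_rec with
  | h x u hu =>
  induction v using adaptedFrames_rec with
  | h y v hv =>
  obtain rfl : y = x := h2
  rw [mem_frameDom_iff, mem_frameDom_iff, h1, lastCol_smul]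
  simp [hk]

lemma slope_of_sameFlag {u v : adaptedFrames 𝒬} (h : sameFlag 𝒬 u v) :
    s.slope u.1 = s.slope v.1 := by
  obtain ⟨k, hk, h1⟩ := s.sameFlag_nil h
  rw [slope, slope, h1, lastCol_smul, lastCol_smul, mul_div_mul_left _ _ hk]

/-- This form shows that the moved frame depends affinely, hence smoothly, on `t`. -/
lemma shear_arrowCongr (t : ℝ) :
    (ContinuousLinearEquiv.arrowCongr (shear t) (ContinuousLinearEquiv.refl ℝ (Fin n → ℝ)) :
      Std n ≃L[ℝ] Std n).toContinuousLinearMap =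
      rmul n (ContinuousLinearMap.id ℝ _ - t • f₀) := by
  ext1 X
  ext1 v
  have : (shear t).symm v = v - t • f₀ v := by
    ext i; fin_cases i <;> simp [shear_symm_apply, f₀_apply]
  simp [this]

variable {N EN HN : Type*} [NormedAddCommGroup EN] [NormedSpace ℝ EN]
    [TopologicalSpace HN] {K : ModelWithCorners ℝ EN HN} [TopologicalSpace N] [ChartedSpace HN N]

lemma contMDiffAt_slice {x : N → M} {t : N → ℝ} {p : N}
    (hx : ContMDiffAt K (𝓡 (2 * n)) ∞ x p) (hp : x p ∈ s.dom)
    (ht : ContMDiffAt K 𝓘(ℝ, ℝ) ∞ t p) :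
    ContMDiffAt K (modelFrame n) ∞ (fun q => (s.slice (x q) (t q)).1) p := by
  refine s.contMDiffAt_frame_comp (g := fun q => ContinuousLinearEquiv.arrowCongr (shear (t q))
    (ContinuousLinearEquiv.refl ℝ (Fin n → ℝ))) hx hp ?_
  have h1 : ContDiff ℝ ∞ (fun t : ℝ => rmul n (ContinuousLinearMap.id ℝ _ - t • f₀)) :=
    contDiff_rmul.comp (by fun_prop)
  refine (ContMDiffAt.comp (f := t) p h1.contMDiff.contMDiffAt ht).congr_of_eventuallyEq ?_
  exact Filter.Eventually.of_forall fun q => shear_arrowCongr (t q)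

end LocalFrame

variable (𝒬) in
/-- The correspondence space is a quotient manifold of the bundle of adapted frames. -/
theorem exists_corrSpace_manifold :
    ∃ (_ : ChartedSpace (EuclideanSpace ℝ (Fin (2 * n)) × ℝ) (CorrSpace 𝒬))
      (_ : IsManifold (modelC n) ∞ (CorrSpace 𝒬)),
      IsSmoothQuotient (modelFrame n) (modelC n)
        (Subtype.val : adaptedFrames 𝒬 → FrameT n M) (sameFlag 𝒬) := by
  refine exists_quotient_manifold Topology.IsInducing.subtypeVal (sameFlag 𝒬) ?_
  intro u₀
  induction u₀ using adaptedFrames_rec with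
  | h x u hu =>
  obtain ⟨s, hxs, hs⟩ := exists_localFrame 𝒬 hu
  let φ := chartAt (EuclideanSpace ℝ (Fin (2 * n))) x
  have hpr : Continuous (fun v : FrameT n M => v.1) := FiberBundle.continuous_proj _ _
  have hbO : IsOpen {v : FrameT n M | v.1 ∈ φ.source ∧ v ∈ s.frameDom} :=
    (φ.open_source.preimage hpr).inter s.isOpen_frameDom
  have hu0 : (⟨mkFrame x u, hu⟩ : adaptedFrames 𝒬) = s.slice x 0 := by
    refine Subtype.ext ?_
    rw [LocalFrame.slice_val, LocalFrame.sliceLin, hs, shear_zero]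
    rfl
  -- The coordinates are a chart of `M` and the slope. The slope takes all real values on each
  -- fibre, so the second factor of the target is everything.
  refine ⟨{v | v.1.1 ∈ φ.source ∧ v.1 ∈ s.frameDom}, fun v => (φ v.1.1, s.slope v.1),
    (φ.target ∩ φ.symm ⁻¹' s.dom) ×ˢ Set.univ, fun y => s.slice (φ.symm y.1) y.2,
    hbO.preimage continuous_subtype_val,
    (φ.symm.isOpen_inter_preimage s.isOpen_dom).prod isOpen_univ, ?_, ?_, ?_, ?_, ?_, ?_, ?_, ?_⟩
  · rw [hu0]
    exact ⟨mem_chart_source _ x, s.slice_mem_frameDom hxs 0⟩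
  · rw [hu0]
    simp only [s.slope_slice]
    rw [show φ.symm (φ (s.slice x 0).1.1) = x from φ.left_inv (mem_chart_source _ x)]
  · intro v w h
    simp only [Set.mem_ofPred_eq, LocalFrame.base_eq_of_sameFlag h, s.mem_frameDom_of_sameFlag h]
  · intro v w h _
    simp only [LocalFrame.base_eq_of_sameFlag h, s.slope_of_sameFlag h]
  · rintro v ⟨h1, h2⟩
    refine ⟨⟨⟨φ.map_source h1, ?_⟩, Set.mem_univ _⟩, ?_⟩
    · change φ.symm (φ v.1.1) ∈ s.dom
      rw [φ.left_inv h1]; exact h2.1.1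
    · refine Quot.sound ?_
      simp only [φ.left_inv h1]
      exact s.sameFlag_slice v h2
  · rintro ⟨y, t⟩ ⟨⟨h1, h2⟩, -⟩
    refine ⟨⟨φ.map_target h1, s.slice_mem_frameDom h2 t⟩, Prod.ext (φ.right_inv h1) ?_⟩
    exact s.slope_slice _ t
  · rintro v hv
    refine ⟨_, hbO, hv, fun w => (φ w.1, s.slope w), ?_, fun w hw => ⟨hw, rfl⟩⟩
    refine ContMDiffOn.prodMk_space ?_ (s.contMDiffOn_slope.mono fun w hw => hw.2)
    exact (contMDiffOn_chart (I := 𝓡 (2 * n)) (n := ∞) (x := x)).comp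
      (contMDiffOn_proj _) fun w hw => hw.1
  · rintro ⟨y, t⟩ ⟨⟨h1, h2⟩, -⟩
    refine ContMDiffAt.contMDiffWithinAt ?_
    have h3 : ContMDiffAt 𝓘(ℝ, EuclideanSpace ℝ (Fin (2 * n)) × ℝ) (𝓡 (2 * n)) ∞
        (fun y : EuclideanSpace ℝ (Fin (2 * n)) × ℝ => φ.symm y.1) (y, t) :=
      ContMDiffAt.comp (f := Prod.fst) (y, t)
        ((contMDiffOn_chart_symm (I := 𝓡 (2 * n)) (n := ∞) (x := x)).contMDiffAt
          (φ.open_target.mem_nhds h1)) contDiff_fst.contMDiff.contMDiffAt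
    exact s.contMDiffAt_slice h3 h2 contDiff_snd.contMDiff.contMDiffAt

end Hub

/-! ### The vertical bundle of the correspondence space -/

section Vertical

variable {n : ℕ} [NeZero n] {M : Type*} [TopologicalSpace M]
  [ChartedSpace (EuclideanSpace ℝ (Fin (2 * n))) M] [IsManifold (𝓡 (2 * n)) ∞ M]
  {𝒬 : AlmostParaQuaternionic n M}

namespace LocalFrame

variable (s : LocalFrame 𝒬)

/-- The class of the frame `s_x · (1 0; t 1)`. -/
def cls (x : M) (t : ℝ) : CorrSpace 𝒬 := Quot.mk _ (s.slice x t)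

/-- The set of classes of frames with non-degenerate coordinate. -/
def clsDom : Set (CorrSpace 𝒬) :=
  {c | Quot.lift (fun u : adaptedFrames 𝒬 => u.1 ∈ s.frameDom)
    (fun _ _ h => propext (s.mem_frameDom_of_sameFlag h)) c}

/-- The affine coordinate on the fibres of the correspondence space. -/
def param : CorrSpace 𝒬 → ℝ :=
  Quot.lift (fun u : adaptedFrames 𝒬 => s.slope u.1) fun _ _ h => s.slope_of_sameFlag h

lemma proj_cls (x : M) (t : ℝ) : CorrSpace.proj 𝒬 (s.cls x t) = x := rfl

lemma param_cls (x : M) (t : ℝ) : s.param (s.cls x t) = t := s.slope_slice x t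

lemma cls_mem_clsDom {x : M} (hx : x ∈ s.dom) (t : ℝ) : s.cls x t ∈ s.clsDom :=
  s.slice_mem_frameDom hx t

lemma mk_mem_clsDom (u : adaptedFrames 𝒬) :
    (Quot.mk _ u : CorrSpace 𝒬) ∈ s.clsDom ↔ u.1 ∈ s.frameDom := Iff.rfl

lemma proj_mem_dom {c : CorrSpace 𝒬} (hc : c ∈ s.clsDom) : CorrSpace.proj 𝒬 c ∈ s.dom := by
  induction c using Quot.ind with
  | mk u => exact hc.1.1

lemma cls_param {c : CorrSpace 𝒬} (hc : c ∈ s.clsDom) :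
    s.cls (CorrSpace.proj 𝒬 c) (s.param c) = c := by
  induction c using Quot.ind with
  | mk u => exact Quot.sound (s.sameFlag_slice u hc)

lemma isOpen_clsDom : IsOpen s.clsDom := by
  rw [← isQuotientMap_quot_mk.isOpen_preimage]
  exact s.isOpen_frameDom.preimage continuous_subtype_val

end LocalFrame

lemma exists_cls_eq {x : M} {u : Std n ≃L[ℝ] TangentSpace (𝓡 (2 * n)) x}
    (hu : mkFrame x u ∈ adaptedFrames 𝒬) :
    ∃ s : LocalFrame 𝒬, x ∈ s.dom ∧ s.lin x = u ∧ s.cls x 0 = Quot.mk _ ⟨mkFrame x u, hu⟩ := by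
  obtain ⟨s, hx, hs⟩ := exists_localFrame 𝒬 hu
  refine ⟨s, hx, hs, congrArg _ (Subtype.ext ?_)⟩
  rw [LocalFrame.slice_val, LocalFrame.sliceLin, hs, shear_zero]
  rfl

variable (𝒬) in
lemma exists_mem_clsDom (c : CorrSpace 𝒬) : ∃ s : LocalFrame 𝒬, c ∈ s.clsDom := by
  induction c using Quot.ind with
  | mk u =>
  induction u using adaptedFrames_rec with
  | h x u hu =>
  obtain ⟨s, hx, -, h⟩ := exists_cls_eq hu
  exact ⟨s, h ▸ s.cls_mem_clsDom hx 0⟩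

variable (𝒬) in
lemma CorrSpace.proj_surjective : Function.Surjective (CorrSpace.proj 𝒬) := by
  intro x
  obtain ⟨u, hu⟩ := exists_adapted 𝒬 x
  exact ⟨Quot.mk _ ⟨mkFrame x u, hu⟩, rfl⟩

variable [ChartedSpace (EuclideanSpace ℝ (Fin (2 * n)) × ℝ) (CorrSpace 𝒬)]
  [IsManifold (modelC n) ∞ (CorrSpace 𝒬)]
  (hq : IsSmoothQuotient (modelFrame n) (modelC n)
    (Subtype.val : adaptedFrames 𝒬 → FrameT n M) (sameFlag 𝒬))

include hq in
lemma CorrSpace.contMDiff_proj : ContMDiff (modelC n) (𝓡 (2 * n)) ∞ (CorrSpace.proj 𝒬) := by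
  intro c
  induction c using Quot.ind with
  | mk u =>
  refine hq.contMDiffAt (F := TotalSpace.proj) (contMDiffAt_proj _)
    (Filter.Eventually.of_forall ?_)
  rintro p t rfl
  rfl

include hq in
lemma LocalFrame.contMDiffOn_param (s : LocalFrame 𝒬) :
    ContMDiffOn (modelC n) 𝓘(ℝ, ℝ) ∞ s.param s.clsDom := by
  intro c hc
  refine ContMDiffAt.contMDiffWithinAt ?_
  induction c using Quot.ind with
  | mk u =>
  refine hq.contMDiffAt (F := s.slope) (s.contMDiffOn_slope.contMDiffAt
    (s.isOpen_frameDom.mem_nhds hc)) (Filter.Eventually.of_forall ?_)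
  rintro p t rfl
  rfl

include hq in
lemma LocalFrame.contMDiffAt_cls (s : LocalFrame 𝒬) {N EN HN : Type*} [NormedAddCommGroup EN]
    [NormedSpace ℝ EN] [TopologicalSpace HN] {K : ModelWithCorners ℝ EN HN} [TopologicalSpace N]
    [ChartedSpace HN N] {x : N → M} {t : N → ℝ} {p : N}
    (hx : ContMDiffAt K (𝓡 (2 * n)) ∞ x p) (hp : x p ∈ s.dom)
    (ht : ContMDiffAt K 𝓘(ℝ, ℝ) ∞ t p) :
    ContMDiffAt K (modelC n) ∞ (fun q => s.cls (x q) (t q)) p :=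
  hq.contMDiffAt_mk_comp (s.contMDiffAt_slice hx hp ht)

include hq in
lemma LocalFrame.mdifferentiableAt_cls (s : LocalFrame 𝒬) {x : M} (hx : x ∈ s.dom) (t : ℝ) :
    MDifferentiableAt 𝓘(ℝ, ℝ) (modelC n) (s.cls x) t :=
  (s.contMDiffAt_cls hq (x := fun _ : ℝ => x) contMDiffAt_const hx
    contMDiffAt_id).mdifferentiableAt (by simp)

include hq in
lemma CorrSpace.mdifferentiableAt_proj (c : CorrSpace 𝒬) :
    MDifferentiableAt (modelC n) (𝓡 (2 * n)) (CorrSpace.proj 𝒬) c :=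
  (CorrSpace.contMDiff_proj hq c).mdifferentiableAt (by simp)

include hq in
-- For fixed `t`, the map `y ↦ s.cls y t` is a section of the projection, smooth near `x`; its
-- derivative is a right inverse.
lemma CorrSpace.mfderiv_proj_surjective (c : CorrSpace 𝒬) :
    Function.Surjective (mfderiv (modelC n) (𝓡 (2 * n)) (CorrSpace.proj 𝒬) c) := by
  obtain ⟨s, hc⟩ := exists_mem_clsDom 𝒬 c
  have h1 := s.cls_param hc
  -- Once its coordinates are free variables, the point can be replaced by `s.cls x t`.
  generalize CorrSpace.proj 𝒬 c = x, s.param c = t at h1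
  have hx : x ∈ s.dom := by rw [← h1] at hc; exact s.proj_mem_dom hc
  subst h1
  have h2 : MDifferentiableAt (𝓡 (2 * n)) (modelC n) (fun y => s.cls y t) x :=
    (s.contMDiffAt_cls hq contMDiffAt_id hx contMDiffAt_const).mdifferentiableAt (by simp)
  have h3 := mfderiv_comp x (CorrSpace.mdifferentiableAt_proj hq (s.cls x t)) h2
  have h4 : CorrSpace.proj 𝒬 ∘ (fun y => s.cls y t) = id := rfl
  rw [h4, mfderiv_id] at h3
  intro v
  exact ⟨mfderiv (𝓡 (2 * n)) (modelC n) (fun y => s.cls y t) x v,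
    (DFunLike.congr_fun h3 v).symm⟩

include hq in
-- Rank–nullity for a surjection from dimension `2n + 1` to dimension `2n`.
lemma CorrSpace.finrank_ker_mfderiv_proj (c : CorrSpace 𝒬) :
    Module.finrank ℝ
      (mfderiv (modelC n) (𝓡 (2 * n)) (CorrSpace.proj 𝒬) c).toLinearMap.ker = 1 := by
  let f : (EuclideanSpace ℝ (Fin (2 * n)) × ℝ) →ₗ[ℝ] EuclideanSpace ℝ (Fin (2 * n)) :=
    (mfderiv (modelC n) (𝓡 (2 * n)) (CorrSpace.proj 𝒬) c).toLinearMap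
  have hf : Function.Surjective f := CorrSpace.mfderiv_proj_surjective hq c
  have h1 := f.finrank_range_add_finrank_ker
  rw [LinearMap.range_eq_top.2 hf, finrank_top, Module.finrank_prod, finrank_euclideanSpace,
    Fintype.card_fin, Module.finrank_self] at h1
  exact Nat.add_left_cancel h1

namespace LocalFrame

variable (s : LocalFrame 𝒬)

/-- The velocity of the curve `t ↦ s.cls x t`, multiplied by `τ`. -/
def velocity (x : M) (t τ : ℝ) : TangentBundle (modelC n) (CorrSpace 𝒬) :=
  ⟨s.cls x t, mfderiv 𝓘(ℝ, ℝ) (modelC n) (s.cls x) t τ⟩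

include hq in
-- `param` is a left inverse of `s.cls x`, so its derivative recovers the speed. In particular
-- velocities with non-zero speed do not vanish.
lemma mfderiv_param_velocity {x : M} (hx : x ∈ s.dom) (t τ : ℝ) :
    mfderiv (modelC n) 𝓘(ℝ, ℝ) s.param (s.cls x t) (s.velocity x t τ).2 = τ := by
  have h3 := mfderiv_comp t (((s.contMDiffOn_param hq).contMDiffAt (s.isOpen_clsDom.mem_nhds
    (s.cls_mem_clsDom hx t))).mdifferentiableAt (by simp)) (s.mdifferentiableAt_cls hq hx t)
  have h4 : s.param ∘ s.cls x = id := funext fun t => s.param_cls x t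
  rw [h4, mfderiv_id] at h3
  exact (DFunLike.congr_fun h3 τ).symm

include hq in
lemma mfderiv_proj_velocity {x : M} (hx : x ∈ s.dom) (t τ : ℝ) :
    mfderiv (modelC n) (𝓡 (2 * n)) (CorrSpace.proj 𝒬) (s.cls x t) (s.velocity x t τ).2 = 0 := by
  have h3 := mfderiv_comp t (CorrSpace.mdifferentiableAt_proj hq (s.cls x t))
    (s.mdifferentiableAt_cls hq hx t)
  have h4 : CorrSpace.proj 𝒬 ∘ s.cls x = fun _ => x := rfl
  rw [h4, mfderiv_const] at h3
  exact (DFunLike.congr_fun h3 τ).symm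

include hq in
lemma velocity_mem {x : M} (hx : x ∈ s.dom) (t : ℝ) {τ : ℝ} (hτ : τ ≠ 0) :
    s.velocity x t τ ∈ verticalNonzero 𝒬 := by
  refine ⟨s.mfderiv_proj_velocity hq hx t τ, fun h => hτ ?_⟩
  rw [← s.mfderiv_param_velocity hq hx t τ]
  exact (congrArg _ h).trans (map_zero _)

include hq in
/-- Vertical vectors are velocities. -/
lemma eq_velocity {v : TangentBundle (modelC n) (CorrSpace 𝒬)} (hv : v ∈ verticalBundle 𝒬)
    (hc : v.1 ∈ s.clsDom) :
    v = s.velocity (CorrSpace.proj 𝒬 v.1) (s.param v.1)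
      (mfderiv (modelC n) 𝓘(ℝ, ℝ) s.param v.1 v.2) := by
  obtain ⟨c, v⟩ := v
  dsimp only at hc
  have h1 := s.cls_param hc
  generalize CorrSpace.proj 𝒬 c = x, s.param c = t at h1
  have hx : x ∈ s.dom := by rw [← h1] at hc; exact s.proj_mem_dom hc
  subst h1
  let f : (EuclideanSpace ℝ (Fin (2 * n)) × ℝ) →ₗ[ℝ] EuclideanSpace ℝ (Fin (2 * n)) :=
    (mfderiv (modelC n) (𝓡 (2 * n)) (CorrSpace.proj 𝒬) (s.cls x t)).toLinearMap
  have hf : Module.finrank ℝ (LinearMap.ker f) = 1 :=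
    CorrSpace.finrank_ker_mfderiv_proj hq (s.cls x t)
  -- The unit velocity is a non-zero vector in a one-dimensional kernel and spans it.
  let w : LinearMap.ker f := ⟨(s.velocity x t 1).2, s.mfderiv_proj_velocity hq hx t 1⟩
  have hw : w ≠ 0 := fun h => (s.velocity_mem hq hx t one_ne_zero).2 (congrArg Subtype.val h)
  obtain ⟨k, hk⟩ := (finrank_eq_one_iff_of_nonzero' w hw).1 hf ⟨v, hv⟩
  have hk' : v = mfderiv 𝓘(ℝ, ℝ) (modelC n) (s.cls x) t k := by
    refine (congrArg Subtype.val hk).symm.trans ?_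
    refine ((mfderiv 𝓘(ℝ, ℝ) (modelC n) (s.cls x) t).map_smul k (1 : ℝ)).symm.trans ?_
    exact congrArg _ (mul_one k)
  have h5 : mfderiv (modelC n) 𝓘(ℝ, ℝ) s.param (s.cls x t) v = k := by
    rw [hk']; exact s.mfderiv_param_velocity hq hx t k
  exact (congrArg (fun w => (⟨s.cls x t, w⟩ : TangentBundle (modelC n) (CorrSpace 𝒬))) hk').trans
    (congrArg (s.velocity x t) h5.symm)

end LocalFrame

end Vertical

/-! ### The canonical map from the `0`-twistor space to the vertical bundle -/

section FlagVelocity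

variable {n : ℕ} [NeZero n] {M : Type*} [TopologicalSpace M]
  [ChartedSpace (EuclideanSpace ℝ (Fin (2 * n))) M] [IsManifold (𝓡 (2 * n)) ∞ M]
  {𝒬 : AlmostParaQuaternionic n M}

namespace LocalFrame

variable (s : LocalFrame 𝒬)

/-- The scale of a nilpotent endomorphism in the coordinates of the local frame. -/
def endScale (C : EndT n M) : ℝ := lastCol 0 (s.coordEnd C)

/-- The flag coordinate of a nilpotent endomorphism. -/
def endSlope (C : EndT n M) : ℝ := lastCol 1 (s.coordEnd C) / lastCol 0 (s.coordEnd C)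

/-- The frames on the flag curve of `s_x · (A, B)` in the coordinates of the local frame. -/
lemma lastCol_nil_shear {x : M} (A : (Fin 2 → ℝ) ≃L[ℝ] (Fin 2 → ℝ))
    (B : (Fin n → ℝ) ≃L[ℝ] (Fin n → ℝ)) (τ : ℝ) :
    ∃ d : ℝ, d ≠ 0 ∧
      d = A e₁ 0 * A (Pi.single 1 1) 1 - A e₁ 1 * A (Pi.single 1 1) 0 ∧
      ∀ b, lastCol b (s.nil (moveFrame
        (mkFrame x ((ContinuousLinearEquiv.arrowCongr A B : Std n ≃L[ℝ] Std n).trans (s.lin x)))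
        (shear τ) (ContinuousLinearEquiv.refl ℝ _))) * d =
        (A e₁ 0 + τ * A (Pi.single 1 1) 0) * (A e₁ b + τ * A (Pi.single 1 1) b) := by
  have h1 : ∀ b, ((shear τ).trans A) e₁ b = A e₁ b + τ * A (Pi.single 1 1) b := by
    intro b
    have : shear τ e₁ = e₁ + τ • (Pi.single 1 1 : Fin 2 → ℝ) := by
      ext i; fin_cases i <;> simp [shear_apply, e₁]
    simp [this]
  have h2 : ((shear τ).trans A) (Pi.single 1 1) = A (Pi.single 1 1) := by
    have : shear τ (Pi.single 1 1) = (Pi.single 1 1 : Fin 2 → ℝ) := by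
      ext i; fin_cases i <;> simp [shear_apply]
    simp [this]
  obtain ⟨d, hd, hd', h⟩ := conj_j₀_entries ((shear τ).trans A)
  refine ⟨d, hd, ?_, fun b => ?_⟩
  · rw [hd', h1, h1, h2]; ring
  · rw [moveFrame_mkFrame, nil_mkFrame, conjR_arrowCongr, conjR_arrowCongr, coordEnd_conjR,
      lastCol_rmul, ← h1, ← h1, ← h]
    rfl

variable [ChartedSpace (EuclideanSpace ℝ (Fin (2 * n)) × ℝ) (CorrSpace 𝒬)]
  [IsManifold (modelC n) ∞ (CorrSpace 𝒬)]
  (hq : IsSmoothQuotient (modelFrame n) (modelC n)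
    (Subtype.val : adaptedFrames 𝒬 → FrameT n M) (sameFlag 𝒬))

include hq in
-- The chain rule along a curve that is given by `g` only near `0`; the slope of a flag curve
-- becomes infinite where its line leaves the affine chart.
lemma velocity_of_eventuallyEq {x : M} (hx : x ∈ s.dom) {γ : ℝ → CorrSpace 𝒬} {g : ℝ → ℝ} {g' : ℝ}
    (hγ : γ =ᶠ[𝓝 0] fun τ => s.cls x (g τ)) (hg : HasDerivAt g g' 0) :
    (⟨γ 0, mfderiv 𝓘(ℝ, ℝ) (modelC n) γ 0 (1 : ℝ)⟩ : TangentBundle (modelC n) (CorrSpace 𝒬)) =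
      s.velocity x (g 0) g' := by
  have h0 : γ 0 = s.cls x (g 0) := hγ.self_of_nhds
  have h1 : HasMFDerivAt 𝓘(ℝ, ℝ) (modelC n) (s.cls x ∘ g) 0
      ((mfderiv 𝓘(ℝ, ℝ) (modelC n) (s.cls x) (g 0)).comp
        (ContinuousLinearMap.toSpanSingleton ℝ g' : ℝ →L[ℝ] ℝ)) :=
    HasMFDerivAt.comp (I' := 𝓘(ℝ, ℝ)) 0 (s.mdifferentiableAt_cls hq hx (g 0)).hasMFDerivAt
      hg.hasFDerivAt.hasMFDerivAt
  have h2 := (h1.congr_of_eventuallyEq hγ).mfderiv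
  have h3 : ∀ (c : CorrSpace 𝒬) (v : EuclideanSpace ℝ (Fin (2 * n)) × ℝ), c = s.cls x (g 0) →
      v = mfderiv 𝓘(ℝ, ℝ) (modelC n) (s.cls x) (g 0) g' →
      (⟨c, v⟩ : TangentBundle (modelC n) (CorrSpace 𝒬)) = s.velocity x (g 0) g' := by
    rintro c v rfl rfl; rfl
  refine h3 _ _ h0 ?_
  refine (DFunLike.congr_fun h2 (1 : ℝ)).trans ?_
  exact congrArg (mfderiv 𝓘(ℝ, ℝ) (modelC n) (s.cls x) (g 0)) (one_smul ℝ g')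

include hq in
/-- The velocity of the flag curve in terms of a local frame. -/
theorem flagVelocity_eq {x : M} {u : Std n ≃L[ℝ] TangentSpace (𝓡 (2 * n)) x}
    (hu : mkFrame x u ∈ adaptedFrames 𝒬) (hx : x ∈ s.dom)
    (h0 : s.endScale ⟨x, conjR u j₀⟩ ≠ 0) :
    flagVelocity 𝒬 ⟨mkFrame x u, hu⟩ =
      s.velocity x (s.endSlope ⟨x, conjR u j₀⟩) (s.endScale ⟨x, conjR u j₀⟩)⁻¹ := by
  obtain ⟨A, B, rfl⟩ := exists_moveFrame 𝒬 (s.adapted x) hu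
  set w := A e₁ with hw
  set z := A (Pi.single 1 1) with hz
  have hL := fun τ => s.lastCol_nil_shear (x := x) A B τ
  rw [← hw, ← hz] at hL
  -- At time `τ` the line is spanned by `w + τ z`, and the slope is the ratio of its coordinates.
  -- The determinant and a common factor `w 0 + τ * z 0` cancel from the two entries.
  have hslope : ∀ τ, w 0 + τ * z 0 ≠ 0 → flagCurve 𝒬 ⟨mkFrame x _, hu⟩ τ =
      s.cls x ((w 1 + τ * z 1) / (w 0 + τ * z 0)) := by
    intro τ hτ
    obtain ⟨d, hd, -, h⟩ := hL τ
    have hne : lastCol 0 (s.nil (moveFrame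
        (mkFrame x ((ContinuousLinearEquiv.arrowCongr A B : Std n ≃L[ℝ] Std n).trans (s.lin x)))
        (shear τ) (ContinuousLinearEquiv.refl ℝ _))) ≠ 0 := by
      intro h1
      have := h 0
      rw [h1, zero_mul] at this
      exact hτ (mul_self_eq_zero.1 this.symm)
    have hmem : moveFrame
        (mkFrame x ((ContinuousLinearEquiv.arrowCongr A B : Std n ≃L[ℝ] Std n).trans (s.lin x)))
        (shear τ) (ContinuousLinearEquiv.refl ℝ _) ∈ s.frameDom := by
      rw [moveFrame_mkFrame, mem_frameDom_iff]
      exact ⟨hx, hne⟩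
    refine (Quot.sound (s.sameFlag_slice ⟨_, moveFrame_mem 𝒬 hu _ _⟩ hmem)).symm.trans ?_
    refine congrArg (s.cls x) ?_
    rw [slope, ← mul_div_mul_right _ _ hd, h, h, mul_div_mul_left _ _ hτ]
  obtain ⟨d, hd, hdet, h⟩ := hL 0
  -- At `τ = 0`: the scale is `w₀² / d`, so a non-zero scale forces `w₀ ≠ 0`.
  have hscale : ∀ b, lastCol b (s.coordEnd (⟨x, conjR ((ContinuousLinearEquiv.arrowCongr A B :
      Std n ≃L[ℝ] Std n).trans (s.lin x)) j₀⟩ : EndT n M)) * d = w 0 * w b := by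
    intro b
    have := h b
    rw [moveFrame_mkFrame, nil_mkFrame, conjR_arrowCongr, shear_zero] at this
    simpa using this
  have hw0 : w 0 ≠ 0 := by
    intro h1
    have := hscale 0
    rw [h1, zero_mul] at this
    exact (mul_ne_zero h0 hd) this
  have hg : HasDerivAt (fun τ => (w 1 + τ * z 1) / (w 0 + τ * z 0))
      (((0 + 1 * z 1) * (w 0 + 0 * z 0) - (w 1 + 0 * z 1) * (0 + 1 * z 0)) /
        (w 0 + 0 * z 0) ^ 2) 0 := by
    have hlin : ∀ b, HasDerivAt (fun τ => w b + τ * z b) (0 + 1 * z b) 0 := fun b =>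
      (hasDerivAt_const _ _).add ((hasDerivAt_id _).mul_const _)
    exact (hlin 1).div (hlin 0) (by simpa using hw0)
  have hev : flagCurve 𝒬 ⟨mkFrame x _, hu⟩ =ᶠ[𝓝 0]
      fun τ => s.cls x ((w 1 + τ * z 1) / (w 0 + τ * z 0)) := by
    have hc : ContinuousAt (fun τ : ℝ => w 0 + τ * z 0) 0 := by fun_prop
    filter_upwards [hc.eventually_ne (by simpa using hw0)] with τ hτ using hslope τ hτ
  refine (s.velocity_of_eventuallyEq hq hx hev hg).trans ?_
  have e1 : (w 1 + 0 * z 1) / (w 0 + 0 * z 0) = s.endSlope ⟨x, conjR ((ContinuousLinearEquiv.arrowCongr A B :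
      Std n ≃L[ℝ] Std n).trans (s.lin x)) j₀⟩ := by
    rw [endSlope, eq_div_of_mul_eq hd (hscale 0), eq_div_of_mul_eq hd (hscale 1),
      div_div_div_cancel_right₀ hd, mul_div_mul_left _ _ hw0]
    simp
  -- The quotient rule gives the numerator `w₀ z₁ - w₁ z₀ = d`, so the derivative `d / w₀²` is
  -- exactly the reciprocal of the scale.
  have e2 : ((0 + 1 * z 1) * (w 0 + 0 * z 0) - (w 1 + 0 * z 1) * (0 + 1 * z 0)) /
        (w 0 + 0 * z 0) ^ 2 = (s.endScale ⟨x, conjR ((ContinuousLinearEquiv.arrowCongr A B :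
      Std n ≃L[ℝ] Std n).trans (s.lin x)) j₀⟩)⁻¹ := by
    rw [endScale, eq_div_of_mul_eq hd (hscale 0), inv_div, hdet]
    ring
  rw [e1, e2]

end LocalFrame

end FlagVelocity

/-! ### The bijection between the `0`-twistor space and the non-zero vertical vectors. -/

section NilVelocity

variable {n : ℕ} [NeZero n] {M : Type*} [TopologicalSpace M]
  [ChartedSpace (EuclideanSpace ℝ (Fin (2 * n))) M] [IsManifold (𝓡 (2 * n)) ∞ M]
  {𝒬 : AlmostParaQuaternionic n M}

lemma tr₂_nilMat (z t : ℝ) : tr₂ (nilMat z t) = 0 := by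
  obtain ⟨n1, n2, n3, n4⟩ := nilMat_entries z t
  rw [tr₂_eq, n1, n4]
  ring

lemma nilMat_comp_nilMat (z t : ℝ) : nilMat z t ∘L nilMat z t = 0 := by
  obtain ⟨n1, n2, n3, n4⟩ := nilMat_entries z t
  refine plane_ext fun b k => ?_
  rw [ContinuousLinearMap.comp_apply, plane_apply]
  fin_cases b <;> fin_cases k <;>
    simp only [Fin.zero_eta, Fin.mk_one, Fin.isValue, n1, n2, n3, n4, zero_apply,
      Pi.zero_apply] <;> ring

lemma nilMat_ne_zero {z : ℝ} (hz : z ≠ 0) (t : ℝ) : nilMat z t ≠ 0 := by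
  intro h
  have := (nilMat_entries z t).2.1
  rw [h] at this
  exact hz this.symm

lemma exists_eq_conjR_j₀ (A : zeroTwistor 𝒬) :
    ∃ (x : M) (u : Std n ≃L[ℝ] TangentSpace (𝓡 (2 * n)) x) (_ : mkFrame x u ∈ adaptedFrames 𝒬),
      A.1 = ⟨x, conjR u j₀⟩ := by
  obtain ⟨⟨x, C⟩, hA⟩ := A
  obtain ⟨v, hv⟩ := exists_adapted 𝒬 x
  obtain ⟨u, hu, rfl⟩ := exists_frame_of_zeroTwistor 𝒬 hv hA
  exact ⟨x, u, hu, rfl⟩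

lemma zeroTwistor_rec {p : zeroTwistor 𝒬 → Prop}
    (h : ∀ x (u : Std n ≃L[ℝ] TangentSpace (𝓡 (2 * n)) x) (hu : mkFrame x u ∈ adaptedFrames 𝒬),
      p ⟨⟨x, conjR u j₀⟩, LocalFrame.conjR_j₀_mem hu⟩) (A : zeroTwistor 𝒬) : p A := by
  obtain ⟨x, u, hu, hA⟩ := exists_eq_conjR_j₀ A
  rw [show A = ⟨⟨x, conjR u j₀⟩, LocalFrame.conjR_j₀_mem hu⟩ from Subtype.ext hA]
  exact h x u hu

namespace LocalFrame

variable (s : LocalFrame 𝒬)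

/-- The open set of endomorphisms with non-zero scale. -/
def endDom : Set (EndT n M) := {C | C.1 ∈ s.dom ∧ s.endScale C ≠ 0}

lemma contMDiffOn_lastCol_coordEnd (b : Fin 2) :
    ContMDiffOn (modelEnd n) 𝓘(ℝ, ℝ) ∞ (fun C => lastCol b (s.coordEnd C))
      (TotalSpace.proj ⁻¹' s.dom) :=
  (contDiff_lastCol b).contMDiff.comp_contMDiffOn s.contMDiffOn_coordEnd

lemma isOpen_endDom : IsOpen s.endDom :=
  (s.contMDiffOn_lastCol_coordEnd 0).continuousOn.isOpen_inter_preimage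
    (s.isOpen_dom.preimage (FiberBundle.continuous_proj _ _)) isOpen_ne

lemma contMDiffOn_endScale : ContMDiffOn (modelEnd n) 𝓘(ℝ, ℝ) ∞ s.endScale s.endDom :=
  (s.contMDiffOn_lastCol_coordEnd 0).mono fun _ h => h.1

lemma contMDiffOn_endSlope : ContMDiffOn (modelEnd n) 𝓘(ℝ, ℝ) ∞ s.endSlope s.endDom :=
  ((s.contMDiffOn_lastCol_coordEnd 1).mono fun _ h => h.1).div₀
    ((s.contMDiffOn_lastCol_coordEnd 0).mono fun _ h => h.1) fun _ h => h.2

lemma endScale_smul (x : M) (k : ℝ)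
    (C : TangentSpace (𝓡 (2 * n)) x →L[ℝ] TangentSpace (𝓡 (2 * n)) x) :
    s.endScale (⟨x, k • C⟩ : EndT n M) = k * s.endScale (⟨x, C⟩ : EndT n M) := by
  rw [endScale, endScale, coordEnd_smul, lastCol_smul]

lemma endSlope_smul (x : M) {k : ℝ} (hk : k ≠ 0)
    (C : TangentSpace (𝓡 (2 * n)) x →L[ℝ] TangentSpace (𝓡 (2 * n)) x) :
    s.endSlope (⟨x, k • C⟩ : EndT n M) = s.endSlope (⟨x, C⟩ : EndT n M) := by
  rw [endSlope, endSlope, coordEnd_smul, lastCol_smul, lastCol_smul, mul_div_mul_left _ _ hk]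

/-- The endomorphism with given scale and slope. -/
def nilEnd (x : M) (z t : ℝ) : EndT n M := ⟨x, conjR (s.lin x) (nilMat z t)⟩

lemma endScale_nilEnd (x : M) (z t : ℝ) : s.endScale (s.nilEnd x z t) = z := by
  rw [endScale, nilEnd, coordEnd_conjR, lastCol_rmul, (nilMat_entries z t).2.1]

lemma endSlope_nilEnd (x : M) {z : ℝ} (hz : z ≠ 0) (t : ℝ) :
    s.endSlope (s.nilEnd x z t) = t := by
  rw [endSlope, nilEnd, coordEnd_conjR, lastCol_rmul, lastCol_rmul, (nilMat_entries z t).2.1,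
    (nilMat_entries z t).2.2.2, mul_div_cancel_left₀ _ hz]

lemma nilEnd_one (x : M) (t : ℝ) : s.nilEnd x 1 t = ⟨x, conjR (s.sliceLin x t) j₀⟩ := by
  rw [conjR_sliceLin]; rfl

lemma nilEnd_mem (x : M) {z : ℝ} (hz : z ≠ 0) (t : ℝ) : s.nilEnd x z t ∈ zeroTwistor 𝒬 :=
  conjR_mem_zeroTwistor 𝒬 (s.adapted x) (tr₂_nilMat z t) (nilMat_comp_nilMat z t)
    (nilMat_ne_zero hz t)

lemma eq_nilEnd (A : zeroTwistor 𝒬) (h : s.endScale A.1 ≠ 0) :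
    A.1 = s.nilEnd A.1.1 (s.endScale A.1) (s.endSlope A.1) := by
  obtain ⟨⟨x, C⟩, hA⟩ := A
  exact congrArg (TotalSpace.mk x) (s.eq_conjR_nilMat hA h)

end LocalFrame

variable [ChartedSpace (EuclideanSpace ℝ (Fin (2 * n)) × ℝ) (CorrSpace 𝒬)]
  [IsManifold (modelC n) ∞ (CorrSpace 𝒬)]
  (hq : IsSmoothQuotient (modelFrame n) (modelC n)
    (Subtype.val : adaptedFrames 𝒬 → FrameT n M) (sameFlag 𝒬))

/-- The vertical tangent vector that corresponds to an element of the `0`-twistor space. -/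
def nilVelocity (A : zeroTwistor 𝒬) : TangentBundle (modelC n) (CorrSpace 𝒬) :=
  flagVelocity 𝒬 ⟨_, (exists_eq_conjR_j₀ A).choose_spec.choose_spec.choose⟩

include hq in
lemma nilVelocity_eq (s : LocalFrame 𝒬) (A : zeroTwistor 𝒬) (h : A.1 ∈ s.endDom) :
    nilVelocity A = s.velocity A.1.1 (s.endSlope A.1) (s.endScale A.1)⁻¹ := by
  have h1 := (exists_eq_conjR_j₀ A).choose_spec.choose_spec.choose_spec
  rw [h1] at h
  refine (s.flagVelocity_eq hq _ h.1 h.2).trans ?_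
  rw [← h1]

include hq in
-- The choice of a frame in `nilVelocity` is immaterial: by `flagVelocity_eq` the velocity is a
-- function of the nilpotent.
lemma nilVelocity_conjR {x : M} {u : Std n ≃L[ℝ] TangentSpace (𝓡 (2 * n)) x}
    (hu : mkFrame x u ∈ adaptedFrames 𝒬) :
    nilVelocity ⟨⟨x, conjR u j₀⟩, LocalFrame.conjR_j₀_mem hu⟩ =
      flagVelocity 𝒬 ⟨mkFrame x u, hu⟩ := by
  obtain ⟨s, hx, hs, -⟩ := exists_cls_eq hu
  have h0 : s.endScale ⟨x, conjR u j₀⟩ ≠ 0 := by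
    rw [LocalFrame.endScale, ← hs, s.coordEnd_conjR, lastCol_rmul, j₀_apply]
    exact one_ne_zero
  have h1 := s.flagVelocity_eq hq hu hx h0
  have h2 := nilVelocity_eq hq s ⟨⟨x, conjR u j₀⟩, LocalFrame.conjR_j₀_mem hu⟩ ⟨hx, h0⟩
  rw [h1, h2]

lemma flagVelocity_fst (u : adaptedFrames 𝒬) : (flagVelocity 𝒬 u).1 = Quot.mk _ u := by
  refine congrArg (Quot.mk _) (Subtype.ext ?_)
  change moveFrame u.1 (shear 0) (ContinuousLinearEquiv.refl ℝ _) = u.1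
  rw [shear_zero]
  rfl

include hq in
lemma nilVelocity_fst {x : M} {u : Std n ≃L[ℝ] TangentSpace (𝓡 (2 * n)) x}
    (hu : mkFrame x u ∈ adaptedFrames 𝒬) :
    (nilVelocity ⟨⟨x, conjR u j₀⟩, LocalFrame.conjR_j₀_mem hu⟩).1 =
      Quot.mk _ ⟨mkFrame x u, hu⟩ := by
  rw [nilVelocity_conjR hq, flagVelocity_fst]

include hq in
lemma proj_nilVelocity (A : zeroTwistor 𝒬) : CorrSpace.proj 𝒬 (nilVelocity A).1 = A.1.1 := by
  induction A using zeroTwistor_rec with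
  | h x u hu =>
  rw [nilVelocity_fst hq hu]
  rfl

include hq in
lemma nilVelocity_mem_clsDom (s : LocalFrame 𝒬) (A : zeroTwistor 𝒬) :
    (nilVelocity A).1 ∈ s.clsDom ↔ A.1 ∈ s.endDom := by
  induction A using zeroTwistor_rec with
  | h x u hu =>
  rw [nilVelocity_fst hq hu, LocalFrame.mk_mem_clsDom, LocalFrame.mem_frameDom_iff,
    LocalFrame.nil_mkFrame]
  rfl

include hq in
lemma nilVelocity_mem (A : zeroTwistor 𝒬) : nilVelocity A ∈ verticalNonzero 𝒬 := by
  obtain ⟨s, hs⟩ := exists_mem_clsDom 𝒬 (nilVelocity A).1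
  rw [nilVelocity_mem_clsDom hq] at hs
  rw [nilVelocity_eq hq s A hs]
  exact s.velocity_mem hq hs.1 _ (inv_ne_zero hs.2)

include hq in
-- Multiplying the nilpotent by `c` leaves the slope and multiplies the scale by `c`; the speed is
-- the inverse of the scale.
lemma nilVelocity_smul {A B : zeroTwistor 𝒬} {c : ℝ} (hc : c ≠ 0)
    (h : B.1 = ⟨A.1.1, c • A.1.2⟩) :
    nilVelocity B = ⟨(nilVelocity A).1, c⁻¹ • (nilVelocity A).2⟩ := by
  obtain ⟨s, hs⟩ := exists_mem_clsDom 𝒬 (nilVelocity A).1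
  rw [nilVelocity_mem_clsDom hq] at hs
  have h1 : s.endScale B.1 = c * s.endScale A.1 := by
    rw [h, LocalFrame.endScale_smul]
  have h2 : s.endSlope B.1 = s.endSlope A.1 := by
    rw [h, LocalFrame.endSlope_smul _ _ hc]
  have h3 : B.1.1 = A.1.1 := by rw [h]
  have hB : B.1 ∈ s.endDom := ⟨h3 ▸ hs.1, h1 ▸ mul_ne_zero hc hs.2⟩
  rw [nilVelocity_eq hq s A hs, nilVelocity_eq hq s B hB, h1, h2, h3, mul_inv]
  exact congrArg (fun w => (⟨s.cls A.1.1 (s.endSlope A.1), w⟩ :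
    TangentBundle (modelC n) (CorrSpace 𝒬)))
    ((mfderiv 𝓘(ℝ, ℝ) (modelC n) (s.cls A.1.1) (s.endSlope A.1)).map_smul c⁻¹
      ((s.endScale A.1)⁻¹ : ℝ))

/-- The inverse of `nilVelocity` in terms of a local frame. -/
def LocalFrame.unvelocity (s : LocalFrame 𝒬) (v : TangentBundle (modelC n) (CorrSpace 𝒬)) :
    EndT n M :=
  s.nilEnd (CorrSpace.proj 𝒬 v.1) (mfderiv (modelC n) 𝓘(ℝ, ℝ) s.param v.1 v.2 : ℝ)⁻¹
    (s.param v.1)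

include hq in
lemma LocalFrame.unvelocity_velocity (s : LocalFrame 𝒬) {x : M} (hx : x ∈ s.dom) (t τ : ℝ) :
    s.unvelocity (s.velocity x t τ) = s.nilEnd x τ⁻¹ t := by
  have h1 := s.mfderiv_param_velocity hq hx t τ
  have h2 := s.param_cls x t
  exact (congrArg (fun z : ℝ => s.nilEnd x z⁻¹ (s.param (s.cls x t))) h1).trans
    (congrArg (s.nilEnd x τ⁻¹) h2)

include hq in
lemma LocalFrame.unvelocity_nilVelocity (s : LocalFrame 𝒬) (A : zeroTwistor 𝒬)
    (h : (nilVelocity A).1 ∈ s.clsDom) : s.unvelocity (nilVelocity A) = A.1 := by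
  rw [nilVelocity_mem_clsDom hq] at h
  rw [nilVelocity_eq hq s A h, s.unvelocity_velocity hq h.1, inv_inv]
  exact (s.eq_nilEnd A h.2).symm

include hq in
lemma nilVelocity_injective : Function.Injective (nilVelocity (𝒬 := 𝒬)) := by
  intro A B h
  obtain ⟨s, hs⟩ := exists_mem_clsDom 𝒬 (nilVelocity A).1
  refine Subtype.ext ?_
  rw [← s.unvelocity_nilVelocity hq A hs, ← s.unvelocity_nilVelocity hq B (h ▸ hs), h]

include hq in
lemma exists_nilVelocity_eq {v : TangentBundle (modelC n) (CorrSpace 𝒬)}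
    (hv : v ∈ verticalNonzero 𝒬) : ∃ A : zeroTwistor 𝒬, nilVelocity A = v := by
  obtain ⟨s, hs⟩ := exists_mem_clsDom 𝒬 v.1
  obtain ⟨x, t, τ, hx, rfl⟩ : ∃ (x : M) (t τ : ℝ), x ∈ s.dom ∧ v = s.velocity x t τ :=
    ⟨_, _, _, s.proj_mem_dom hs, s.eq_velocity hq hv.1 hs⟩
  have hτ : τ ≠ 0 := by
    rintro rfl
    exact hv.2 (map_zero (mfderiv 𝓘(ℝ, ℝ) (modelC n) (s.cls x) t))
  -- Speed and scale are reciprocal, so the preimage has scale `τ⁻¹` and slope `t`.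
  have hz := inv_ne_zero hτ
  have hd : s.nilEnd x τ⁻¹ t ∈ s.endDom := ⟨hx, by rwa [s.endScale_nilEnd]⟩
  refine ⟨⟨s.nilEnd x τ⁻¹ t, s.nilEnd_mem x hz t⟩, ?_⟩
  rw [nilVelocity_eq hq s _ hd, s.endSlope_nilEnd x hz, s.endScale_nilEnd, inv_inv]
  rfl

include hq in
lemma nilVelocity_bijective : Function.Bijective
    (fun A : zeroTwistor 𝒬 => (⟨nilVelocity A, nilVelocity_mem hq A⟩ : verticalNonzero 𝒬)) :=
  ⟨fun _ _ h => nilVelocity_injective hq (congrArg Subtype.val h),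
    fun v => (exists_nilVelocity_eq hq v.2).imp fun _ h => Subtype.ext h⟩

/-- The canonical bijection from the `0`-twistor space to the non-zero vertical vectors. -/
def nilVelocityEquiv : zeroTwistor 𝒬 ≃ verticalNonzero 𝒬 :=
  Equiv.ofBijective _ (nilVelocity_bijective hq)

end NilVelocity

/-! ### Smoothness of the bijection, and the projectivized `0`-twistor space. -/

section SmoothVelocity

variable {n : ℕ} [NeZero n] {M : Type*} [TopologicalSpace M]
  [ChartedSpace (EuclideanSpace ℝ (Fin (2 * n))) M] [IsManifold (𝓡 (2 * n)) ∞ M]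
  {𝒬 : AlmostParaQuaternionic n M}
  [ChartedSpace (EuclideanSpace ℝ (Fin (2 * n)) × ℝ) (CorrSpace 𝒬)]
  [IsManifold (modelC n) ∞ (CorrSpace 𝒬)]
  (hq : IsSmoothQuotient (modelFrame n) (modelC n)
    (Subtype.val : adaptedFrames 𝒬 → FrameT n M) (sameFlag 𝒬))

section

variable {N EN HN : Type*} [NormedAddCommGroup EN] [NormedSpace ℝ EN]
    [TopologicalSpace HN] {K : ModelWithCorners ℝ EN HN} [TopologicalSpace N] [ChartedSpace HN N]

/-- A smooth family of vectors tangent to the second factor of `M × ℝ`. -/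
lemma contMDiffAt_vertical_prod {x : N → M} {t τ : N → ℝ} {p : N}
    (hx : ContMDiffAt K (𝓡 (2 * n)) ∞ x p) (ht : ContMDiffAt K 𝓘(ℝ, ℝ) ∞ t p)
    (hτ : ContMDiffAt K 𝓘(ℝ, ℝ) ∞ τ p) :
    ContMDiffAt K ((𝓡 (2 * n)).prod 𝓘(ℝ, ℝ)).tangent ∞
      (fun q => (equivTangentBundleProd (𝓡 (2 * n)) M 𝓘(ℝ, ℝ) ℝ).symm
        (⟨x q, 0⟩, ⟨t q, τ q⟩)) p := by
  have h1 : ContMDiffAt K (𝓡 (2 * n)).tangent ∞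
      (fun q => (⟨x q, 0⟩ : TangentBundle (𝓡 (2 * n)) M)) p :=
    ContMDiffAt.comp (f := x) p ((Bundle.contMDiff_zeroSection ℝ
      (TangentSpace (𝓡 (2 * n)) : M → Type _) (n := ∞)).contMDiffAt) hx
  have h2 : ContMDiffAt K 𝓘(ℝ, ℝ).tangent ∞
      (fun q => (⟨t q, τ q⟩ : TangentBundle 𝓘(ℝ, ℝ) ℝ)) p :=
    by
      rw [Bundle.contMDiffAt_totalSpace]
      refine ⟨ht, hτ.congr_of_eventuallyEq (Filter.Eventually.of_forall fun q => ?_)⟩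
      exact congrArg Prod.snd (trivializationAt_model_space_apply (I := 𝓘(ℝ, ℝ)) _ _)
  exact ContMDiffAt.comp (f := fun q => ((⟨x q, 0⟩, ⟨t q, τ q⟩) :
    TangentBundle (𝓡 (2 * n)) M × TangentBundle 𝓘(ℝ, ℝ) ℝ)) p
    (contMDiff_equivTangentBundleProd_symm (n := ∞)).contMDiffAt (h1.prodMk h2)

include hq in
lemma LocalFrame.contMDiffOn_cls (s : LocalFrame 𝒬) :
    ContMDiffOn ((𝓡 (2 * n)).prod 𝓘(ℝ, ℝ)) (modelC n) ∞ (fun q : M × ℝ => s.cls q.1 q.2)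
      (s.dom ×ˢ Set.univ) := fun _ hq' =>
  (s.contMDiffAt_cls hq contMDiffAt_fst hq'.1 contMDiffAt_snd).contMDiffWithinAt

include hq in
lemma LocalFrame.tangentMap_cls (s : LocalFrame 𝒬) {x : M} (hx : x ∈ s.dom) (t τ : ℝ) :
    tangentMap ((𝓡 (2 * n)).prod 𝓘(ℝ, ℝ)) (modelC n) (fun q : M × ℝ => s.cls q.1 q.2)
      ((equivTangentBundleProd (𝓡 (2 * n)) M 𝓘(ℝ, ℝ) ℝ).symm (⟨x, 0⟩, ⟨t, τ⟩)) =
      s.velocity x t τ := by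
  have h1 : MDifferentiableAt ((𝓡 (2 * n)).prod 𝓘(ℝ, ℝ)) (modelC n)
      (fun q : M × ℝ => s.cls q.1 q.2) (x, t) :=
    (s.contMDiffAt_cls hq contMDiffAt_fst hx contMDiffAt_snd).mdifferentiableAt (by simp)
  have h2 : HasMFDerivAt 𝓘(ℝ, ℝ) ((𝓡 (2 * n)).prod 𝓘(ℝ, ℝ)) (fun t : ℝ => (x, t)) t
      ((0 : ℝ →L[ℝ] EuclideanSpace ℝ (Fin (2 * n))).prod (ContinuousLinearMap.id ℝ ℝ)) :=
    (hasMFDerivAt_const x t).prodMk (hasMFDerivAt_id t)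
  have h3 := (HasMFDerivAt.comp t h1.hasMFDerivAt h2).mfderiv
  refine congrArg (TotalSpace.mk (s.cls x t)) ?_
  exact (DFunLike.congr_fun h3 τ).symm

include hq in
-- The velocity is the tangent map of `(x, t) ↦ s.cls x t` applied to the vector with components `0`
-- and `τ`, and tangent maps of smooth maps are smooth.
lemma LocalFrame.contMDiffAt_velocity (s : LocalFrame 𝒬) {x : N → M} {t τ : N → ℝ} {p : N}
    (hx : ContMDiffAt K (𝓡 (2 * n)) ∞ x p) (hp : x p ∈ s.dom)
    (ht : ContMDiffAt K 𝓘(ℝ, ℝ) ∞ t p) (hτ : ContMDiffAt K 𝓘(ℝ, ℝ) ∞ τ p) :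
    ContMDiffAt K (modelC n).tangent ∞ (fun q => s.velocity (x q) (t q) (τ q)) p := by
  have ho : IsOpen (s.dom ×ˢ (Set.univ : Set ℝ)) := s.isOpen_dom.prod isOpen_univ
  have h1 := (s.contMDiffOn_cls hq).contMDiffOn_tangentMapWithin (m := ∞) (by simp)
    ho.uniqueMDiffOn
  have h2 := h1.contMDiffAt (x := (equivTangentBundleProd (𝓡 (2 * n)) M 𝓘(ℝ, ℝ) ℝ).symm
    (⟨x p, 0⟩, ⟨t p, τ p⟩))
    ((ho.preimage (FiberBundle.continuous_proj _ _)).mem_nhds ⟨hp, Set.mem_univ _⟩)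
  refine (ContMDiffAt.comp p h2 (contMDiffAt_vertical_prod hx ht hτ)).congr_of_eventuallyEq ?_
  filter_upwards [hx.continuousAt.preimage_mem_nhds (s.isOpen_dom.mem_nhds hp)] with q hq'
  rw [← s.tangentMap_cls hq hq']
  exact congrArg (fun L : (EuclideanSpace ℝ (Fin (2 * n)) × ℝ) →L[ℝ]
    (EuclideanSpace ℝ (Fin (2 * n)) × ℝ) => (⟨s.cls (x q) (t q), L (0, τ q)⟩ :
      TangentBundle (modelC n) (CorrSpace 𝒬)))
    (mfderivWithin_of_isOpen (f := fun q : M × ℝ => s.cls q.1 q.2) ho (x := (x q, t q))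
      ⟨hq', Set.mem_univ _⟩).symm

include hq in
lemma LocalFrame.contMDiffOn_mfderiv_param (s : LocalFrame 𝒬) :
    ContMDiffOn (modelC n).tangent 𝓘(ℝ, ℝ) ∞
      (fun v : TangentBundle (modelC n) (CorrSpace 𝒬) =>
        (mfderiv (modelC n) 𝓘(ℝ, ℝ) s.param v.1 v.2 : ℝ)) (TotalSpace.proj ⁻¹' s.clsDom) := by
  have h1 := (s.contMDiffOn_param hq).contMDiffOn_tangentMapWithin (m := ∞) (by simp)
    s.isOpen_clsDom.uniqueMDiffOn
  refine ((contMDiff_snd_tangentBundle_modelSpace ℝ 𝓘(ℝ, ℝ)).comp_contMDiffOn h1).congr ?_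
  intro v hv
  exact congrArg (fun L : (EuclideanSpace ℝ (Fin (2 * n)) × ℝ) →L[ℝ] ℝ => L v.2)
    (mfderivWithin_of_isOpen s.isOpen_clsDom hv).symm

lemma contMDiff_nilMat : ContDiff ℝ ∞ (fun y : ℝ × ℝ => nilMat y.1 y.2) := by
  unfold nilMat
  fun_prop

lemma LocalFrame.contMDiffAt_nilEnd (s : LocalFrame 𝒬) {x : N → M} {z t : N → ℝ} {p : N}
    (hx : ContMDiffAt K (𝓡 (2 * n)) ∞ x p) (hp : x p ∈ s.dom)
    (hz : ContMDiffAt K 𝓘(ℝ, ℝ) ∞ z p) (ht : ContMDiffAt K 𝓘(ℝ, ℝ) ∞ t p) :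
    ContMDiffAt K (modelEnd n) ∞ (fun q => s.nilEnd (x q) (z q) (t q)) p :=
  s.contMDiffAt_conjR hx hp (ContMDiffAt.comp (f := fun q => (z q, t q)) p
    contMDiff_nilMat.contMDiff.contMDiffAt (hz.prodMk_space ht))

end

include hq in
lemma smoothAlong_nilVelocity : SmoothAlong (modelEnd n) (modelC n).tangent
    (Subtype.val : zeroTwistor 𝒬 → EndT n M) (nilVelocity (𝒬 := 𝒬)) := by
  intro A
  obtain ⟨s, hs⟩ := exists_mem_clsDom 𝒬 (nilVelocity A).1
  rw [nilVelocity_mem_clsDom hq] at hs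
  refine ⟨s.endDom, s.isOpen_endDom, hs,
    fun C => s.velocity C.1 (s.endSlope C) (s.endScale C)⁻¹, fun C hC => ?_,
    fun B hB => (nilVelocity_eq hq s B hB).symm⟩
  refine ContMDiffAt.contMDiffWithinAt ?_
  have hn := s.isOpen_endDom.mem_nhds hC
  exact s.contMDiffAt_velocity hq (contMDiffAt_proj _) hC.1 (s.contMDiffOn_endSlope.contMDiffAt hn)
    ((s.contMDiffOn_endScale.contMDiffAt hn).inv₀ hC.2)

include hq in
-- The inverse extends to `s.unvelocity`, which is smooth on the open set of all tangent vectors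
-- over `s.clsDom`, vertical or not, on which the derivative of `param` is non-zero. By
-- `eq_velocity` this set contains the non-zero vertical vectors over `s.clsDom`.
lemma smoothAlong_nilVelocityEquiv_symm : SmoothAlong (modelC n).tangent (modelEnd n)
    (Subtype.val : verticalNonzero 𝒬 → TangentBundle (modelC n) (CorrSpace 𝒬))
    (fun v => ((nilVelocityEquiv hq).symm v).1) := by
  intro v
  obtain ⟨s, hs⟩ := exists_mem_clsDom 𝒬 v.1.1
  obtain ⟨f, hf⟩ : ∃ f : TangentBundle (modelC n) (CorrSpace 𝒬) → ℝ, f = fun v =>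
    (mfderiv (modelC n) 𝓘(ℝ, ℝ) s.param v.1 v.2 : ℝ) := ⟨_, rfl⟩
  have hfs : ContMDiffOn (modelC n).tangent 𝓘(ℝ, ℝ) ∞ f (TotalSpace.proj ⁻¹' s.clsDom) :=
    hf ▸ s.contMDiffOn_mfderiv_param hq
  have hO : IsOpen (TotalSpace.proj ⁻¹' s.clsDom : Set (TangentBundle (modelC n) (CorrSpace 𝒬))) :=
    s.isOpen_clsDom.preimage (FiberBundle.continuous_proj _ _)
  refine ⟨TotalSpace.proj ⁻¹' s.clsDom ∩ {w | f w ∈ ({0}ᶜ : Set ℝ)},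
    hfs.continuousOn.isOpen_inter_preimage hO isOpen_compl_singleton, ⟨hs, ?_⟩, s.unvelocity,
    ?_, ?_⟩
  · intro h0
    have h1 := s.eq_velocity hq v.2.1 hs
    have h2 : (mfderiv (modelC n) 𝓘(ℝ, ℝ) s.param v.1.1 v.1.2 : ℝ) = 0 := by
      rw [hf] at h0; exact h0
    have h3 := v.2
    rw [h1] at h3
    refine h3.2 ?_
    exact (congrArg _ h2).trans (map_zero (mfderiv 𝓘(ℝ, ℝ) (modelC n)
      (s.cls (CorrSpace.proj 𝒬 v.1.1)) (s.param v.1.1)))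
  · rintro w ⟨hw, hw0⟩
    refine ContMDiffAt.contMDiffWithinAt ?_
    have h1 : ContMDiffAt (modelC n).tangent (modelC n) ∞
      (fun w : TangentBundle (modelC n) (CorrSpace 𝒬) => w.1) w := contMDiffAt_proj _
    have h2 : ContMDiffAt (modelC n).tangent 𝓘(ℝ, ℝ) ∞ (fun w => (f w)⁻¹) w :=
      (hfs.contMDiffAt (hO.mem_nhds hw)).inv₀ hw0
    have h3 := s.contMDiffAt_nilEnd
      (ContMDiffAt.comp w (CorrSpace.contMDiff_proj hq).contMDiffAt h1) (s.proj_mem_dom hw) h2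
      (ContMDiffAt.comp w ((s.contMDiffOn_param hq).contMDiffAt (s.isOpen_clsDom.mem_nhds hw)) h1)
    rw [hf] at h3
    exact h3
  · rintro w ⟨hw, -⟩
    have h1 : nilVelocity ((nilVelocityEquiv hq).symm w) = w.1 :=
      congrArg Subtype.val ((nilVelocityEquiv hq).apply_symm_apply w)
    exact (congrArg s.unvelocity h1).symm.trans
      (s.unvelocity_nilVelocity hq _ (by rw [h1]; exact hw))

/-- `nilMat z t` is linear in `z`, so nilpotents of equal slope are proportional by the ratio of
their scales. -/
lemma LocalFrame.eq_smul_of_endSlope_eq (s : LocalFrame 𝒬) {A B : zeroTwistor 𝒬}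
    (hA : s.endScale A.1 ≠ 0) (hB : s.endScale B.1 ≠ 0) (h : B.1.1 = A.1.1)
    (hs : s.endSlope B.1 = s.endSlope A.1) :
    B.1 = ⟨A.1.1, (s.endScale B.1 / s.endScale A.1) • A.1.2⟩ := by
  obtain ⟨⟨x, C⟩, hC⟩ := A
  obtain ⟨⟨y, D⟩, hD⟩ := B
  obtain rfl : y = x := h
  refine congrArg (TotalSpace.mk y) ?_
  have key : ∀ z z' t : ℝ, z ≠ 0 → C = conjR (s.lin y) (nilMat z t) →
      D = conjR (s.lin y) (nilMat z' t) → D = (z' / z) • C := by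
    rintro z z' t hz rfl rfl
    rw [nilMat_eq_smul z, nilMat_eq_smul z', conjR_smul, conjR_smul, smul_smul,
      div_mul_cancel₀ _ hz]
  have h1 := s.eq_conjR_nilMat hD hB
  refine key _ _ _ hA (s.eq_conjR_nilMat hC hA) ?_
  exact h1.trans (congrArg (fun t => conjR (s.lin y) (nilMat _ t)) hs)

include hq in
lemma LocalFrame.nilVelocity_nilEnd_fst (s : LocalFrame 𝒬) (x : M) (t : ℝ) :
    (nilVelocity ⟨s.nilEnd x 1 t, s.nilEnd_mem x one_ne_zero t⟩).1 = s.cls x t := by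
  have hsl : mkFrame x (s.sliceLin x t) ∈ adaptedFrames 𝒬 := (s.slice x t).2
  have e : (⟨s.nilEnd x 1 t, s.nilEnd_mem x one_ne_zero t⟩ : zeroTwistor 𝒬) =
      ⟨⟨x, conjR (s.sliceLin x t) j₀⟩, conjR_j₀_mem hsl⟩ := Subtype.ext (s.nilEnd_one x t)
  rw [e, nilVelocity_fst hq hsl]
  rfl

include hq in
/-- The projectivized `0`-twistor space is diffeomorphic to the correspondence space. -/
theorem exists_projZeroTwistor_diffeo :
    ∃ (_ : ChartedSpace (EuclideanSpace ℝ (Fin (2 * n)) × ℝ) (ProjZeroTwistor 𝒬))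
      (_ : IsManifold (modelC n) ∞ (ProjZeroTwistor 𝒬)),
      IsSmoothQuotient (modelEnd n) (modelC n)
        (Subtype.val : zeroTwistor 𝒬 → EndT n M) (sameLine 𝒬) ∧
      ∃ χ : Diffeomorph (modelC n) (modelC n) (ProjZeroTwistor 𝒬) (CorrSpace 𝒬) ∞,
        ∀ A, χ (Quot.mk _ A) = (nilVelocity A).1 := by
  refine exists_quotient_diffeo Topology.IsInducing.subtypeVal (sameLine 𝒬)
    (fun A => (nilVelocity A).1) ?_ ?_ ?_ ?_ ?_
  · intro A
    obtain ⟨U, hU, hA, F, hF, hFf⟩ := smoothAlong_nilVelocity hq A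
    exact ⟨U, hU, hA, fun C => (F C).1, (contMDiff_proj _).comp_contMDiffOn hF,
      fun B hB => congrArg TotalSpace.proj (hFf B hB)⟩
  · intro c
    induction c using Quot.ind with
    | mk u =>
    induction u using adaptedFrames_rec with
    | h x u hu => exact ⟨_, nilVelocity_fst hq hu⟩
  · rintro A B ⟨c, hc, h⟩
    rw [nilVelocity_smul hq hc h]
  · intro A B h
    obtain ⟨s, hs⟩ := exists_mem_clsDom 𝒬 (nilVelocity A).1
    have hs' := h ▸ hs
    rw [nilVelocity_mem_clsDom hq] at hs hs'
    have h1 : B.1.1 = A.1.1 := by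
      rw [← proj_nilVelocity hq, ← proj_nilVelocity hq, h]
    have h2 : s.endSlope B.1 = s.endSlope A.1 := by
      have := congrArg s.param h
      rw [nilVelocity_eq hq s A hs, nilVelocity_eq hq s B hs'] at this
      exact ((s.param_cls _ _).symm.trans (this.symm.trans (s.param_cls _ _)))
    refine ⟨s.endScale B.1 / s.endScale A.1, div_ne_zero hs'.2 hs.2, ?_⟩
    exact s.eq_smul_of_endSlope_eq hs.2 hs'.2 h1 h2
  · intro A
    induction A using zeroTwistor_rec with
    | h x u hu =>
    obtain ⟨s, hx, hs, hc⟩ := exists_cls_eq hu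
    -- The section consists of the nilpotents of scale `1`. It passes through the given nilpotent
    -- because the local frame equals `u` at `x`, where that nilpotent has matrix `j₀`.
    refine ⟨s.clsDom, s.isOpen_clsDom, ?_, fun c => ⟨s.nilEnd (CorrSpace.proj 𝒬 c) 1 (s.param c),
      s.nilEnd_mem _ one_ne_zero _⟩, fun c hc' => ?_, ?_, fun c hc' => ?_⟩
    · rw [nilVelocity_fst hq hu, ← hc]
      exact s.cls_mem_clsDom hx 0
    · exact (s.contMDiffAt_nilEnd (CorrSpace.contMDiff_proj hq).contMDiffAt (s.proj_mem_dom hc')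
        contMDiffAt_const
        ((s.contMDiffOn_param hq).contMDiffAt (s.isOpen_clsDom.mem_nhds hc'))).contMDiffWithinAt
    · refine Subtype.ext ?_
      change s.nilEnd _ 1 _ = _
      rw [nilVelocity_fst hq hu, ← hc, s.proj_cls, s.param_cls, LocalFrame.nilEnd, nilMat_one_zero,
        hs]
    · exact (s.nilVelocity_nilEnd_fst hq _ _).trans (s.cls_param hc')

end SmoothVelocity

/-! ### Global auxiliary bundles -/

section SameFlag

variable {n : ℕ} [NeZero n] {M : Type*} [TopologicalSpace M]
  [ChartedSpace (EuclideanSpace ℝ (Fin (2 * n))) M] [IsManifold (𝓡 (2 * n)) ∞ M]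
  (𝒬 : AlmostParaQuaternionic n M)

/-- Equality in `Quot` is a priori the generated equivalence relation. Here the relation is already
an equivalence, as proportionality of nilpotents is. -/
lemma sameFlag_equivalence : Equivalence (sameFlag 𝒬) where
  refl u := by
    induction u using adaptedFrames_rec with
    | h x u hu => exact (sameFlag_iff 𝒬 hu hu).2 ⟨1, one_ne_zero, (one_smul _ _).symm⟩
  symm {u v} h := by
    have hb := LocalFrame.base_eq_of_sameFlag h
    induction u using adaptedFrames_rec with
    | h x u hu =>
    induction v using adaptedFrames_rec with
    | h y v hv =>
    obtain rfl : y = x := hb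
    obtain ⟨k, hk, h⟩ := (sameFlag_iff 𝒬 hu hv).1 h
    exact (sameFlag_iff 𝒬 hv hu).2 ⟨k⁻¹, inv_ne_zero hk, by rw [h, inv_smul_smul₀ hk]⟩
  trans {u v w} h h' := by
    have hb := LocalFrame.base_eq_of_sameFlag h
    have hb' := LocalFrame.base_eq_of_sameFlag h'
    induction u using adaptedFrames_rec with
    | h x u hu =>
    induction v using adaptedFrames_rec with
    | h y v hv =>
    induction w using adaptedFrames_rec with
    | h z w hw =>
    obtain rfl : y = x := hb
    obtain rfl : z = y := hb'
    obtain ⟨k, hk, h⟩ := (sameFlag_iff 𝒬 hu hv).1 h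
    obtain ⟨k', hk', h'⟩ := (sameFlag_iff 𝒬 hv hw).1 h'
    exact (sameFlag_iff 𝒬 hu hw).2 ⟨k' * k, mul_ne_zero hk' hk, by rw [h', h, smul_smul]⟩

lemma CorrSpace.mk_eq_mk_iff {u v : adaptedFrames 𝒬} :
    (Quot.mk _ u : CorrSpace 𝒬) = Quot.mk _ v ↔ sameFlag 𝒬 u v :=
  ⟨fun h => (sameFlag_equivalence 𝒬).eqvGen_iff.1 (Quot.eqvGen_exact h), Quot.sound⟩

/-- Frames that differ by an element of `GL(2) × GL(n)` determine the same flag if and only if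
the first component of the element stabilizes the line of `e₁`. -/
lemma mk_arrowCongr_eq_iff {x : M} {u : Std n ≃L[ℝ] TangentSpace (𝓡 (2 * n)) x}
    (hu : mkFrame x u ∈ adaptedFrames 𝒬) (A : (Fin 2 → ℝ) ≃L[ℝ] (Fin 2 → ℝ))
    (B : (Fin n → ℝ) ≃L[ℝ] (Fin n → ℝ)) :
    (Quot.mk _ ⟨mkFrame x u, hu⟩ : CorrSpace 𝒬) = Quot.mk _ ⟨mkFrame x
      ((ContinuousLinearEquiv.arrowCongr A B : Std n ≃L[ℝ] Std n).trans u),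
        moveFrame_mem 𝒬 hu A B⟩ ↔ ∃ c : ℝ, A e₁ = c • e₁ := by
  rw [CorrSpace.mk_eq_mk_iff]
  refine ⟨fun h => ?_, fun h => ⟨A, B, h, rfl⟩⟩
  have hv : mkFrame x ((ContinuousLinearEquiv.arrowCongr A B : Std n ≃L[ℝ] Std n).trans u) ∈
    adaptedFrames 𝒬 := moveFrame_mem 𝒬 hu A B
  obtain ⟨k, hk, h⟩ := (sameFlag_iff 𝒬 hu hv).1 h
  rw [conjR_arrowCongr, ← conjR_smul] at h
  exact flag_of_conj_j₀ hk (conjR_injective u h)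

end SameFlag

/-! ### Local trivializations of a vector bundle as total families of isomorphisms. -/

section FibreIso

variable {B₀ EB HB F₀ : Type*} [TopologicalSpace B₀] [NormedAddCommGroup EB] [NormedSpace ℝ EB]
  [TopologicalSpace HB] {IB : ModelWithCorners ℝ EB HB} [ChartedSpace HB B₀]
  [NormedAddCommGroup F₀] [NormedSpace ℝ F₀]
  (V : B₀ → Type*) [TopologicalSpace (TotalSpace F₀ V)] [∀ x, AddCommGroup (V x)]
  [∀ x, Module ℝ (V x)] [∀ x, TopologicalSpace (V x)]
  [FiberBundle F₀ V] [VectorBundle ℝ F₀ V]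

open Classical in
/-- Isomorphisms of the fibres with the model fibre, given on a neighbourhood of `x₀` by the
trivialization at `x₀`. -/
def fibreIso (x₀ x : B₀) : F₀ ≃L[ℝ] V x :=
  if h : x ∈ (trivializationAt F₀ V x₀).baseSet then
    ((trivializationAt F₀ V x₀).continuousLinearEquivAt ℝ x h).symm
  else ((trivializationAt F₀ V x).continuousLinearEquivAt ℝ x
    (FiberBundle.mem_baseSet_trivializationAt' x)).symm

lemma triv_fibreIso {x₀ x : B₀} (h : x ∈ (trivializationAt F₀ V x₀).baseSet) (y : F₀) :
    (trivializationAt F₀ V x₀ ⟨x, fibreIso V x₀ x y⟩).2 = y := by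
  rw [fibreIso, dif_pos h]
  exact ((trivializationAt F₀ V x₀).continuousLinearEquivAt ℝ x h).apply_symm_apply y

lemma fibreIso_symm_apply {x₀ x : B₀} (h : x ∈ (trivializationAt F₀ V x₀).baseSet) (v : V x) :
    (fibreIso (F₀ := F₀) V x₀ x).symm v = (trivializationAt F₀ V x₀ ⟨x, v⟩).2 := by
  rw [fibreIso, dif_pos h]
  rfl

lemma fibreIso_apply {x₀ x : B₀} (h : x ∈ (trivializationAt F₀ V x₀).baseSet) (y : F₀) :
    fibreIso V x₀ x y = (trivializationAt F₀ V x₀).symmL ℝ x y := by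
  rw [fibreIso, dif_pos h, ← Trivialization.symm_continuousLinearEquivAt_eq _ h]

lemma continuousLinearMapAt_fibreIso {x₀ x : B₀} (h : x ∈ (trivializationAt F₀ V x₀).baseSet)
    (y : F₀) :
    (trivializationAt F₀ V x₀).continuousLinearMapAt ℝ x (fibreIso V x₀ x y) = y := by
  rw [fibreIso_apply V h, Trivialization.continuousLinearMapAt_symmL _ h]

variable [ContMDiffVectorBundle ∞ F₀ V IB]
  {N EN HN : Type*} [NormedAddCommGroup EN] [NormedSpace ℝ EN]
    [TopologicalSpace HN] {K : ModelWithCorners ℝ EN HN} [TopologicalSpace N] [ChartedSpace HN N]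

lemma contMDiffAt_fibreIso {x₀ : B₀} {x : N → B₀} {y : N → F₀} {p : N}
    (hx : ContMDiffAt K IB ∞ x p) (hp : x p ∈ (trivializationAt F₀ V x₀).baseSet)
    (hy : ContMDiffAt K 𝓘(ℝ, F₀) ∞ y p) :
    ContMDiffAt K (IB.prod 𝓘(ℝ, F₀)) ∞
      (fun q => (⟨x q, fibreIso V x₀ (x q) (y q)⟩ : TotalSpace F₀ V)) p := by
  refine (Trivialization.contMDiffAt_iff (e := trivializationAt F₀ V x₀)
    ((Trivialization.mem_source _).2 hp)).2 ⟨hx, hy.congr_of_eventuallyEq ?_⟩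
  filter_upwards [hx.continuousAt.preimage_mem_nhds
    ((trivializationAt F₀ V x₀).open_baseSet.mem_nhds hp)] with q hq
  exact triv_fibreIso V hq _

variable (IB) in
lemma contMDiffOn_fibreIso_symm (x₀ : B₀) :
    ContMDiffOn (IB.prod 𝓘(ℝ, F₀)) 𝓘(ℝ, F₀) ∞
      (fun v : TotalSpace F₀ V => (fibreIso (F₀ := F₀) V x₀ v.1).symm v.2)
      (TotalSpace.proj ⁻¹' (trivializationAt F₀ V x₀).baseSet) := by
  intro v hv
  refine ContMDiffAt.contMDiffWithinAt ?_
  have h := ((Trivialization.contMDiffAt_iff (IB := IB) (n := ∞) (e := trivializationAt F₀ V x₀)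
    (f := fun w : TotalSpace F₀ V => w) ((Trivialization.mem_source _).2 hv)).1 contMDiffAt_id).2
  refine h.congr_of_eventuallyEq ?_
  filter_upwards [((trivializationAt F₀ V x₀).open_baseSet.preimage
    (FiberBundle.continuous_proj F₀ V)).mem_nhds hv] with w hw
  exact fibreIso_symm_apply V hw _

end FibreIso

/-! ### Adapted frames from frames of `E` and `F`. -/

section BundleFrame

variable {n : ℕ} {M : Type*} [TopologicalSpace M]
  [ChartedSpace (EuclideanSpace ℝ (Fin (2 * n))) M] [IsManifold (𝓡 (2 * n)) ∞ M]
  {E F : M → Type*}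
  [TopologicalSpace (TotalSpace (Fin 2 → ℝ) E)] [∀ x, AddCommGroup (E x)] [∀ x, Module ℝ (E x)]
  [∀ x, TopologicalSpace (E x)] [∀ x, IsTopologicalAddGroup (E x)]
  [∀ x, ContinuousSMul ℝ (E x)]
  [FiberBundle (Fin 2 → ℝ) E] [VectorBundle ℝ (Fin 2 → ℝ) E]
  [TopologicalSpace (TotalSpace (Fin n → ℝ) F)] [∀ x, AddCommGroup (F x)] [∀ x, Module ℝ (F x)]
  [∀ x, TopologicalSpace (F x)] [∀ x, IsTopologicalAddGroup (F x)]
  [∀ x, ContinuousSMul ℝ (F x)]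
  [FiberBundle (Fin n → ℝ) F] [VectorBundle ℝ (Fin n → ℝ) F]
  (ψ : ∀ x, (E x →L[ℝ] F x) ≃ₗ[ℝ] TangentSpace (𝓡 (2 * n)) x)

local instance (x : M) : FiniteDimensional ℝ (TangentSpace (𝓡 (2 * n)) x) :=
  inferInstanceAs (FiniteDimensional ℝ (EuclideanSpace ℝ (Fin (2 * n))))

local instance (x : M) : T2Space (TangentSpace (𝓡 (2 * n)) x) :=
  inferInstanceAs (T2Space (EuclideanSpace ℝ (Fin (2 * n))))

/-- The frame of `T_x M` given by frames of `E_x` and `F_x`. -/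
def bundleLin {x : M} (e : (Fin 2 → ℝ) ≃L[ℝ] E x) (f : (Fin n → ℝ) ≃L[ℝ] F x) :
    Std n ≃L[ℝ] TangentSpace (𝓡 (2 * n)) x :=
  ((ContinuousLinearEquiv.arrowCongr e f : Std n ≃L[ℝ] (E x →L[ℝ] F x)).toLinearEquiv.trans
    (ψ x)).toContinuousLinearEquiv

lemma bundleLin_apply {x : M} (e : (Fin 2 → ℝ) ≃L[ℝ] E x) (f : (Fin n → ℝ) ≃L[ℝ] F x)
    (X : Std n) : bundleLin ψ e f X =
      ψ x (f.toContinuousLinearMap ∘L X ∘L e.symm.toContinuousLinearMap) := rfl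

lemma bundleLin_trans {x : M} (e : (Fin 2 → ℝ) ≃L[ℝ] E x) (f : (Fin n → ℝ) ≃L[ℝ] F x)
    (A : (Fin 2 → ℝ) ≃L[ℝ] (Fin 2 → ℝ)) (B : (Fin n → ℝ) ≃L[ℝ] (Fin n → ℝ)) :
    bundleLin ψ (A.trans e) (B.trans f) =
      (ContinuousLinearEquiv.arrowCongr A B : Std n ≃L[ℝ] Std n).trans (bundleLin ψ e f) := rfl

variable {ψ} {𝒬 : AlmostParaQuaternionic n M}

/-- Conjugation by `e` matches the trace-free endomorphisms of `E_x` with the trace-free matrices,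
and `f` cancels. -/
lemma bundleLin_adapted (h : EquivalentTo ψ 𝒬) {x : M} (e : (Fin 2 → ℝ) ≃L[ℝ] E x)
    (f : (Fin n → ℝ) ≃L[ℝ] F x) : mkFrame x (bundleLin ψ e f) ∈ adaptedFrames 𝒬 := by
  rw [mkFrame_mem_iff]
  intro C
  simp only [eq_conjR_iff]
  refine (h x C).trans ⟨?_, ?_⟩
  · rintro ⟨a, ha, h⟩
    refine ⟨e.symm.toContinuousLinearMap ∘L a ∘L e.toContinuousLinearMap, ?_, fun X => ?_⟩
    · rw [← ha]
      exact LinearMap.trace_conj' a.toLinearMap e.symm.toLinearEquiv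
    · rw [bundleLin_apply, bundleLin_apply, h]
      congr 1
      ext v; simp
  · rintro ⟨a, ha, h⟩
    refine ⟨e.toContinuousLinearMap ∘L a ∘L e.symm.toContinuousLinearMap, ?_, fun X => ?_⟩
    · rw [← ha]
      exact LinearMap.trace_conj' a.toLinearMap e.toLinearEquiv
    · have h1 := h (f.symm.toContinuousLinearMap ∘L X ∘L e.toContinuousLinearMap)
      rw [bundleLin_apply, bundleLin_apply] at h1
      have e1 : f.toContinuousLinearMap ∘L (f.symm.toContinuousLinearMap ∘L X ∘L
          e.toContinuousLinearMap) ∘L e.symm.toContinuousLinearMap = X := by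
        ext v; simp
      have e2 : f.toContinuousLinearMap ∘L ((f.symm.toContinuousLinearMap ∘L X ∘L
          e.toContinuousLinearMap) ∘L a) ∘L e.symm.toContinuousLinearMap =
          X ∘L e.toContinuousLinearMap ∘L a ∘L e.symm.toContinuousLinearMap := by
        ext v; simp
      rwa [e1, e2] at h1

/-- Frames with the same first vector of `E` determine the same flag, and conversely. -/
lemma mk_bundleLin_eq_iff [NeZero n] (h : EquivalentTo ψ 𝒬) {x : M} (e e' : (Fin 2 → ℝ) ≃L[ℝ] E x)
    (f f' : (Fin n → ℝ) ≃L[ℝ] F x) :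
    (Quot.mk _ ⟨mkFrame x (bundleLin ψ e f), bundleLin_adapted h e f⟩ : CorrSpace 𝒬) =
      Quot.mk _ ⟨mkFrame x (bundleLin ψ e' f'), bundleLin_adapted h e' f'⟩ ↔
      ∃ c : ℝ, e' e₁ = c • e e₁ := by
  have he : e' = (e'.trans e.symm).trans e := by ext v; simp
  have hf : f' = (f'.trans f.symm).trans f := by ext v; simp
  have h1 := mk_arrowCongr_eq_iff 𝒬 (bundleLin_adapted h e f) (e'.trans e.symm) (f'.trans f.symm)
  have h2 : bundleLin ψ e' f' = (ContinuousLinearEquiv.arrowCongr (e'.trans e.symm)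
      (f'.trans f.symm) : Std n ≃L[ℝ] Std n).trans (bundleLin ψ e f) := by
    rw [← bundleLin_trans, ← he, ← hf]
  simp only [h2]
  refine h1.trans (exists_congr fun c => ?_)
  rw [ContinuousLinearEquiv.trans_apply, ContinuousLinearEquiv.symm_apply_eq, map_smul]

variable [ContMDiffVectorBundle ∞ (Fin 2 → ℝ) E (𝓡 (2 * n))]
  [ContMDiffVectorBundle ∞ (Fin n → ℝ) F (𝓡 (2 * n))]

/-- The local frame given by the trivializations of `E` and `F`. -/
def bundleFrame (hψ : SmoothIso ψ) (h : EquivalentTo ψ 𝒬) (x₀ : M) : LocalFrame 𝒬 where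
  dom := (trivializationAt (Fin 2 → ℝ) E x₀).baseSet ∩ (trivializationAt (Fin n → ℝ) F x₀).baseSet
  isOpen_dom := (trivializationAt (Fin 2 → ℝ) E x₀).open_baseSet.inter
    (trivializationAt (Fin n → ℝ) F x₀).open_baseSet
  lin x := bundleLin ψ (fibreIso E x₀ x) (fibreIso F x₀ x)
  adapted _ := bundleLin_adapted h _ _
  smooth := by
    intro p hp
    refine ContMDiffAt.contMDiffWithinAt ?_
    refine contMDiffAt_frameT_of_apply contMDiffAt_id fun X => ?_
    have h1 : ContMDiffAt (𝓡 (2 * n)) ((𝓡 (2 * n)).prod 𝓘(ℝ, Std n)) ∞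
        (fun x => (⟨x, (fibreIso F x₀ x).toContinuousLinearMap ∘L X ∘L
          (fibreIso E x₀ x).symm.toContinuousLinearMap⟩ :
          TotalSpace (Std n) (fun x => E x →L[ℝ] F x))) p := by
      refine (Trivialization.contMDiffAt_iff (e := trivializationAt (Std n)
        (fun x => E x →L[ℝ] F x) x₀) ((Trivialization.mem_source _).2 (by
          rw [hom_trivializationAt_baseSet]; exact hp))).2 ⟨contMDiffAt_id, ?_⟩
      -- In the trivialization of `Hom(E, F)` at `x₀` this section is the constant `X`.
      refine (contMDiffAt_const (c := X)).congr_of_eventuallyEq ?_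
      filter_upwards [((trivializationAt (Fin 2 → ℝ) E x₀).open_baseSet.inter
        (trivializationAt (Fin n → ℝ) F x₀).open_baseSet).mem_nhds hp] with q hq
      refine (congrArg Prod.snd (hom_trivializationAt_apply (RingHom.id ℝ) x₀ _)).trans ?_
      ext1 v
      change (trivializationAt (Fin n → ℝ) F x₀).continuousLinearMapAt ℝ q
        (fibreIso F x₀ q (X ((fibreIso E x₀ q).symm
          ((trivializationAt (Fin 2 → ℝ) E x₀).symmL ℝ q v)))) = X v
      rw [continuousLinearMapAt_fibreIso F hq.2, ← fibreIso_apply E hq.1,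
        ContinuousLinearEquiv.symm_apply_apply]
    exact ContMDiffAt.comp p hψ.contMDiffAt h1

end BundleFrame

/-! ### The diffeomorphism from `PE` to the correspondence space. -/

section ProjBundle

variable {n : ℕ} [NeZero n] {M : Type*} [TopologicalSpace M]
  [ChartedSpace (EuclideanSpace ℝ (Fin (2 * n))) M] [IsManifold (𝓡 (2 * n)) ∞ M]
  {E F : M → Type*}
  [TopologicalSpace (TotalSpace (Fin 2 → ℝ) E)] [∀ x, AddCommGroup (E x)] [∀ x, Module ℝ (E x)]
  [∀ x, TopologicalSpace (E x)] [∀ x, IsTopologicalAddGroup (E x)]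
  [∀ x, ContinuousSMul ℝ (E x)]
  [FiberBundle (Fin 2 → ℝ) E] [VectorBundle ℝ (Fin 2 → ℝ) E]
  [TopologicalSpace (TotalSpace (Fin n → ℝ) F)] [∀ x, AddCommGroup (F x)] [∀ x, Module ℝ (F x)]
  [∀ x, TopologicalSpace (F x)] [∀ x, IsTopologicalAddGroup (F x)]
  [∀ x, ContinuousSMul ℝ (F x)]
  [FiberBundle (Fin n → ℝ) F] [VectorBundle ℝ (Fin n → ℝ) F]
  {ψ : ∀ x, (E x →L[ℝ] F x) ≃ₗ[ℝ] TangentSpace (𝓡 (2 * n)) x} {𝒬 : AlmostParaQuaternionic n M}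

omit [IsManifold (𝓡 (2 * n)) ∞ M] [NeZero n] in
lemma exists_iso_apply_e₁ (v : NonzeroVec E) :
    ∃ (e : (Fin 2 → ℝ) ≃L[ℝ] E v.1.1), e e₁ = v.1.2 := by
  obtain ⟨A, hA⟩ := exists_equiv_apply_e₁ (w := (fibreIso E v.1.1 v.1.1).symm v.1.2)
    (by simpa using v.2)
  exact ⟨A.trans (fibreIso E v.1.1 v.1.1), by simp [hA]⟩

/-- The flag of adapted frames that a non-zero vector of `E` determines. -/
def flagOfVec (h : EquivalentTo ψ 𝒬) (v : NonzeroVec E) : CorrSpace 𝒬 :=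
  Quot.mk _ ⟨_, bundleLin_adapted h (exists_iso_apply_e₁ v).choose (fibreIso F v.1.1 v.1.1)⟩

/-- The isomorphisms chosen in `flagOfVec` are immaterial, since only the line of the first basis
vector of `E_x` counts. -/
lemma flagOfVec_eq (h : EquivalentTo ψ 𝒬) {x : M} (e : (Fin 2 → ℝ) ≃L[ℝ] E x)
    (f : (Fin n → ℝ) ≃L[ℝ] F x) (v : E x) (hv : v ≠ 0) (c : ℝ) (hc : c ≠ 0) (hev : v = c • e e₁) :
    flagOfVec h ⟨⟨x, v⟩, hv⟩ = Quot.mk _ ⟨mkFrame x (bundleLin ψ e f), bundleLin_adapted h e f⟩ := by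
  refine (mk_bundleLin_eq_iff h _ _ _ _).2 ⟨c⁻¹, ?_⟩
  rw [(exists_iso_apply_e₁ (⟨⟨x, v⟩, hv⟩ : NonzeroVec E)).choose_spec]
  simp only [hev]
  rw [inv_smul_smul₀ hc]

omit [NeZero n] in
lemma shear_e₁ (t : ℝ) : shear t e₁ = ![1, t] := by
  ext i; fin_cases i <;> simp [shear_apply, e₁]

variable [ContMDiffVectorBundle ∞ (Fin 2 → ℝ) E (𝓡 (2 * n))]
  [ContMDiffVectorBundle ∞ (Fin n → ℝ) F (𝓡 (2 * n))]
  [ChartedSpace (EuclideanSpace ℝ (Fin (2 * n)) × ℝ) (CorrSpace 𝒬)]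
  [IsManifold (modelC n) ∞ (CorrSpace 𝒬)]
  (hq : IsSmoothQuotient (modelFrame n) (modelC n)
    (Subtype.val : adaptedFrames 𝒬 → FrameT n M) (sameFlag 𝒬))

/-- The flag of a vector in terms of the local frame given by trivializations. -/
lemma flagOfVec_eq_cls (hψ : SmoothIso ψ) (h : EquivalentTo ψ 𝒬) (x₀ : M)
    (A : (Fin 2 → ℝ) ≃L[ℝ] (Fin 2 → ℝ)) (v : NonzeroVec E)
    (h0 : A.symm ((fibreIso (F₀ := Fin 2 → ℝ) E x₀ v.1.1).symm v.1.2) 0 ≠ 0) :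
    flagOfVec h v = ((bundleFrame hψ h x₀).move A (ContinuousLinearEquiv.refl ℝ _)).cls v.1.1
      (A.symm ((fibreIso (F₀ := Fin 2 → ℝ) E x₀ v.1.1).symm v.1.2) 1 /
        A.symm ((fibreIso (F₀ := Fin 2 → ℝ) E x₀ v.1.1).symm v.1.2) 0) := by
  obtain ⟨⟨x, v⟩, hv⟩ := v
  dsimp only at h0 ⊢
  set y := A.symm ((fibreIso (F₀ := Fin 2 → ℝ) E x₀ x).symm v) with hy
  -- The first basis vector is `(1, y 1 / y 0)` in the moved frame, that is, `v` divided by `y 0`.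
  refine flagOfVec_eq h ((shear (y 1 / y 0)).trans (A.trans (fibreIso E x₀ x)))
    ((ContinuousLinearEquiv.refl ℝ _).trans ((ContinuousLinearEquiv.refl ℝ _).trans
      (fibreIso F x₀ x))) v hv (y 0) h0 ?_
  rw [ContinuousLinearEquiv.trans_apply, ContinuousLinearEquiv.trans_apply, shear_e₁,
    ← map_smul, ← map_smul]
  have h1 : y 0 • ![1, y 1 / y 0] = y := by
    ext i; fin_cases i
    · simp
    · simp [mul_div_cancel₀ _ h0]
  rw [h1, hy]
  simp

include hq in
/-- The projectivization of `E` is diffeomorphic to the correspondence space. -/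
theorem exists_projBundle_diffeo (hψ : SmoothIso ψ) (h : EquivalentTo ψ 𝒬) :
    ∃ (_ : ChartedSpace (EuclideanSpace ℝ (Fin (2 * n)) × ℝ) (ProjBundle E))
      (_ : IsManifold (modelC n) ∞ (ProjBundle E)),
      IsSmoothQuotient ((𝓡 (2 * n)).prod 𝓘(ℝ, Fin 2 → ℝ)) (modelC n)
        (Subtype.val : NonzeroVec E → TotalSpace (Fin 2 → ℝ) E) (sameLineE E) ∧
      ∃ Ψ : Diffeomorph (modelC n) (modelC n) (ProjBundle E) (CorrSpace 𝒬) ∞,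
        ∀ v, Ψ (Quot.mk _ v) = flagOfVec h v := by
  refine exists_quotient_diffeo Topology.IsInducing.subtypeVal (sameLineE E) (flagOfVec h)
    ?_ ?_ ?_ ?_ ?_
  · rintro ⟨⟨x₀, v⟩, hv⟩
    -- Moving the frame by `A` makes `v` its first vector, so `v` has coordinates `(1, 0)` and the
    -- denominator of the slope does not vanish there.
    obtain ⟨A, hA⟩ := exists_equiv_apply_e₁ (w := (fibreIso E x₀ x₀).symm v) (by
      rw [Ne, map_eq_zero_iff _ (ContinuousLinearEquiv.injective _)]; exact hv)
    let s := (bundleFrame hψ h x₀).move A (ContinuousLinearEquiv.refl ℝ _)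
    let y : TotalSpace (Fin 2 → ℝ) E → (Fin 2 → ℝ) := fun w =>
      A.symm ((fibreIso (F₀ := Fin 2 → ℝ) E x₀ w.1).symm w.2)
    have hO : IsOpen (TotalSpace.proj ⁻¹' s.dom : Set (TotalSpace (Fin 2 → ℝ) E)) :=
      s.isOpen_dom.preimage (FiberBundle.continuous_proj _ _)
    have hy : ∀ i, ContMDiffOn ((𝓡 (2 * n)).prod 𝓘(ℝ, Fin 2 → ℝ)) 𝓘(ℝ, ℝ) ∞ (fun w => y w i)
        (TotalSpace.proj ⁻¹' s.dom) := by
      intro i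
      have h1 : ContDiff ℝ ∞ (fun z : Fin 2 → ℝ => A.symm z i) := by fun_prop
      exact h1.contMDiff.comp_contMDiffOn
        ((contMDiffOn_fibreIso_symm (𝓡 (2 * n)) E x₀).mono fun w hw => hw.1)
    refine ⟨TotalSpace.proj ⁻¹' s.dom ∩ {w | y w 0 ∈ ({0}ᶜ : Set ℝ)},
      (hy 0).continuousOn.isOpen_inter_preimage hO isOpen_compl_singleton, ⟨?_, ?_⟩,
      fun w => s.cls w.1 (y w 1 / y w 0), ?_, ?_⟩
    · exact ⟨FiberBundle.mem_baseSet_trivializationAt' _,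
        FiberBundle.mem_baseSet_trivializationAt' _⟩
    · change A.symm ((fibreIso (F₀ := Fin 2 → ℝ) E x₀ x₀).symm v) 0 ≠ 0
      rw [← hA, ContinuousLinearEquiv.symm_apply_apply]
      simp [e₁]
    · rintro w ⟨hw, hw0⟩
      refine ContMDiffAt.contMDiffWithinAt ?_
      refine s.contMDiffAt_cls hq (contMDiffAt_proj _) hw ?_
      exact ((hy 1).contMDiffAt (hO.mem_nhds hw)).div₀ ((hy 0).contMDiffAt (hO.mem_nhds hw)) hw0
    · rintro w ⟨hw, hw0⟩
      exact (flagOfVec_eq_cls hψ h x₀ A w hw0).symm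
  · intro c
    induction c using Quot.ind with
    | mk u =>
    induction u using adaptedFrames_rec with
    | h x u hu =>
    obtain ⟨A, B, rfl⟩ := exists_moveFrame 𝒬 (bundleLin_adapted h (fibreIso E x x)
      (fibreIso F x x)) hu
    have hne : (A.trans (fibreIso E x x)) e₁ ≠ 0 := by
      rw [Ne, map_eq_zero_iff _ (ContinuousLinearEquiv.injective _)]
      intro h
      simpa [e₁] using congrFun h 0
    exact ⟨⟨⟨x, (A.trans (fibreIso E x x)) e₁⟩, hne⟩,
      flagOfVec_eq h (A.trans (fibreIso E x x)) (B.trans (fibreIso F x x)) _ hne 1 one_ne_zero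
        (one_smul _ _).symm⟩
  · rintro v ⟨w, hw⟩ ⟨c, hc, rfl⟩
    obtain ⟨⟨x, v⟩, hv⟩ := v
    obtain ⟨e, he⟩ := exists_iso_apply_e₁ (⟨⟨x, v⟩, hv⟩ : NonzeroVec E)
    dsimp only at he
    rw [flagOfVec_eq h e (fibreIso F x x) v hv 1 one_ne_zero (by rw [he, one_smul]),
      flagOfVec_eq h e (fibreIso F x x) (c • v) hw c hc (by rw [he])]
  · rintro ⟨⟨x, v⟩, hv⟩ ⟨⟨x', w⟩, hw⟩ hvw
    obtain rfl : x' = x := (congrArg (CorrSpace.proj 𝒬) hvw).symm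
    obtain ⟨e, he⟩ := exists_iso_apply_e₁ (⟨⟨x', v⟩, hv⟩ : NonzeroVec E)
    obtain ⟨e', he'⟩ := exists_iso_apply_e₁ (⟨⟨x', w⟩, hw⟩ : NonzeroVec E)
    dsimp only at he he'
    rw [flagOfVec_eq h e (fibreIso F x' x') v hv 1 one_ne_zero (by rw [he, one_smul]),
      flagOfVec_eq h e' (fibreIso F x' x') w hw 1 one_ne_zero (by rw [he', one_smul]),
      mk_bundleLin_eq_iff h, he, he'] at hvw
    obtain ⟨c, rfl⟩ := hvw
    exact ⟨c, fun hc => hw (by simp [hc]), rfl⟩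
  · rintro ⟨⟨x₀, v⟩, hv⟩
    obtain ⟨A, hA⟩ := exists_equiv_apply_e₁ (w := (fibreIso E x₀ x₀).symm v) (by
      rw [Ne, map_eq_zero_iff _ (ContinuousLinearEquiv.injective _)]; exact hv)
    let s := (bundleFrame hψ h x₀).move A (ContinuousLinearEquiv.refl ℝ _)
    have hx₀ : x₀ ∈ s.dom := ⟨FiberBundle.mem_baseSet_trivializationAt' _,
        FiberBundle.mem_baseSet_trivializationAt' _⟩
    have hne : ∀ x t, fibreIso E x₀ x (A ![1, t]) ≠ 0 := by
      intro x t
      rw [Ne, map_eq_zero_iff _ (ContinuousLinearEquiv.injective _),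
        map_eq_zero_iff _ (ContinuousLinearEquiv.injective _)]
      intro h
      simpa using congrFun h 0
    have hcls : ∀ x t, flagOfVec h ⟨⟨x, fibreIso E x₀ x (A ![1, t])⟩, hne x t⟩ = s.cls x t := by
      intro x t
      rw [flagOfVec_eq_cls hψ h x₀ A _ (by simp)]
      simp [s]
    have hv0 : flagOfVec h ⟨⟨x₀, v⟩, hv⟩ = s.cls x₀ 0 := by
      rw [← hcls]
      congr 3
      rw [show ![1, (0 : ℝ)] = e₁ from rfl, hA, ContinuousLinearEquiv.apply_symm_apply]
    -- The section picks the vector with first coordinate `1`. The class of `v` has parameter `0`,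
    -- and there the section returns `v`.
    refine ⟨s.clsDom, s.isOpen_clsDom, ?_, fun c => ⟨⟨CorrSpace.proj 𝒬 c,
      fibreIso E x₀ (CorrSpace.proj 𝒬 c) (A ![1, s.param c])⟩, hne _ _⟩, ?_, ?_, ?_⟩
    · rw [hv0]
      exact s.cls_mem_clsDom hx₀ 0
    · intro c hc
      refine ContMDiffAt.contMDiffWithinAt ?_
      have h1 : ContDiff ℝ ∞ (fun t : ℝ => A ![1, t]) := by
        refine A.contDiff.comp ?_
        rw [contDiff_pi]
        intro i; fin_cases i
        · exact contDiff_const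
        · exact contDiff_id
      exact contMDiffAt_fibreIso E (CorrSpace.contMDiff_proj hq).contMDiffAt
        (s.proj_mem_dom hc).1 (ContMDiffAt.comp (f := s.param) c h1.contMDiff.contMDiffAt
          ((s.contMDiffOn_param hq).contMDiffAt (s.isOpen_clsDom.mem_nhds hc)))
    · rw [hv0]
      refine Subtype.ext ?_
      change (⟨x₀, fibreIso E x₀ x₀ (A ![1, s.param (s.cls x₀ 0)])⟩ :
        TotalSpace (Fin 2 → ℝ) E) = ⟨x₀, v⟩
      rw [s.param_cls, show ![1, (0 : ℝ)] = e₁ from rfl, hA,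
        ContinuousLinearEquiv.apply_symm_apply]
    · intro c hc
      rw [hcls, s.cls_param hc]

end ProjBundle

/-! ### Parabolic geometries -/

section Blocks

variable {n : ℕ}

/-- The block diagonal matrix of a pair of automorphisms. -/
def blockDiag (A : (Fin 2 → ℝ) ≃L[ℝ] (Fin 2 → ℝ)) (B : (Fin n → ℝ) ≃L[ℝ] (Fin n → ℝ)) : Mat n :=
  Matrix.fromBlocks (LinearMap.toMatrix' A.toLinearEquiv.toLinearMap) 0 0
    (LinearMap.toMatrix' B.toLinearEquiv.toLinearMap)

/-- The diagonal blocks of `p` are the matrices of `A` and `B`. -/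
def HasBlocks (p : Mat n) (A : (Fin 2 → ℝ) ≃L[ℝ] (Fin 2 → ℝ))
    (B : (Fin n → ℝ) ≃L[ℝ] (Fin n → ℝ)) : Prop :=
  (∀ i j, A (Pi.single j 1) i = p (Sum.inl i) (Sum.inl j)) ∧
    ∀ i j, B (Pi.single j 1) i = p (Sum.inr i) (Sum.inr j)

lemma hasBlocks_blockDiag (A : (Fin 2 → ℝ) ≃L[ℝ] (Fin 2 → ℝ))
    (B : (Fin n → ℝ) ≃L[ℝ] (Fin n → ℝ)) : HasBlocks (blockDiag A B) A B :=
  ⟨fun i j => by simp [blockDiag, LinearMap.toMatrix'_apply],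
    fun i j => by simp [blockDiag, LinearMap.toMatrix'_apply]⟩

lemma memP_blockDiag (A : (Fin 2 → ℝ) ≃L[ℝ] (Fin 2 → ℝ))
    (B : (Fin n → ℝ) ≃L[ℝ] (Fin n → ℝ)) : MemP (blockDiag A B) := by
  refine ⟨?_, fun a b => by simp [blockDiag]⟩
  rw [blockDiag, Matrix.det_fromBlocks_zero₂₁, LinearMap.det_toMatrix', LinearMap.det_toMatrix']
  exact mul_ne_zero A.toLinearEquiv.isUnit_det'.ne_zero B.toLinearEquiv.isUnit_det'.ne_zero

lemma blockDiag_refl : blockDiag (n := n) (ContinuousLinearEquiv.refl ℝ _)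
    (ContinuousLinearEquiv.refl ℝ _) = 1 := by
  rw [← Matrix.fromBlocks_one, blockDiag]
  congr 1 <;> exact LinearMap.toMatrix'_id

lemma exists_equiv_of_det_ne_zero {m : ℕ} (P : Matrix (Fin m) (Fin m) ℝ) (h : P.det ≠ 0) :
    ∃ A : (Fin m → ℝ) ≃L[ℝ] (Fin m → ℝ), ∀ i j, A (Pi.single j 1) i = P i j := by
  refine ⟨(Matrix.toLinearEquiv' P
    (Matrix.invertibleOfIsUnitDet P (isUnit_iff_ne_zero.2 h))).toContinuousLinearEquiv,
    fun i j => ?_⟩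
  change Matrix.toLin' P (Pi.single j 1) i = P i j
  simp

/-- The determinant of a block triangular matrix is the product of those of its diagonal blocks, so
both are invertible. -/
lemma MemP.exists_hasBlocks {p : Mat n} (hp : MemP p) :
    ∃ (A : (Fin 2 → ℝ) ≃L[ℝ] (Fin 2 → ℝ)) (B : (Fin n → ℝ) ≃L[ℝ] (Fin n → ℝ)),
      HasBlocks p A B := by
  have h1 : p = Matrix.fromBlocks p.toBlocks₁₁ p.toBlocks₁₂ 0 p.toBlocks₂₂ := by
    conv_lhs => rw [← Matrix.fromBlocks_toBlocks p]
    congr 1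
    ext a b
    exact hp.2 a b
  have h2 := hp.1
  rw [h1, Matrix.det_fromBlocks_zero₂₁] at h2
  obtain ⟨A, hA⟩ := exists_equiv_of_det_ne_zero _ (left_ne_zero_of_mul h2)
  obtain ⟨B, hB⟩ := exists_equiv_of_det_ne_zero _ (right_ne_zero_of_mul h2)
  exact ⟨A, B, hA, hB⟩

lemma clm_apply_eq_sum {m : ℕ} {W : Type*} [AddCommGroup W] [Module ℝ W] [TopologicalSpace W]
    (L : (Fin m → ℝ) →L[ℝ] W) (v : Fin m → ℝ) : L v = ∑ i, v i • L (Pi.single i 1) := by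
  conv_lhs => rw [← Finset.univ_sum_single v]
  rw [map_sum]
  refine Finset.sum_congr rfl fun i _ => ?_
  rw [← map_smul, ← Pi.single_smul, smul_eq_mul, mul_one]

lemma negIncl_apply (X : Std n) (a : Fin n) (b : Fin 2) :
    (negIncl n X : Mat n) (Sum.inr a) (Sum.inl b) = X (Pi.single b 1) a := by
  have h1 : (negIncl n X : Mat n) = ∑ a : Fin n, ∑ b : Fin 2,
      X (Pi.single b 1) a • (negElem a b : Mat n) := by
    simp [negIncl]
  rw [h1]
  have h2 : ∀ (a' : Fin n) (b' : Fin 2), (negElem a' b' : Mat n) (Sum.inr a) (Sum.inl b) =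
      if a' = a ∧ b' = b then 1 else 0 := by
    intro a' b'
    simp [negElem, Matrix.single_apply]
  simp only [Matrix.sum_apply, Matrix.smul_apply, h2, smul_eq_mul]
  rw [Finset.sum_eq_single a, Finset.sum_eq_single b]
  · simp
  · intro b' _ hb; simp [hb]
  · simp
  · intro a' _ ha; simp [ha]
  · simp

lemma HasBlocks.sum_inl {p : Mat n} {A : (Fin 2 → ℝ) ≃L[ℝ] (Fin 2 → ℝ)}
    {B : (Fin n → ℝ) ≃L[ℝ] (Fin n → ℝ)} (h : HasBlocks p A B) (X : Std n) (a : Fin n)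
    (b : Fin 2) :
    ∑ b', X (Pi.single b' 1) a * p (Sum.inl b') (Sum.inl b) = X (A (Pi.single b 1)) a := by
  rw [clm_apply_eq_sum X (A (Pi.single b 1)), Finset.sum_apply]
  refine Finset.sum_congr rfl fun b' _ => ?_
  rw [Pi.smul_apply, smul_eq_mul, h.1, mul_comm]

lemma HasBlocks.sum_inr {p : Mat n} {A : (Fin 2 → ℝ) ≃L[ℝ] (Fin 2 → ℝ)}
    {B : (Fin n → ℝ) ≃L[ℝ] (Fin n → ℝ)} (h : HasBlocks p A B) (z : Fin n → ℝ) (a : Fin n) :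
    ∑ a', p (Sum.inr a) (Sum.inr a') * z a' = B z a := by
  rw [show B z a = (B.toContinuousLinearMap) z a from rfl, clm_apply_eq_sum, Finset.sum_apply]
  refine Finset.sum_congr rfl fun a' _ => ?_
  rw [Pi.smul_apply, smul_eq_mul, ← h.2, mul_comm]
  rfl

/-- The action of `p ∈ P` on `𝔤/𝔭`. -/
lemma blockUpper_conj_sub {p : Mat n} (hp : MemP p) {A : (Fin 2 → ℝ) ≃L[ℝ] (Fin 2 → ℝ)}
    {B : (Fin n → ℝ) ≃L[ℝ] (Fin n → ℝ)} (h : HasBlocks p A B) (Y : Std n) (Z : Mat n)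
    (hZ : Z = p⁻¹ * (negIncl n (ContinuousLinearEquiv.arrowCongr A B Y) : Mat n) * p) :
    BlockUpper (Z - (negIncl n Y : Mat n)) := by
  set N := (negIncl n (ContinuousLinearEquiv.arrowCongr A B Y) : Mat n) with hN
  have h1 : p * Z = N * p := by
    rw [hZ, ← mul_assoc, ← mul_assoc, Matrix.mul_nonsing_inv p (isUnit_iff_ne_zero.2 hp.1),
      one_mul]
  intro a b
  -- The lower left block of `p Z = N p` reads `B Z₂₁ = (B Y A⁻¹) A = B Y`, as that block of `p`
  -- vanishes; `B` is injective.
  have h2 : ∀ a, B (fun a' => Z (Sum.inr a') (Sum.inl b)) a = B (Y (Pi.single b 1)) a := by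
    intro a
    have h3 := congrFun (congrFun h1 (Sum.inr a)) (Sum.inl b)
    rw [Matrix.mul_apply, Matrix.mul_apply, Fintype.sum_sum_type, Fintype.sum_sum_type] at h3
    simp only [hp.2 _ _, zero_mul, mul_zero, Finset.sum_const_zero, zero_add, add_zero] at h3
    rw [h.sum_inr (fun a' => Z (Sum.inr a') (Sum.inl b))] at h3
    rw [h3]
    simp only [hN, negIncl_apply]
    rw [h.sum_inl]
    simp
  have h4 := congrFun (B.injective (funext h2)) a
  rw [Matrix.sub_apply, negIncl_apply, ← h4, sub_self]

lemma BlockUpper.exp {X : Mat n} (h : BlockUpper X) : BlockUpper (NormedSpace.exp X) := by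
  have h1 : Matrix.BlockTriangular X (Sum.elim (fun _ => (0 : ℕ)) (fun _ => 1)) := by
    rintro (i | i) (j | j) hij
    · simp at hij
    · simp at hij
    · exact h i j
    · simp at hij
  intro a b
  exact h1.exp (i := Sum.inr a) (j := Sum.inl b) (by simp)

lemma BlockUpper.memP_exp {X : Mat n} (h : BlockUpper X) (t : ℝ) :
    MemP (NormedSpace.exp (t • X)) := by
  have h1 : IsUnit (NormedSpace.exp (t • X)) := Matrix.isUnit_exp (t • X)
  have h2 : BlockUpper (t • X) := fun a b => by rw [Matrix.smul_apply, h a b, smul_zero]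
  exact ⟨((Matrix.isUnit_iff_isUnit_det _).1 h1).ne_zero, h2.exp⟩

end Blocks

/-! ### Equivariance and smoothness of the frames of a Cartan geometry. -/

section Cartan

variable {n : ℕ} {M : Type*} [TopologicalSpace M]
  [ChartedSpace (EuclideanSpace ℝ (Fin (2 * n))) M] [IsManifold (𝓡 (2 * n)) ∞ M]
  {𝒢 : Type*} [TopologicalSpace 𝒢]
  [ChartedSpace (EuclideanSpace ℝ (Fin (n ^ 2 + 4 * n + 3))) 𝒢]
  [IsManifold (𝓡 (n ^ 2 + 4 * n + 3)) ∞ 𝒢]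

namespace CartanGeometry

variable (Γ : CartanGeometry n M 𝒢)

lemma proj_act (u : 𝒢) {p : Mat n} (hp : MemP p) : Γ.proj (Γ.act u p) = Γ.proj u :=
  ((Γ.proj_eq_iff u _).2 ⟨p, hp, rfl⟩).symm

lemma contMDiff_act {p : Mat n} (hp : MemP p) :
    ContMDiff (𝓡 (n ^ 2 + 4 * n + 3)) (𝓡 (n ^ 2 + 4 * n + 3)) ∞ (fun v => Γ.act v p) := by
  intro v
  exact Γ.smooth_act.contMDiffAt_comp (τ := fun v => ⟨(v, Matrix.of.symm p), hp⟩)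
    (contMDiffAt_id.prodMk contMDiffAt_const)

lemma mdifferentiableAt_proj (u : 𝒢) :
    MDifferentiableAt (𝓡 (n ^ 2 + 4 * n + 3)) (𝓡 (2 * n)) Γ.proj u :=
  (Γ.smooth_proj u).mdifferentiableAt (by simp)

/-- The derivative of the projection, as a map on the model space. -/
def dproj (u : 𝒢) (Z : slAlg n) : EuclideanSpace ℝ (Fin (2 * n)) :=
  mfderiv (𝓡 (n ^ 2 + 4 * n + 3)) (𝓡 (2 * n)) Γ.proj u ((Γ.conn u).symm Z)

lemma dproj_sub (u : 𝒢) (Z Z' : slAlg n) : Γ.dproj u (Z - Z') = Γ.dproj u Z - Γ.dproj u Z' := by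
  rw [dproj, map_sub]
  exact map_sub (mfderiv (𝓡 (n ^ 2 + 4 * n + 3)) (𝓡 (2 * n)) Γ.proj u) _ _

/-- The Cartan connection identifies the vertical tangent space with `𝔭`. -/
lemma dproj_of_blockUpper (u : 𝒢) {Z : slAlg n} (hZ : BlockUpper (Z : Mat n)) :
    Γ.dproj u Z = 0 := by
  set γ : ℝ → 𝒢 := fun t => Γ.act u (NormedSpace.exp (t • (Z : Mat n))) with hγ
  have h0 : γ 0 = u := by
    simp only [hγ]
    rw [zero_smul, NormedSpace.exp_zero, Γ.act_one]
  -- The generator property of `conn` lives at `γ 0`, which equals `u` but not by definition.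
  suffices h : Γ.dproj (γ 0) Z = 0 by rwa [h0] at h
  have h1 : (Γ.conn (γ 0)).symm Z =
      mfderiv 𝓘(ℝ, ℝ) (𝓡 (n ^ 2 + 4 * n + 3)) γ 0 (1 : ℝ) := by
    rw [LinearEquiv.symm_apply_eq]
    exact (Γ.reproduces Z hZ u).symm
  rw [dproj, h1]
  -- A differentiable orbit curve stays in a fibre, so its velocity projects to `0`; otherwise
  -- `mfderiv` is `0` by default.
  by_cases hd : MDifferentiableAt 𝓘(ℝ, ℝ) (𝓡 (n ^ 2 + 4 * n + 3)) γ 0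
  · have h2 := mfderiv_comp 0 (Γ.mdifferentiableAt_proj (γ 0)) hd
    have h3 : Γ.proj ∘ γ = fun _ => Γ.proj u := funext fun t => Γ.proj_act u (hZ.memP_exp t)
    rw [h3, mfderiv_const] at h2
    exact (DFunLike.congr_fun h2 (1 : ℝ)).symm
  · rw [mfderiv_zero_of_not_mdifferentiableAt hd]
    exact map_zero (mfderiv (𝓡 (n ^ 2 + 4 * n + 3)) (𝓡 (2 * n)) Γ.proj (γ 0))

/-- Translation by `p` covers the identity of `M` and changes `conn` by conjugation with `p⁻¹`. The
conjugate of `B Y A⁻¹` differs from `Y` by an element of `𝔭`, which projects to `0`. -/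
lemma dproj_act (u : 𝒢) {p : Mat n} (hp : MemP p) {A : (Fin 2 → ℝ) ≃L[ℝ] (Fin 2 → ℝ)}
    {B : (Fin n → ℝ) ≃L[ℝ] (Fin n → ℝ)} (h : HasBlocks p A B) (Y : Std n) :
    Γ.dproj (Γ.act u p) (negIncl n Y) =
      Γ.dproj u (negIncl n (ContinuousLinearEquiv.arrowCongr A B Y)) := by
  set ξ := (Γ.conn u).symm (negIncl n (ContinuousLinearEquiv.arrowCongr A B Y)) with hξ
  set η := mfderiv (𝓡 (n ^ 2 + 4 * n + 3)) (𝓡 (n ^ 2 + 4 * n + 3)) (fun v => Γ.act v p) u ξ with hη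
  have h1 : mfderiv (𝓡 (n ^ 2 + 4 * n + 3)) (𝓡 (2 * n)) Γ.proj (Γ.act u p) η =
      mfderiv (𝓡 (n ^ 2 + 4 * n + 3)) (𝓡 (2 * n)) Γ.proj u ξ := by
    have h2 := mfderiv_comp u (Γ.mdifferentiableAt_proj (Γ.act u p))
      ((Γ.contMDiff_act hp u).mdifferentiableAt (by simp))
    have h3 : Γ.proj ∘ (fun v => Γ.act v p) = Γ.proj := funext fun v => Γ.proj_act v hp
    rw [h3] at h2
    exact (DFunLike.congr_fun h2 ξ).symm
  have h4 : ((Γ.conn (Γ.act u p) η : slAlg n) : Mat n) =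
      p⁻¹ * (negIncl n (ContinuousLinearEquiv.arrowCongr A B Y) : Mat n) * p := by
    rw [hη, Γ.equivariant p hp u ξ, hξ, LinearEquiv.apply_symm_apply]
  have h5 : Γ.dproj (Γ.act u p) (Γ.conn (Γ.act u p) η - negIncl n Y) = 0 :=
    Γ.dproj_of_blockUpper _ (blockUpper_conj_sub hp h Y _ h4)
  rw [dproj_sub, sub_eq_zero] at h5
  rw [← h5, dproj, LinearEquiv.symm_apply_apply]
  exact h1

/-- `P` acts on frames through its diagonal blocks, because the frame only sees `𝔤/𝔭`. -/
lemma frame_act (u : 𝒢) {p : Mat n} (hp : MemP p) {A : (Fin 2 → ℝ) ≃L[ℝ] (Fin 2 → ℝ)}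
    {B : (Fin n → ℝ) ≃L[ℝ] (Fin n → ℝ)} (h : HasBlocks p A B) :
    Γ.frame (Γ.act u p) = moveFrame (Γ.frame u) A B := by
  have key : ∀ (x y : M) (L L' : Std n →L[ℝ] EuclideanSpace ℝ (Fin (2 * n))), x = y →
      (∀ Y, L Y = L' Y) → (⟨x, L⟩ : FrameT n M) = ⟨y, L'⟩ := by
    rintro x _ L L' rfl hL
    rw [ContinuousLinearMap.ext hL]
  exact key _ _ _ _ (Γ.proj_act u hp) (Γ.dproj_act u hp h)

/-- The Cartan connection in a local trivialization of the tangent bundle at `u₀`, composed with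
its inverse at `u₀`. -/
def connIso (u₀ u : 𝒢) : EuclideanSpace ℝ (Fin (n ^ 2 + 4 * n + 3)) ≃L[ℝ]
    EuclideanSpace ℝ (Fin (n ^ 2 + 4 * n + 3)) :=
  let f : EuclideanSpace ℝ (Fin (n ^ 2 + 4 * n + 3)) ≃ₗ[ℝ]
      EuclideanSpace ℝ (Fin (n ^ 2 + 4 * n + 3)) :=
    (fibreIso (F₀ := EuclideanSpace ℝ (Fin (n ^ 2 + 4 * n + 3)))
      (TangentSpace (𝓡 (n ^ 2 + 4 * n + 3)) : 𝒢 → Type) u₀ u).toLinearEquiv.trans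
        ((Γ.conn u).trans (Γ.conn u₀).symm)
  f.toContinuousLinearEquiv

/-- Smoothness of `conn` is given for matrix entries. A left inverse `r` of the inclusion of `𝔰𝔩` in
the matrices writes the value as a combination of fixed vectors with those entries as coefficients.
-/
lemma contMDiffAt_connIso_apply (u₀ : 𝒢) (y : EuclideanSpace ℝ (Fin (n ^ 2 + 4 * n + 3))) :
    ContMDiffAt (𝓡 (n ^ 2 + 4 * n + 3)) 𝓘(ℝ, EuclideanSpace ℝ (Fin (n ^ 2 + 4 * n + 3))) ∞
      (fun u => Γ.connIso u₀ u y) u₀ := by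
  let κ : slAlg n ≃ₗ[ℝ] EuclideanSpace ℝ (Fin (n ^ 2 + 4 * n + 3)) := (Γ.conn u₀).symm
  let ι : slAlg n →ₗ[ℝ] Mat n :=
    { toFun := fun Z => Z, map_add' := fun _ _ => rfl, map_smul' := fun _ _ => rfl }
  obtain ⟨r, hr⟩ := LinearMap.exists_leftInverse_of_injective ι
    (LinearMap.ker_eq_bot.2 Subtype.val_injective)
  have hκ : ∀ Z : slAlg n, κ Z = ∑ i, ∑ j, (Z : Mat n) i j • κ (r (Matrix.single i j 1)) := by
    intro Z
    have h1 : r (Z : Mat n) = Z := LinearMap.congr_fun hr Z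
    conv_lhs => rw [← h1, Matrix.matrix_eq_sum_single (Z : Mat n)]
    simp only [map_sum]
    refine Finset.sum_congr rfl fun i _ => Finset.sum_congr rfl fun j _ => ?_
    rw [← map_smul, ← map_smul, Matrix.smul_single, smul_eq_mul, mul_one]
  have hb : ContMDiffAt (𝓡 (n ^ 2 + 4 * n + 3)) (𝓡 (n ^ 2 + 4 * n + 3)).tangent ∞
      (fun u => (⟨u, fibreIso (TangentSpace (𝓡 (n ^ 2 + 4 * n + 3)) : 𝒢 → Type) u₀ u y⟩ :
        TangentBundle (𝓡 (n ^ 2 + 4 * n + 3)) 𝒢)) u₀ :=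
    contMDiffAt_fibreIso _ contMDiffAt_id (FiberBundle.mem_baseSet_trivializationAt' u₀)
      contMDiffAt_const
  have h1 : (fun u => Γ.connIso u₀ u y) = fun u => ∑ i, ∑ j, (Γ.conn u
      (fibreIso (TangentSpace (𝓡 (n ^ 2 + 4 * n + 3)) : 𝒢 → Type) u₀ u y) : Mat n) i j •
        κ (r (Matrix.single i j 1)) := funext fun u => hκ _
  rw [h1]
  refine contMDiffAt_finsetSum fun i _ => contMDiffAt_finsetSum fun j _ => ?_
  have h2 := ContMDiffAt.comp u₀ (Γ.smooth_conn i j).contMDiffAt hb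
  exact h2.smul contMDiffAt_const

/-- Inversion of linear isomorphisms is smooth. -/
lemma contMDiffAt_connIso_symm (u₀ : 𝒢) (Y : EuclideanSpace ℝ (Fin (n ^ 2 + 4 * n + 3))) :
    ContMDiffAt (𝓡 (n ^ 2 + 4 * n + 3)) 𝓘(ℝ, EuclideanSpace ℝ (Fin (n ^ 2 + 4 * n + 3))) ∞
      (fun u => (Γ.connIso u₀ u).symm Y) u₀ := by
  have hg : ContMDiffAt (𝓡 (n ^ 2 + 4 * n + 3))
      𝓘(ℝ, EuclideanSpace ℝ (Fin (n ^ 2 + 4 * n + 3)) →L[ℝ]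
        EuclideanSpace ℝ (Fin (n ^ 2 + 4 * n + 3))) ∞
      (fun u => (Γ.connIso u₀ u).toContinuousLinearMap) u₀ :=
    contMDiffAt_clm_of_apply fun y => Γ.contMDiffAt_connIso_apply u₀ y
  have h1 := ContMDiffAt.comp u₀ (contDiffAt_map_inverse (n := ∞) (Γ.connIso u₀ u₀)).contMDiffAt hg
  have h2 := h1.clm_apply (contMDiffAt_const (c := Y))
  refine h2.congr_of_eventuallyEq (Filter.Eventually.of_forall fun u => ?_)
  simp only [Function.comp_apply, ContinuousLinearMap.inverse_equiv]
  rfl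

/-- The constant vector fields of a Cartan connection are smooth. -/
lemma contMDiff_conn_symm (Y : slAlg n) :
    ContMDiff (𝓡 (n ^ 2 + 4 * n + 3)) (𝓡 (n ^ 2 + 4 * n + 3)).tangent ∞
      (fun u => (⟨u, (Γ.conn u).symm Y⟩ : TangentBundle (𝓡 (n ^ 2 + 4 * n + 3)) 𝒢)) := by
  intro u₀
  have h2 := contMDiffAt_fibreIso (F₀ := EuclideanSpace ℝ (Fin (n ^ 2 + 4 * n + 3)))
    (TangentSpace (𝓡 (n ^ 2 + 4 * n + 3)) : 𝒢 → Type) (x₀ := u₀) (K := 𝓡 (n ^ 2 + 4 * n + 3))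
    (IB := 𝓡 (n ^ 2 + 4 * n + 3)) contMDiffAt_id (FiberBundle.mem_baseSet_trivializationAt' u₀)
    (Γ.contMDiffAt_connIso_symm u₀ ((Γ.conn u₀).symm Y))
  refine h2.congr_of_eventuallyEq (Filter.Eventually.of_forall fun u => ?_)
  have h3 : fibreIso (F₀ := EuclideanSpace ℝ (Fin (n ^ 2 + 4 * n + 3)))
      (TangentSpace (𝓡 (n ^ 2 + 4 * n + 3)) : 𝒢 → Type) u₀ u
        ((Γ.connIso u₀ u).symm ((Γ.conn u₀).symm Y)) = (Γ.conn u).symm Y := by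
    rw [LinearEquiv.eq_symm_apply]
    exact (Γ.conn u₀).symm.injective
      ((Γ.connIso u₀ u).apply_symm_apply ((Γ.conn u₀).symm Y))
  exact congrArg (TotalSpace.mk u) h3.symm

lemma contMDiff_frame : ContMDiff (𝓡 (n ^ 2 + 4 * n + 3)) (modelFrame n) ∞ Γ.frame := by
  intro u
  refine contMDiffAt_frameT_of_apply (Γ.smooth_proj u) fun X => ?_
  exact ContMDiffAt.comp u (Γ.smooth_proj.contMDiff_tangentMap (m := ∞) (by simp)).contMDiffAt
    (Γ.contMDiff_conn_symm (negIncl n X) u)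

end CartanGeometry

end Cartan

/-! ### The quotient of the Cartan bundle by `Q`. -/

section Cartan

variable {n : ℕ} [NeZero n] {M : Type*} [TopologicalSpace M]
  [ChartedSpace (EuclideanSpace ℝ (Fin (2 * n))) M] [IsManifold (𝓡 (2 * n)) ∞ M]
  {𝒬 : AlmostParaQuaternionic n M}
  {𝒢 : Type*} [TopologicalSpace 𝒢]
  [ChartedSpace (EuclideanSpace ℝ (Fin (n ^ 2 + 4 * n + 3))) 𝒢]
  [IsManifold (𝓡 (n ^ 2 + 4 * n + 3)) ∞ 𝒢]

namespace CartanGeometry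

variable (Γ : CartanGeometry n M 𝒢)

lemma proj_surjective : Function.Surjective Γ.proj := by
  intro x
  obtain ⟨U, -, hx, σ, -, h⟩ := Γ.local_section x
  exact ⟨σ x, h x hx⟩

/-- Through every point there is a local section, extended to a set-theoretic global one. -/
lemma exists_section (u : 𝒢) : ∃ (U : Set M) (σ : M → 𝒢), IsOpen U ∧ Γ.proj u ∈ U ∧
    ContMDiffOn (𝓡 (2 * n)) (𝓡 (n ^ 2 + 4 * n + 3)) ∞ σ U ∧ (∀ x, Γ.proj (σ x) = x) ∧
    σ (Γ.proj u) = u := by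
  classical
  obtain ⟨U, hU, hx, σ, hσ, h⟩ := Γ.local_section (Γ.proj u)
  -- A section over `U` is translated by a constant `p` so as to pass through `u`.
  obtain ⟨p, hp, hu⟩ := (Γ.proj_eq_iff (σ (Γ.proj u)) u).1 (h _ hx)
  choose τ hτ using Γ.proj_surjective
  refine ⟨U, fun x => if x ∈ U then Γ.act (σ x) p else τ x, hU, hx, ?_, fun x => ?_, ?_⟩
  · exact ((Γ.contMDiff_act hp).comp_contMDiffOn hσ).congr fun x hx => if_pos hx
  · by_cases hxU : x ∈ U
    · simp only [if_pos hxU]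
      rw [Γ.proj_act _ hp, h x hxU]
    · simp only [if_neg hxU]
      exact hτ x
  · simp only [if_pos hx]
    exact hu.symm

variable {Γ}

lemma exists_frame_eq_mkFrame (hΓ : Γ.Induces 𝒬) {u : 𝒢} {x : M} (h : Γ.proj u = x) :
    ∃ v : Std n ≃L[ℝ] TangentSpace (𝓡 (2 * n)) x, Γ.frame u = mkFrame x v := by
  subst h
  exact exists_eq_mkFrame 𝒬 (hΓ u)

/-- The local adapted frame given by a local section. -/
lemma exists_localFrame_of_section (hΓ : Γ.Induces 𝒬) {U : Set M} {σ : M → 𝒢} (hU : IsOpen U)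
    (hσ : ContMDiffOn (𝓡 (2 * n)) (𝓡 (n ^ 2 + 4 * n + 3)) ∞ σ U) (h : ∀ x, Γ.proj (σ x) = x) :
    ∃ s : LocalFrame 𝒬, s.dom = U ∧ ∀ x, Γ.frame (σ x) = mkFrame x (s.lin x) := by
  choose v hv using fun x => exists_frame_eq_mkFrame hΓ (h x)
  refine ⟨⟨U, hU, v, fun x => hv x ▸ hΓ (σ x), ?_⟩, rfl, hv⟩
  exact (Γ.contMDiff_frame.comp_contMDiffOn hσ).congr fun x _ => (hv x).symm

/-- The flag determined by a point of the Cartan bundle. -/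
def flag (hΓ : Γ.Induces 𝒬) (u : 𝒢) : CorrSpace 𝒬 := Quot.mk _ ⟨Γ.frame u, hΓ u⟩

/-- Shears are realized by block diagonal elements of `P`, so the slices defining the charts of `𝒞M`
lift to `𝒢`. -/
lemma flag_act_shear (hΓ : Γ.Induces 𝒬) {u : 𝒢} {s : LocalFrame 𝒬} {x : M}
    (h : Γ.frame u = mkFrame x (s.lin x)) (t : ℝ) :
    flag hΓ (Γ.act u (blockDiag (shear t) (ContinuousLinearEquiv.refl ℝ _))) = s.cls x t := by
  refine congrArg (Quot.mk _) (Subtype.ext ?_)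
  change Γ.frame _ = (s.slice x t).1
  rw [Γ.frame_act u (memP_blockDiag _ _) (hasBlocks_blockDiag _ _), h]
  rfl

/-- `p` acts through its blocks `(A, B)`, and `A` preserves the line of `e₁` exactly when the lower
left entry of the `2 × 2` block vanishes. -/
lemma flag_act_eq_iff (hΓ : Γ.Induces 𝒬) (u : 𝒢) {p : Mat n} (hp : MemP p) :
    flag hΓ u = flag hΓ (Γ.act u p) ↔ MemQ p := by
  obtain ⟨A, B, h⟩ := hp.exists_hasBlocks
  obtain ⟨v, hv⟩ := exists_eq_mkFrame 𝒬 (hΓ u)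
  have hm : mkFrame _ v ∈ adaptedFrames 𝒬 := hv ▸ hΓ u
  have h1 : flag hΓ u = Quot.mk _ ⟨mkFrame _ v, hm⟩ := congrArg (Quot.mk _) (Subtype.ext hv)
  have h2 : flag hΓ (Γ.act u p) = Quot.mk _ ⟨mkFrame _ ((ContinuousLinearEquiv.arrowCongr A B :
      Std n ≃L[ℝ] Std n).trans v), moveFrame_mem 𝒬 hm A B⟩ := by
    refine congrArg (Quot.mk _) (Subtype.ext ?_)
    change Γ.frame _ = _
    rw [Γ.frame_act u hp h]
    exact congrArg (moveFrame · A B) hv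
  rw [h1, h2, mk_arrowCongr_eq_iff, e₁_eq]
  constructor
  · rintro ⟨c, hc⟩
    refine ⟨hp, ?_⟩
    rw [← h.1, hc]
    simp
  · rintro ⟨-, h0⟩
    refine ⟨p (Sum.inl 0) (Sum.inl 0), ?_⟩
    ext i; fin_cases i
    · simpa using h.1 0 0
    · simpa [h0] using h.1 1 0

/-- Adapted frames at a point differ by `(A, B)`, which is realized by the block diagonal element of
`P`. -/
lemma flag_surjective (hΓ : Γ.Induces 𝒬) : Function.Surjective (flag hΓ) := by
  intro c
  induction c using Quot.ind with
  | mk u =>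
  induction u using adaptedFrames_rec with
  | h x u hu =>
  obtain ⟨w, rfl⟩ := Γ.proj_surjective x
  obtain ⟨v, hv⟩ := exists_frame_eq_mkFrame hΓ (rfl : Γ.proj w = _)
  obtain ⟨A, B, rfl⟩ := exists_moveFrame 𝒬 (hv ▸ hΓ w) hu
  refine ⟨Γ.act w (blockDiag A B), congrArg (Quot.mk _) (Subtype.ext ?_)⟩
  change Γ.frame _ = _
  rw [Γ.frame_act w (memP_blockDiag _ _) (hasBlocks_blockDiag _ _), hv]
  rfl

lemma contMDiff_blockDiag_shear : ContMDiff 𝓘(ℝ, ℝ)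
    𝓘(ℝ, Fin 2 ⊕ Fin n → Fin 2 ⊕ Fin n → ℝ) ∞ (fun t => Matrix.of.symm
      (blockDiag (n := n) (shear t) (ContinuousLinearEquiv.refl ℝ _))) := by
  rw [contMDiff_iff_contDiff, contDiff_pi]
  intro i
  rw [contDiff_pi]
  intro j
  rcases i with i | i <;> rcases j with j | j
  · simp only [blockDiag, Matrix.of_symm_apply, Matrix.fromBlocks_apply₁₁,
      LinearMap.toMatrix'_apply]
    change ContDiff ℝ ∞ fun t => shear t (Pi.single j 1) i
    fin_cases i <;> fin_cases j <;> simp [shear_apply] <;> fun_prop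
  all_goals exact contDiff_const

variable [ChartedSpace (EuclideanSpace ℝ (Fin (2 * n)) × ℝ) (CorrSpace 𝒬)]
  [IsManifold (modelC n) ∞ (CorrSpace 𝒬)]
  (hq : IsSmoothQuotient (modelFrame n) (modelC n)
    (Subtype.val : adaptedFrames 𝒬 → FrameT n M) (sameFlag 𝒬))

include hq in
lemma smoothAlong_flag (hΓ : Γ.Induces 𝒬) :
    SmoothAlong (𝓡 (n ^ 2 + 4 * n + 3)) (modelC n) (id : 𝒢 → 𝒢) (flag hΓ) := by
  intro u
  refine ⟨Set.univ, isOpen_univ, trivial, flag hΓ, ?_, fun _ _ => rfl⟩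
  intro v _
  refine ContMDiffAt.contMDiffWithinAt ?_
  exact hq.contMDiffAt_mk_comp (τ := fun u => (⟨Γ.frame u, hΓ u⟩ : adaptedFrames 𝒬)) (Γ.contMDiff_frame v)

include hq in
/-- The correspondence space is the quotient of the Cartan bundle by the parabolic `Q`. -/
theorem exists_quot_sameOrbit_diffeo (hΓ : Γ.Induces 𝒬) :
    ∃ (_ : ChartedSpace (EuclideanSpace ℝ (Fin (2 * n)) × ℝ) (Quot Γ.sameOrbit))
      (_ : IsManifold (modelC n) ∞ (Quot Γ.sameOrbit)),
      IsSmoothQuotient (𝓡 (n ^ 2 + 4 * n + 3)) (modelC n) (id : 𝒢 → 𝒢) Γ.sameOrbit ∧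
      ∃ Θ : Diffeomorph (modelC n) (modelC n) (Quot Γ.sameOrbit) (CorrSpace 𝒬) ∞,
        ∀ u : 𝒢, Θ (Quot.mk _ u) = Quot.mk _ ⟨Γ.frame u, hΓ u⟩ := by
  refine exists_quotient_diffeo Topology.IsInducing.id Γ.sameOrbit (flag hΓ)
    (smoothAlong_flag hq hΓ) (flag_surjective hΓ) ?_ ?_ ?_
  · rintro u _ ⟨p, hp, rfl⟩
    exact (flag_act_eq_iff hΓ u hp.1).2 hp
  · intro u v huv
    obtain ⟨p, hp, rfl⟩ := (Γ.proj_eq_iff u v).1 (congrArg (CorrSpace.proj 𝒬) huv)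
    exact ⟨p, (flag_act_eq_iff hΓ u hp).1 huv, rfl⟩
  · intro u
    obtain ⟨U, σ, hU, hx, hσ, hσp, hσu⟩ := Γ.exists_section u
    obtain ⟨s, rfl, hs⟩ := exists_localFrame_of_section hΓ hU hσ hσp
    -- The section of `𝒢 → M` is sheared by the affine coordinate; at the class of `u` the
    -- coordinate is `0` and the value is `u`.
    let σ' : CorrSpace 𝒬 → 𝒢 := fun c => Γ.act (σ (CorrSpace.proj 𝒬 c))
      (blockDiag (shear (s.param c)) (ContinuousLinearEquiv.refl ℝ _))
    have hu : flag hΓ u = s.cls (Γ.proj u) 0 := by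
      rw [← flag_act_shear hΓ (hs _), shear_zero, blockDiag_refl, Γ.act_one, hσu]
    refine ⟨s.clsDom, s.isOpen_clsDom, ?_, σ', ?_, ?_, ?_⟩
    · rw [hu]
      exact s.cls_mem_clsDom hx 0
    · intro c hc
      refine ContMDiffAt.contMDiffWithinAt ?_
      have h1 : ContMDiffAt (modelC n) (𝓡 (n ^ 2 + 4 * n + 3)) ∞
          (fun c => σ (CorrSpace.proj 𝒬 c)) c :=
        ContMDiffAt.comp c (hσ.contMDiffAt (hU.mem_nhds (s.proj_mem_dom hc)))
          (CorrSpace.contMDiff_proj hq c)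
      have h2 := ContMDiffAt.comp c (contMDiff_blockDiag_shear (n := n)).contMDiffAt
        ((s.contMDiffOn_param hq).contMDiffAt (s.isOpen_clsDom.mem_nhds hc))
      exact Γ.smooth_act.contMDiffAt_comp (τ := fun c => ⟨(σ (CorrSpace.proj 𝒬 c),
        Matrix.of.symm (blockDiag (shear (s.param c)) (ContinuousLinearEquiv.refl ℝ _))),
          memP_blockDiag _ _⟩) (h1.prodMk h2)
    · change Γ.act _ _ = u
      rw [hu, s.param_cls, s.proj_cls, shear_zero, blockDiag_refl, Γ.act_one, hσu]
    · intro c hc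
      rw [flag_act_shear hΓ (hs _), s.cls_param hc]

end CartanGeometry

end Cartan

/-! ### Compatibility with arbitrary frames and with the projections to `M`. -/

section Canonical

variable {n : ℕ} [NeZero n] {M : Type*} [TopologicalSpace M]
  [ChartedSpace (EuclideanSpace ℝ (Fin (2 * n))) M] [IsManifold (𝓡 (2 * n)) ∞ M]
  {𝒬 : AlmostParaQuaternionic n M}
  [ChartedSpace (EuclideanSpace ℝ (Fin (2 * n)) × ℝ) (CorrSpace 𝒬)]
  [IsManifold (modelC n) ∞ (CorrSpace 𝒬)]
  (hq : IsSmoothQuotient (modelFrame n) (modelC n)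
    (Subtype.val : adaptedFrames 𝒬 → FrameT n M) (sameFlag 𝒬))

include hq in
lemma nilVelocity_eq_flagVelocity (u : adaptedFrames 𝒬) (A : zeroTwistor 𝒬)
    (C : TangentSpace (𝓡 (2 * n)) u.1.1 →L[ℝ] TangentSpace (𝓡 (2 * n)) u.1.1)
    (hA : A.1 = ⟨u.1.1, C⟩) (hC : ∀ X : Std n, C (u.1.2 X) = u.1.2 (X ∘L j₀ : Std n)) :
    nilVelocity A = flagVelocity 𝒬 u := by
  induction u using adaptedFrames_rec with
  | h x u hu =>
  have hC' : C = conjR u j₀ := (eq_conjR_iff u j₀ C).2 hC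
  rw [← nilVelocity_conjR hq hu]
  exact congrArg nilVelocity (Subtype.ext (hA.trans (congrArg (TotalSpace.mk x) hC')))

include hq in
lemma proj_eq_of_apply_mk {χ : ProjZeroTwistor 𝒬 → CorrSpace 𝒬}
    (h : ∀ A, χ (Quot.mk _ A) = (nilVelocity A).1) (z : ProjZeroTwistor 𝒬) :
    CorrSpace.proj 𝒬 (χ z) = ProjZeroTwistor.proj 𝒬 z := by
  induction z using Quot.ind with
  | mk A =>
  rw [h, proj_nilVelocity hq]
  rfl

end Canonical

section FlagOfVec

variable {n : ℕ} [NeZero n] {M : Type*} [TopologicalSpace M]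
  [ChartedSpace (EuclideanSpace ℝ (Fin (2 * n))) M] [IsManifold (𝓡 (2 * n)) ∞ M]
  {E F : M → Type*}
  [TopologicalSpace (TotalSpace (Fin 2 → ℝ) E)] [∀ x, AddCommGroup (E x)] [∀ x, Module ℝ (E x)]
  [∀ x, TopologicalSpace (E x)] [∀ x, IsTopologicalAddGroup (E x)]
  [∀ x, ContinuousSMul ℝ (E x)]
  [FiberBundle (Fin 2 → ℝ) E] [VectorBundle ℝ (Fin 2 → ℝ) E]
  [TopologicalSpace (TotalSpace (Fin n → ℝ) F)] [∀ x, AddCommGroup (F x)] [∀ x, Module ℝ (F x)]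
  [∀ x, TopologicalSpace (F x)] [∀ x, IsTopologicalAddGroup (F x)]
  [∀ x, ContinuousSMul ℝ (F x)]
  [FiberBundle (Fin n → ℝ) F] [VectorBundle ℝ (Fin n → ℝ) F]
  {ψ : ∀ x, (E x →L[ℝ] F x) ≃ₗ[ℝ] TangentSpace (𝓡 (2 * n)) x} {𝒬 : AlmostParaQuaternionic n M}

lemma flagOfVec_eq_mk (h : EquivalentTo ψ 𝒬) (u : adaptedFrames 𝒬)
    (e : (Fin 2 → ℝ) ≃L[ℝ] E u.1.1) (f : (Fin n → ℝ) ≃L[ℝ] F u.1.1) (v : NonzeroVec E)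
    (hu : ∀ X : Std n, u.1.2 X = ψ u.1.1
      (f.toContinuousLinearMap ∘L X ∘L e.symm.toContinuousLinearMap))
    (hv : v.1 = ⟨u.1.1, e e₁⟩) : flagOfVec h v = Quot.mk _ u := by
  obtain ⟨⟨x, L⟩, hL⟩ := u
  obtain ⟨v, hv0⟩ := v
  dsimp only at e f hu hv
  subst hv
  rw [flagOfVec_eq h e f (e e₁) hv0 1 one_ne_zero (one_smul _ _).symm]
  refine congrArg (Quot.mk _) (Subtype.ext (congrArg (TotalSpace.mk x) ?_))
  exact ContinuousLinearMap.ext fun X => (hu X).symm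

end FlagOfVec

end ParaQuat

end

/-! ### Assembly of the theorem. -/

set_option maxHeartbeats 2000000 in
theorem mainTheorem2 (n : ℕ) (hn : 2 ≤ n) (M : Type*) [TopologicalSpace M]
    [ChartedSpace (EuclideanSpace ℝ (Fin (2 * n))) M] [IsManifold (𝓡 (2 * n)) ∞ M]
    (𝒬 : AlmostParaQuaternionic n M) :
    -- the correspondence space is a quotient manifold of the bundle of adapted frames
    ∃ (_ : ChartedSpace (EuclideanSpace ℝ (Fin (2 * n)) × ℝ) (CorrSpace 𝒬))
      (_ : IsManifold (modelC n) ∞ (CorrSpace 𝒬)),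
      IsSmoothQuotient (modelFrame n) (modelC n)
        (Subtype.val : adaptedFrames 𝒬 → FrameT n M) (sameFlag 𝒬) ∧
      -- it is fibred over `M`, and the vertical subbundle has rank one
      ContMDiff (modelC n) (𝓡 (2 * n)) ∞ (CorrSpace.proj 𝒬) ∧
      Function.Surjective (CorrSpace.proj 𝒬) ∧
      (∀ c, Function.Surjective (mfderiv (modelC n) (𝓡 (2 * n)) (CorrSpace.proj 𝒬) c)) ∧
      (∀ c, Module.finrank ℝ
        (mfderiv (modelC n) (𝓡 (2 * n)) (CorrSpace.proj 𝒬) c).toLinearMap.ker = 1) ∧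
      -- the canonical identification of the 0-twistor space with the vertical subbundle
      (∃ Φ : zeroTwistor 𝒬 ≃ verticalNonzero 𝒬,
        SmoothAlong (modelEnd n) (modelC n).tangent
          (Subtype.val : zeroTwistor 𝒬 → EndT n M) (fun A => (Φ A).1) ∧
        SmoothAlong (modelC n).tangent (modelEnd n)
          (Subtype.val : verticalNonzero 𝒬 → TangentBundle (modelC n) (CorrSpace 𝒬))
          (fun v => (Φ.symm v).1) ∧
        (∀ A, CorrSpace.proj 𝒬 (Φ A).1.1 = A.1.1) ∧
        (∀ (u : adaptedFrames 𝒬) (A : zeroTwistor 𝒬)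
          (C : TangentSpace (𝓡 (2 * n)) u.1.1 →L[ℝ] TangentSpace (𝓡 (2 * n)) u.1.1),
          A.1 = ⟨u.1.1, C⟩ → (∀ X : Std n, C (u.1.2 X) = u.1.2 (X ∘L j₀ : Std n)) →
          (Φ A).1 = flagVelocity 𝒬 u) ∧
        (∀ (A B : zeroTwistor 𝒬) (c : ℝ), c ≠ 0 → B.1 = ⟨A.1.1, c • A.1.2⟩ →
          (Φ B).1 = ⟨(Φ A).1.1, c⁻¹ • (Φ A).1.2⟩) ∧
        -- the induced identification of the projectivization with the correspondence space
        ∃ (_ : ChartedSpace (EuclideanSpace ℝ (Fin (2 * n)) × ℝ) (ProjZeroTwistor 𝒬))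
          (_ : IsManifold (modelC n) ∞ (ProjZeroTwistor 𝒬)),
          IsSmoothQuotient (modelEnd n) (modelC n)
            (Subtype.val : zeroTwistor 𝒬 → EndT n M) (sameLine 𝒬) ∧
          ∃ χ : Diffeomorph (modelC n) (modelC n) (ProjZeroTwistor 𝒬) (CorrSpace 𝒬) ∞,
            (∀ A, χ (Quot.mk _ A) = (Φ A).1.1) ∧
            ∀ z, CorrSpace.proj 𝒬 (χ z) = ProjZeroTwistor.proj 𝒬 z) ∧
      -- the correspondence space is `𝒢/Q` for each normal parabolic geometry inducing the structure
      (∀ (𝒢 : Type*) [TopologicalSpace 𝒢]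
        [ChartedSpace (EuclideanSpace ℝ (Fin (n ^ 2 + 4 * n + 3))) 𝒢]
        [IsManifold (𝓡 (n ^ 2 + 4 * n + 3)) ∞ 𝒢] (Γ : CartanGeometry n M 𝒢)
        (_ : Γ.IsNormal) (hΓ : Γ.Induces 𝒬),
        ∃ (_ : ChartedSpace (EuclideanSpace ℝ (Fin (2 * n)) × ℝ) (Quot Γ.sameOrbit))
          (_ : IsManifold (modelC n) ∞ (Quot Γ.sameOrbit)),
          IsSmoothQuotient (𝓡 (n ^ 2 + 4 * n + 3)) (modelC n) (id : 𝒢 → 𝒢) Γ.sameOrbit ∧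
          ∃ Θ : Diffeomorph (modelC n) (modelC n) (Quot Γ.sameOrbit) (CorrSpace 𝒬) ∞,
            ∀ u : 𝒢, Θ (Quot.mk _ u) = Quot.mk _ ⟨Γ.frame u, hΓ u⟩) ∧
      -- the correspondence space is `P E` for each isomorphism `E* ⊗ F ≅ TM` giving the structure
      (∀ (E F : M → Type*)
        [TopologicalSpace (TotalSpace (Fin 2 → ℝ) E)] [∀ x, AddCommGroup (E x)]
        [∀ x, Module ℝ (E x)] [∀ x, TopologicalSpace (E x)] [∀ x, IsTopologicalAddGroup (E x)]
        [∀ x, ContinuousSMul ℝ (E x)]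
        [FiberBundle (Fin 2 → ℝ) E] [VectorBundle ℝ (Fin 2 → ℝ) E]
        [ContMDiffVectorBundle ∞ (Fin 2 → ℝ) E (𝓡 (2 * n))]
        [TopologicalSpace (TotalSpace (Fin n → ℝ) F)] [∀ x, AddCommGroup (F x)]
        [∀ x, Module ℝ (F x)] [∀ x, TopologicalSpace (F x)] [∀ x, IsTopologicalAddGroup (F x)]
        [∀ x, ContinuousSMul ℝ (F x)]
        [FiberBundle (Fin n → ℝ) F] [VectorBundle ℝ (Fin n → ℝ) F]
        [ContMDiffVectorBundle ∞ (Fin n → ℝ) F (𝓡 (2 * n))]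
        (ψ : ∀ x, (E x →L[ℝ] F x) ≃ₗ[ℝ] TangentSpace (𝓡 (2 * n)) x)
        (_ : SmoothIso ψ) (_ : EquivalentTo ψ 𝒬),
        ∃ (_ : ChartedSpace (EuclideanSpace ℝ (Fin (2 * n)) × ℝ) (ProjBundle E))
          (_ : IsManifold (modelC n) ∞ (ProjBundle E)),
          IsSmoothQuotient ((𝓡 (2 * n)).prod 𝓘(ℝ, Fin 2 → ℝ)) (modelC n)
            (Subtype.val : NonzeroVec E → TotalSpace (Fin 2 → ℝ) E) (sameLineE E) ∧
          ∃ Ψ : Diffeomorph (modelC n) (modelC n) (ProjBundle E) (CorrSpace 𝒬) ∞,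
            ∀ (u : adaptedFrames 𝒬) (e : (Fin 2 → ℝ) ≃L[ℝ] E u.1.1)
              (f : (Fin n → ℝ) ≃L[ℝ] F u.1.1) (v : NonzeroVec E),
              (∀ X : Std n, u.1.2 X = ψ u.1.1
                (f.toContinuousLinearMap ∘L X ∘L e.symm.toContinuousLinearMap)) →
              v.1 = ⟨u.1.1, e e₁⟩ → Ψ (Quot.mk _ v) = Quot.mk _ u) := by
  have : NeZero n := ⟨by omega⟩
  obtain ⟨cs, hm, hq⟩ := exists_corrSpace_manifold 𝒬
  refine ⟨cs, hm, hq, ?_, ?_, ?_, ?_, ?_, ?_, ?_⟩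
  · exact CorrSpace.contMDiff_proj hq
  · exact CorrSpace.proj_surjective 𝒬
  · exact CorrSpace.mfderiv_proj_surjective hq
  · exact CorrSpace.finrank_ker_mfderiv_proj hq
  · refine ⟨nilVelocityEquiv hq, ?_, ?_, ?_, ?_, ?_, ?_⟩
    · exact smoothAlong_nilVelocity hq
    · exact smoothAlong_nilVelocityEquiv_symm hq
    · exact proj_nilVelocity hq
    · exact nilVelocity_eq_flagVelocity hq
    · exact fun A B c hc h => nilVelocity_smul hq hc h
    · obtain ⟨cs', hm', hq', χ, hχ⟩ := exists_projZeroTwistor_diffeo hq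
      exact ⟨cs', hm', hq', χ, hχ, proj_eq_of_apply_mk hq hχ⟩
  · intro 𝒢 _ _ _ Γ _ hΓ
    exact CartanGeometry.exists_quot_sameOrbit_diffeo hq hΓ
  · intro E F _ _ _ _ _ _ _ _ _ _ _ _ _ _ _ _ _ _ ψ hψ h
    obtain ⟨cs', hm', hq', Ψ, hΨ⟩ := exists_projBundle_diffeo hq hψ h
    exact ⟨cs', hm', hq', Ψ, fun u e f v hu hv =>
      (hΨ v).trans (flagOfVec_eq_mk h u e f v hu hv)⟩
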